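/- **Definitions.** Let $(R,\mathfrak m)$ be a Cohen–Macaulay (in particular Noetherian) local ring. * A proper ideal $I$ of $R$ is *equimultiple* if its analytic spread, the Krull dimension of the fiber cone $\bigoplus_{i\ge 0} I^i/\mathfrak m I^i$, equals its height. An equimultiple ideal $I$ of height $s$ is an *Ulrich ideal* if the associated graded ring $\mathrm{gr}_I(R)=\bigoplus_{i\ge 0}I^i/I^{i+1}$ is a Cohen–Macaulay ring with $\mathrm a(\mathrm{gr}_I(R))=1-s$ and $I/I^2$ is a free $R/I$-module. Here the $\mathrm a$-invariant of a graded ring $G$ of dimension $d$ with graded maximal ideal $M$ is the largest degree in which the local cohomology $H^d_M(G)$ is nonzero. * An ideal $Q\subseteq I$ is a *reduction* of $I$ if $I^{r+1}=QI^r$ for some $r\ge 0$; it is *minimal* if it contains no smaller reduction of $I$. * For ideals $Q \subseteq J$ of $R$ let $\mathcal R(J)=R[Jt]$ and $\mathcal R(Q)=R[Qt]$ be the Rees algebras. The *Sally module* is the graded $\mathcal R(Q)$-module $\mathcal S_Q(J)=J\mathcal R(J)/J\mathcal R(Q)\cong\bigoplus_{i\ge1}J^{i+1}/JQ^i$. If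 $Q$ is generated by a system of parameters of $R$, then $\mathfrak p=\mathfrak m\mathcal R(Q)$ is a prime ideal, and $\operatorname{rank}\mathcal S_Q(J)$ is the length of the $\mathcal R(Q)_{\mathfrak p}$-module $\mathcal S_Q(J)_{\mathfrak p}$. * For an integer $n\ge 0$, a Cohen–Macaulay local ring $R$ of dimension $d>0$ is an *$n$-Goto ring* if there are a proper ideal $K$ of $R$ that is a canonical module of $R$, and a system of parameters $x_1,\dots,x_d$ of $R$ with $x_1\in K$, such that for $Q=(x_1,\dots,x_d)$ and $J=K+Q$ the Sally module $\mathcal S_Q(J)$ has rank $n$ and is generated over $\mathcal R(Q)$ by its homogeneous elements of degree one. * For an ideal $I$ of a commutative ring $A$ and $\alpha\in A$, the *quasi-trivial extension* $A\overset{\alpha}{\ltimes}I$ is the additive group $A\oplus I$ with the multiplication $(a,x)(b,y)=(ab,\,ay+bx+\alpha xy)$. **Theorem 10.4.** Let $(A,\mathfrak m)$ be a Gorenstein local ring of dimension $d>0$, and let $I$ be an equimultiple Ulrich ideal of $A$ of height one which has a principal ideal $(a_1)$ as a minimal reduction. Let $a_2,\dots,a_d\in A$ be elements whose images form a system of parameters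 of $A/I$, and set $J=I+(a_2,\dots,a_d)$. Then the multiplicity $\mathrm e_0(J)$ of $A$ with respect to the $\mathfrak m$-primary ideal $J$ (the leading Hilbert coefficient of $J$) is even, say $\mathrm e_0(J)=2n$, and the quasi-trivial extension $A\overset{\alpha}{\ltimes}I$ is an $n$-Goto ring for every $\alpha\in A$. In particular, the idealization $A\ltimes I$ and the fiber product $A\times_{A/I}A$ of two copies of the canonical surjection $A \to A/I$ are $n$-Goto rings. -/

import Mathlib

open Polynomial

universe u

noncomputable section

namespace GotoRing

/-! ### Cohen–Macaulay rings, Gorenstein rings, canonical modules -/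

/-- `M` is a maximal Cohen–Macaulay module over the local ring `R`: it is finitely generated and
there is an `M`-regular sequence of length `dim R` in the maximal ideal (`depth M = dim R`). -/
def IsMaximalCohenMacaulay (R : Type u) [CommRing R] [IsLocalRing R]
    (M : Type u) [AddCommGroup M] [Module R M] : Prop :=
  Module.Finite R M ∧ ∃ rs : List R, (∀ r ∈ rs, r ∈ IsLocalRing.maximalIdeal R) ∧
    RingTheory.Sequence.IsRegular M rs ∧ ringKrullDim R = (rs.length : ℕ)

/-- A Cohen–Macaulay local ring: Noetherian with `depth R = dim R`. -/
def IsCohenMacaulayLocalRing (R : Type u) [CommRing R] [IsLocalRing R] : Prop :=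
  IsNoetherianRing R ∧ IsMaximalCohenMacaulay R R

/-- A Cohen–Macaulay ring: Noetherian, and all localizations at primes are Cohen–Macaulay. -/
def IsCohenMacaulayRing (R : Type u) [CommRing R] : Prop :=
  IsNoetherianRing R ∧
    ∀ (p : Ideal R) [p.IsPrime], IsCohenMacaulayLocalRing (Localization.AtPrime p)

/-- The `R`-module `M` has finite injective dimension. -/
def HasFiniteInjectiveDimension (R : Type u) [CommRing R]
    (M : Type u) [AddCommGroup M] [Module R M] : Prop :=
  ∃ n : ℕ, CategoryTheory.HasInjectiveDimensionLE (ModuleCat.of R M) n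

/-- A Gorenstein local ring: a Cohen–Macaulay local ring of finite self-injective dimension. -/
def IsGorensteinLocalRing (R : Type u) [CommRing R] [IsLocalRing R] : Prop :=
  IsCohenMacaulayLocalRing R ∧ HasFiniteInjectiveDimension R R

/-- `K` is a canonical module of the Cohen–Macaulay local ring `R`: a maximal Cohen–Macaulay
module of finite injective dimension whose endomorphisms are exactly the homotheties,
`R = End_R(K)`. -/
def IsCanonicalModule (R : Type u) [CommRing R] [IsLocalRing R]
    (K : Type u) [AddCommGroup K] [Module R K] : Prop :=
  IsMaximalCohenMacaulay R K ∧ HasFiniteInjectiveDimension R K ∧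
    Function.Bijective (algebraMap R (Module.End R K))

/-! ### Parameters, reductions, Hilbert coefficients -/

/-- `x₁, …, xₙ` (or rather their images) form a system of parameters of `R/I`, for an ideal `I` of
a local ring `R`: `n = dim R/I`, and `I + (x₁, …, xₙ)` is primary to the maximal ideal. -/
def IsSystemOfParametersMod {R : Type u} [CommRing R] [IsLocalRing R] (I : Ideal R)
    {n : ℕ} (x : Fin n → R) : Prop :=
  ringKrullDim (R ⧸ I) = n ∧
    (I ⊔ Ideal.span (Set.range x)).radical = IsLocalRing.maximalIdeal R

/-- `x₁, …, xₙ` is a system of parameters of the local ring `R`. -/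
def IsSystemOfParameters {R : Type u} [CommRing R] [IsLocalRing R]
    {n : ℕ} (x : Fin n → R) : Prop :=
  ringKrullDim R = n ∧ (Ideal.span (Set.range x)).radical = IsLocalRing.maximalIdeal R

/-- `Q ⊆ J` is a reduction of `J`: `J ^ (r + 1) = Q J ^ r` for some `r ≥ 0`. -/
def IsReduction {R : Type u} [CommRing R] (Q J : Ideal R) : Prop :=
  Q ≤ J ∧ ∃ r : ℕ, J ^ (r + 1) = Q * J ^ r

/-- A reduction of `J` that contains no smaller reduction of `J`. -/
def IsMinimalReduction {R : Type u} [CommRing R] (Q J : Ideal R) : Prop :=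
  IsReduction Q J ∧ ∀ Q' : Ideal R, IsReduction Q' J → Q' ≤ Q → Q' = Q

/-- `e 0, …, e d` are the Hilbert coefficients of `J`, where `d = dim R`: for all large `n`,
`ℓ(R/J^(n+1)) = ∑ᵢ (-1)ⁱ eᵢ (n+d-i choose d-i)`. -/
def IsHilbertCoefficients {R : Type u} [CommRing R] (J : Ideal R) (d : ℕ) (e : ℕ → ℤ) : Prop :=
  ringKrullDim R = d ∧ ∃ N : ℕ, ∀ n ≥ N, ∃ l : ℕ,
    Module.length R (R ⧸ J ^ (n + 1)) = l ∧
      (l : ℤ) = ∑ i ∈ Finset.range (d + 1), (-1) ^ i * e i * ((n + d - i).choose (d - i) : ℤ)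

/-- `e₀(J) = m`. -/
def IsMultiplicity {R : Type u} [CommRing R] (J : Ideal R) (m : ℤ) : Prop :=
  ∃ (d : ℕ) (e : ℕ → ℤ), IsHilbertCoefficients J d e ∧ e 0 = m

/-! ### Graded local cohomology and the `a`-invariant -/

/-- The localization `G_{x_S}` of `G` at the product `x_S` of the `xᵢ`, `i ∈ S`. -/
abbrev CechLoc {G : Type u} [CommRing G] {r : ℕ} (x : Fin r → G) (S : Finset (Fin r)) : Type u :=
  Localization.Away (∏ i ∈ S, x i)

theorem cech_isUnit {G : Type u} [CommRing G] {r : ℕ} (x : Fin r → G) {S S' : Finset (Fin r)}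
    (h : S ⊆ S') : IsUnit (algebraMap G (CechLoc x S') (∏ i ∈ S, x i)) :=
  isUnit_of_dvd_unit (map_dvd _ (Finset.prod_dvd_prod_of_subset S S' x h))
    (IsLocalization.Away.algebraMap_isUnit (S := CechLoc x S') (∏ i ∈ S', x i))

/-- The canonical map `G_{x_S} → G_{x_{S'}}` for `S ⊆ S'`. -/
def cechRes {G : Type u} [CommRing G] {r : ℕ} (x : Fin r → G) {S S' : Finset (Fin r)}
    (h : S ⊆ S') : CechLoc x S →+* CechLoc x S' :=
  Localization.awayLift (algebraMap G (CechLoc x S')) (∏ i ∈ S, x i) (cech_isUnit x h)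

/-- The differential of the (extended) Čech complex `0 → G → ∏ G_{xᵢ} → ∏ G_{xᵢxⱼ} → ⋯`. Its
degree `p` term is the product of the `G_{x_S}` over the sets `S` with `p` elements. -/
def cechD {G : Type u} [CommRing G] {r : ℕ} (x : Fin r → G) (c : ∀ S, CechLoc x S)
    (S : Finset (Fin r)) : CechLoc x S :=
  ∑ j ∈ S, (-1) ^ (S.filter (· < j)).card * cechRes x (S.erase_subset j) (c (S.erase j))

/-- `z ∈ G_{x_S}` is homogeneous of degree `n`, i.e. `z = g / x_S ^ t` with `g ∈ G` homogeneous of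
degree `n + t deg x_S` (zero counts as homogeneous of every degree); here `𝒢 k` is the degree `k`
part of `G` and `xᵢ ∈ 𝒢 (δ i)`. -/
def IsCechHomogeneous {G : Type u} [CommRing G] (𝒢 : ℕ → AddSubgroup G) {r : ℕ} (x : Fin r → G)
    (δ : Fin r → ℕ) (n : ℤ) (S : Finset (Fin r)) (z : CechLoc x S) : Prop :=
  ∃ (t : ℕ) (g : G), (g = 0 ∨ ∃ k : ℕ, g ∈ 𝒢 k ∧ (k : ℤ) = n + t * ∑ i ∈ S, (δ i : ℤ)) ∧
    z * algebraMap G (CechLoc x S) (∏ i ∈ S, x i) ^ t = algebraMap G (CechLoc x S) g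

/-- The degree `n` part of the `p`-th Čech cohomology of `G` with respect to `x` is nonzero: there
is a `p`-cocycle, homogeneous of degree `n`, which is not a coboundary. -/
def CechCohomologyNonzero {G : Type u} [CommRing G] (𝒢 : ℕ → AddSubgroup G) {r : ℕ}
    (x : Fin r → G) (δ : Fin r → ℕ) (p : ℕ) (n : ℤ) : Prop :=
  ∃ c : ∀ S, CechLoc x S,
    (∀ S, S.card = p → IsCechHomogeneous 𝒢 x δ n S (c S)) ∧
    (∀ S, S.card = p + 1 → cechD x c S = 0) ∧
    ¬ ∃ b : ∀ S, CechLoc x S, ∀ S, S.card = p → cechD x b S = c S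

/-- `a(G) = a`, for a Noetherian ring `G`, graded by `𝒢`, whose degree zero part is local, with
graded maximal ideal `M`: `a` is the largest degree in which the local cohomology `H^d_M(G)`,
`d = dim G`, does not vanish. The graded module `H^d_M(G)` is computed by the Čech complex of a
finite sequence of homogeneous elements that generates `M` up to radical. Such sequences exist,
and the graded cohomology does not depend on the choice. -/
def HasAInvariant {G : Type u} [CommRing G] (𝒢 : ℕ → AddSubgroup G) (M : Ideal G) (a : ℤ) :
    Prop :=
  ∃ d : ℕ, ringKrullDim G = d ∧
    ∀ (r : ℕ) (x : Fin r → G) (δ : Fin r → ℕ), (∀ i, x i ∈ 𝒢 (δ i)) →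
      (Ideal.span (Set.range x)).radical = M →
      IsGreatest {n : ℤ | CechCohomologyNonzero 𝒢 x δ d n} a

/-! ### Blow-up algebras and equimultiple Ulrich ideals -/

/-- The Rees algebra `R(I) = R[It] ⊆ R[t]`: the ring `reesAlgebra I`, made a type of its own. -/
def Rees {R : Type u} [CommRing R] (I : Ideal R) : Type u := reesAlgebra I

instance {R : Type u} [CommRing R] (I : Ideal R) : CommRing (Rees I) :=
  inferInstanceAs (CommRing (reesAlgebra I))

instance {R : Type u} [CommRing R] (I : Ideal R) : Algebra R (Rees I) :=
  inferInstanceAs (Algebra R (reesAlgebra I))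

/-- The inclusion `R(I) ⊆ R[t]`. -/
def reesVal {R : Type u} [CommRing R] (I : Ideal R) : Rees I →+* R[X] :=
  ((reesAlgebra I).val : reesAlgebra I →+* R[X])

instance {R : Type u} [CommRing R] (I : Ideal R) : Algebra (Rees I) R[X] := (reesVal I).toAlgebra

instance {R : Type u} [CommRing R] (I : Ideal R) : IsScalarTower R (Rees I) R[X] :=
  IsScalarTower.of_algebraMap_eq' rfl

/-- The fiber cone `F(I) = ⨁ Iⁿ/𝔪Iⁿ = R(I)/𝔪R(I)`. -/
abbrev FiberCone {R : Type u} [CommRing R] [IsLocalRing R] (I : Ideal R) : Type u :=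
  Rees I ⧸ (IsLocalRing.maximalIdeal R).map (algebraMap R (Rees I))

/-- `I` is equimultiple: it is proper and its analytic spread `dim F(I)` equals its height. -/
def IsEquimultiple {R : Type u} [CommRing R] [IsLocalRing R] (I : Ideal R) : Prop :=
  I ≠ ⊤ ∧ ringKrullDim (FiberCone I) = (I.height : WithBot ℕ∞)

/-- The associated graded ring `gr_I(R) = ⨁ Iⁿ/Iⁿ⁺¹ = R(I)/I R(I)`. -/
abbrev AssocGraded {R : Type u} [CommRing R] (I : Ideal R) : Type u :=
  Rees I ⧸ I.map (algebraMap R (Rees I))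

/-- The degree `n` part `Iⁿ/Iⁿ⁺¹` of `gr_I(R)`: the classes of the monomials `c tⁿ`, `c ∈ Iⁿ`. -/
def grPart {R : Type u} [CommRing R] (I : Ideal R) (n : ℕ) : AddSubgroup (AssocGraded I) :=
  ((LinearMap.range (monomial n : R →ₗ[R] R[X])).toAddSubgroup.comap
    (reesVal I).toAddMonoidHom).map
    (Ideal.Quotient.mk (I.map (algebraMap R (Rees I)))).toAddMonoidHom

/-- The graded maximal ideal of `gr_I(R)`, generated by `𝔪` and the elements of positive degree. -/
def grMaximalIdeal {R : Type u} [CommRing R] [IsLocalRing R] (I : Ideal R) :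
    Ideal (AssocGraded I) :=
  (IsLocalRing.maximalIdeal R).map (algebraMap R (AssocGraded I)) ⊔
    Ideal.span (⋃ n : ℕ, (grPart I (n + 1) : Set (AssocGraded I)))

/-- An Ulrich ideal: an equimultiple ideal `I` of height `s` such that `gr_I(R)` is
Cohen–Macaulay with `a(gr_I(R)) = 1 - s`, and `I/I²` is a free `R/I`-module. -/
def IsUlrichIdeal {R : Type u} [CommRing R] [IsLocalRing R] (I : Ideal R) : Prop :=
  IsEquimultiple I ∧
  IsCohenMacaulayRing (AssocGraded I) ∧
  (∃ s : ℕ, I.height = s ∧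
    HasAInvariant (G := AssocGraded I) (grPart I) (grMaximalIdeal I) (1 - (s : ℤ))) ∧
  Module.Free (R ⧸ I) I.Cotangent

/-! ### Sally modules and Goto rings -/

/-- For ideals `J`, `L`, `Q` of `R` the `R(Q)`-submodule of `R[t]` generated by `J · R(L)`. For
`Q ≤ L` this is the ideal `J R(L)` of `R(L)`, viewed as a module over `R(Q)`. -/
def mulRees {R : Type u} [CommRing R] (Q J L : Ideal R) : Submodule (Rees Q) R[X] :=
  Submodule.span (Rees Q) {f | ∃ c ∈ J, ∃ g ∈ reesAlgebra L, f = C c * g}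

/-- The Sally module `S_Q(J) = J R(J) / J R(Q)`, a module over `R(Q)`, for ideals `Q ≤ J`. -/
abbrev SallyModule {R : Type u} [CommRing R] (Q J : Ideal R) : Type u :=
  ↥(mulRees Q J J) ⧸ (mulRees Q J Q).submoduleOf (mulRees Q J J)

/-- The degree one part `[S_Q(J)]₁ = J²/JQ` of the Sally module. -/
def sallyDegreeOne {R : Type u} [CommRing R] (Q J : Ideal R) : Set (SallyModule Q J) :=
  {s | ∃ f : ↥(mulRees Q J J), (∃ c : R, (f : R[X]) = monomial 1 c) ∧ Submodule.Quotient.mk f = s}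

/-- `rank S_Q(J) = n`: the length of `S_Q(J)` localized at `𝔭 = 𝔪R(Q)`. For a parameter ideal `Q`
the ideal `𝔭` is always prime. -/
def HasSallyRank {R : Type u} [CommRing R] [IsLocalRing R] (Q J : Ideal R) (n : ℕ) : Prop :=
  ∃ _ : ((IsLocalRing.maximalIdeal R).map (algebraMap R (Rees Q))).IsPrime,
    Module.length
      (Localization.AtPrime ((IsLocalRing.maximalIdeal R).map (algebraMap R (Rees Q))))
      (LocalizedModule
        ((IsLocalRing.maximalIdeal R).map (algebraMap R (Rees Q))).primeCompl
        (SallyModule Q J)) = n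

/-- `R` is an `n`-Goto ring: a Cohen–Macaulay local ring of dimension `d > 0` with a canonical
ideal `I` (a proper ideal that is a canonical module) and a system of parameters `a₁, …, a_d` such
that, for `Q = (a₁, …, a_d)` and `J = I + Q`, one has `a₁ ∈ I`, `rank S_Q(J) = n`, and `S_Q(J)` is
generated by its elements of degree one. -/
def IsGotoRing (n : ℕ) (R : Type u) [CommRing R] : Prop :=
  ∃ _ : IsLocalRing R, IsCohenMacaulayLocalRing R ∧
    ∃ (d : ℕ) (hd : 0 < d) (I : Ideal R) (a : Fin d → R),
      I ≠ ⊤ ∧ IsCanonicalModule R I ∧ IsSystemOfParameters a ∧ a ⟨0, hd⟩ ∈ I ∧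
      HasSallyRank (Ideal.span (Set.range a)) (I ⊔ Ideal.span (Set.range a)) n ∧
      Submodule.span (Rees (Ideal.span (Set.range a)))
        (sallyDegreeOne (Ideal.span (Set.range a)) (I ⊔ Ideal.span (Set.range a))) = ⊤

/-! ### Quasi-trivial extensions and fiber products -/

/-- The quasi-trivial extension `A ⋉^α I`, whose additive group is `A ⊕ I`. -/
def QuasiTrivialExtension {A : Type u} [CommRing A] (I : Ideal A) (_α : A) : Type u := A × I

namespace QuasiTrivialExtension

variable {A : Type u} [CommRing A] {I : Ideal A} {α : A}

instance : AddCommGroup (QuasiTrivialExtension I α) := inferInstanceAs (AddCommGroup (A × I))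

/-- `(a, x) (b, y) = (a b, a y + b x + α x y)`. -/
instance : Mul (QuasiTrivialExtension I α) :=
  ⟨fun p q => (p.1 * q.1, p.1 • q.2 + q.1 • p.2 + α • ((p.2 : A) • q.2))⟩

instance : One (QuasiTrivialExtension I α) := ⟨((1 : A), (0 : I))⟩

theorem ext' {p q : QuasiTrivialExtension I α} (h₁ : p.1 = q.1) (h₂ : (p.2 : A) = q.2) : p = q :=
  Prod.ext h₁ (Subtype.ext h₂)

theorem one_fst : (1 : QuasiTrivialExtension I α).1 = 1 := rfl

theorem one_snd : ((1 : QuasiTrivialExtension I α).2 : A) = 0 := rfl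

theorem zero_fst : (0 : QuasiTrivialExtension I α).1 = 0 := rfl

theorem zero_snd : ((0 : QuasiTrivialExtension I α).2 : A) = 0 := rfl

theorem add_fst (p q : QuasiTrivialExtension I α) : (p + q).1 = p.1 + q.1 := rfl

theorem add_snd (p q : QuasiTrivialExtension I α) : ((p + q).2 : A) = p.2 + q.2 := rfl

theorem mul_fst (p q : QuasiTrivialExtension I α) : (p * q).1 = p.1 * q.1 := rfl

theorem mul_snd (p q : QuasiTrivialExtension I α) :
    ((p * q).2 : A) = p.1 * q.2 + q.1 * p.2 + α * (p.2 * q.2) := rfl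

instance : CommRing (QuasiTrivialExtension I α) where
  __ := (inferInstance : AddCommGroup (QuasiTrivialExtension I α))
  mul := (· * ·)
  one := 1
  left_distrib p q r := by
    refine ext' ?_ ?_ <;> simp only [mul_fst, mul_snd, add_fst, add_snd] <;> ring
  right_distrib p q r := by
    refine ext' ?_ ?_ <;> simp only [mul_fst, mul_snd, add_fst, add_snd] <;> ring
  zero_mul p := by
    refine ext' ?_ ?_ <;> simp only [mul_fst, mul_snd, zero_fst, zero_snd] <;> ring
  mul_zero p := by
    refine ext' ?_ ?_ <;> simp only [mul_fst, mul_snd, zero_fst, zero_snd] <;> ring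
  mul_assoc p q r := by
    refine ext' ?_ ?_ <;> simp only [mul_fst, mul_snd] <;> ring
  one_mul p := by
    refine ext' ?_ ?_ <;> simp only [mul_fst, mul_snd, one_fst, one_snd] <;> ring
  mul_one p := by
    refine ext' ?_ ?_ <;> simp only [mul_fst, mul_snd, one_fst, one_snd] <;> ring
  mul_comm p q := by
    refine ext' ?_ ?_ <;> simp only [mul_fst, mul_snd] <;> ring

end QuasiTrivialExtension

/-- The fiber product `A ×_{A/I} A` of two copies of the canonical surjection `A → A/I`, the
subring of `A × A` of the pairs `(a, b)` with `a ≡ b` modulo `I`. -/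
def fiberProduct {A : Type u} [CommRing A] (I : Ideal A) : Subring (A × A) :=
  RingHom.eqLocus ((Ideal.Quotient.mk I).comp (RingHom.fst A A))
    ((Ideal.Quotient.mk I).comp (RingHom.snd A A))

end GotoRing

end

noncomputable section

namespace GotoRing

/-! ### Systems of parameters as regular sequences -/

section Parameters

open RingTheory.Sequence IsLocalRing Module

variable {R : Type*} [CommRing R] [IsLocalRing R] [IsNoetherianRing R]

/-! The hypotheses on `I` are first turned into relations between two elements. Write `a` for the
generator of the reduction. In the Cohen–Macaulay ring `gr_I(A)`, the class of `a t` and those of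
the `bᵢ` generate the graded maximal ideal up to radical. If an element of degree `k ≥ 2` lay
outside the ideal of these parameters, dividing it by their product would give a nonzero top Čech
class of degree `k - 1 > 0`, against a-invariant zero; with Nakayama this yields `I² = aI`. If `I =
(a)`, every top class of degree zero would vanish, so `I ≠ (a)`. Both facts are
`sq_eq_and_ne_of_hasAInvariant_zero`.

As `I/I²` is free, `a` can be completed to generators `a, cⱼ` of `I` whose relations have all
`cⱼ`-coefficients in `I`. Then `I² = aI` makes `I` a retract of its first syzygy, so `Extⁱ(I, A) =
0` for `i ≥ 1` because `A` has finite injective dimension, and this vanishing leaves room for a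
single `c` (`exists_isGoodPair`). Thus `I = (a, c)`, `I² = aI` and `I/(a) ≅ A/I`.

Evenness: the sequence `0 → A/I → A/(a) → A/I → 0` remains exact modulo the `bᵢ`, so `ℓ(A/Q) =
2ℓ(A/J)` for `Q = (a, b)`. As `J² = QJ`, this length is `e₀(J)`, and `n = ℓ(A/J)`
(`isMultiplicity_of_sq_eq`).

Goto property: all three rings have the form `R = A ⊕ I` for some `α` (`IsIdealExtension`; `α` is
`0` for the idealization and `1` for the fiber product). The ideal `K = I ⊕ aA` of `R` is isomorphic
to `Hom_A(R, A)`, hence canonical. Over `R`, `K + QR = QR + (c, ε)`, where `ε` is `a` placed in the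
summand `I`. The relations `c² ∈ a(a, c)` and `ε² = αaε` show that `cε` alone generates the Sally
module, in degree one. Its annihilator is extended from the preimage `𝔏` of `J` in `R`. Since `QR`
is generated by a quasi-regular sequence, the length of `R(QR)/𝔏R(QR)` at `𝔪R(QR)` is `ℓ(R/𝔏) =
ℓ(A/J) = n`. -/

theorem supportDim_le_add_length (rs : List R) (hrs : ∀ r ∈ rs, r ∈ maximalIdeal R)
    (M : Type*) [AddCommGroup M] [Module R M] [Module.Finite R M] :
    supportDim R M ≤ supportDim R (M ⧸ (Ideal.ofList rs • ⊤ : Submodule R M)) + rs.length := by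
  induction rs generalizing M with
  | nil =>
    rw [Ideal.ofList_nil, Submodule.bot_smul]
    simpa using (supportDim_eq_of_equiv (Submodule.quotEquivOfEqBot (⊥ : Submodule R M) rfl)).ge
  | cons x rs ih =>
    rw [supportDim_eq_of_equiv (Submodule.quotOfListConsSMulTopEquivQuotSMulTopInner M x _)]
    refine (supportDim_le_supportDim_quotSMulTop_succ (hrs x (by simp))).trans ?_
    have := ih (fun r hr => hrs r (by simp [hr])) (QuotSMulTop x M)
    rw [List.length_cons, Nat.cast_add, ← add_assoc]
    exact add_le_add this le_rfl

/-- If `x` were a zero divisor, an associated prime containing it would lie in the support of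
`M/xM`, so it would be the maximal ideal; but then it would contain the regular element `w`. -/
theorem isSMulRegular_of_supportDim_eq_zero {M : Type*} [AddCommGroup M] [Module R M]
    [Module.Finite R M] {w x : R} (hw : w ∈ maximalIdeal R) (hwr : IsSMulRegular M w)
    (hx : supportDim R (QuotSMulTop x M) = 0) : IsSMulRegular M x := by
  by_contra hxr
  have hmem : x ∈ ⋃ p ∈ associatedPrimes R M, (p : Set R) := by
    rw [biUnion_associatedPrimes_eq_compl_regular]; exact hxr
  simp only [Set.mem_iUnion] at hmem
  obtain ⟨p, hp, hxp⟩ := hmem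
  have hwp : w ∉ p := fun h => by
    have : w ∈ ⋃ p ∈ associatedPrimes R M, (p : Set R) := by
      simp only [Set.mem_iUnion]; exact ⟨p, hp, h⟩
    rw [biUnion_associatedPrimes_eq_compl_regular] at this
    exact this hwr
  have hpp : p.IsPrime := hp.isPrime
  have hsup : (⟨p, hpp⟩ : PrimeSpectrum R) ∈ support R (QuotSMulTop x M) := by
    rw [support_quotSMulTop]
    refine ⟨?_, by simpa using hxp⟩
    exact mem_support_iff_of_finite.mpr (Submodule.annihilator_top (R := R) (M := M) ▸ hp.annihilator_le)
  rw [support_of_supportDim_eq_zero R _ hx, PrimeSpectrum.mem_zeroLocus] at hsup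
  exact hwp (hsup hw)

/-- In a finite module having a regular sequence of length `n`, every system of parameters of
length `n` is a regular sequence. -/
theorem isWeaklyRegular_of_supportDim_eq_zero (n : ℕ) :
    ∀ (M : Type u) [AddCommGroup M] [Module R M] [Module.Finite R M] (ys xs : List R),
      ys.length = n → xs.length = n → (∀ r ∈ ys, r ∈ maximalIdeal R) →
      (∀ r ∈ xs, r ∈ maximalIdeal R) → IsWeaklyRegular M ys →
      supportDim R (M ⧸ (Ideal.ofList xs • ⊤ : Submodule R M)) = 0 → IsWeaklyRegular M xs := by
  induction n with
  | zero =>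
    intro M _ _ _ ys xs _ hxl _ _ _ _
    rw [List.length_eq_zero_iff] at hxl
    subst hxl
    exact .nil R M
  | succ n ih =>
    -- Exchange argument: an element `w` regular modulo `ys` and a parameter modulo `xs` replaces
    -- `y` at the head of `ys`. The induction hypothesis over `M/wM` passes from `ys` to `xs`, and
    -- finally `w` is replaced by `x`.
    intro M _ _ _ ys xs hyl hxl hym hxm hy hx
    obtain ⟨y, ys, rfl⟩ : ∃ y ys', ys = y :: ys' := by
      cases ys with
      | nil => simp at hyl
      | cons y ys => exact ⟨y, ys, rfl⟩
    obtain ⟨x, xs, rfl⟩ : ∃ x xs', xs = x :: xs' := by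
      cases xs with
      | nil => simp at hxl
      | cons x xs => exact ⟨x, xs, rfl⟩
    simp only [List.length_cons, Nat.add_right_cancel_iff] at hyl hxl
    have hym' : ∀ r ∈ ys, r ∈ maximalIdeal R := fun r hr => hym r (by simp [hr])
    have hxm' : ∀ r ∈ xs, r ∈ maximalIdeal R := fun r hr => hxm r (by simp [hr])
    have hMnt : Nontrivial M := by
      have : Nontrivial (M ⧸ (Ideal.ofList (x :: xs) • ⊤ : Submodule R M)) := by
        rw [← supportDim_ne_bot_iff_nontrivial R, hx]; simp
      exact (Submodule.mkQ_surjective (Ideal.ofList (x :: xs) • ⊤ : Submodule R M)).nontrivial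
    -- `M / ys M` has depth at least one
    have hy' := isWeaklyRegular_of_perm_of_subset_maximalIdeal hy
      (List.perm_append_singleton y ys).symm hym
    rw [isWeaklyRegular_append_iff, isWeaklyRegular_singleton_iff] at hy'
    -- `M / xs M` has dimension one
    set N := M ⧸ (Ideal.ofList xs • ⊤ : Submodule R M) with hN
    have hxN : supportDim R (QuotSMulTop x N) = 0 := by
      rw [← hx]
      exact (supportDim_eq_of_equiv
        (Submodule.quotOfListConsSMulTopEquivQuotSMulTopOuter M x xs)).symm
    have hdimM : ((n + 1 : ℕ) : WithBot ℕ∞) ≤ supportDim R M := by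
      have hreg := IsRegular.of_isWeaklyRegular_of_mem_maximalIdeal M hym hy
      rw [← supportDim_add_length_eq_supportDim_of_isRegular _ hreg, List.length_cons, hyl]
      have : Nontrivial (M ⧸ (Ideal.ofList (y :: ys) • ⊤ : Submodule R M)) :=
        hreg.quot_ofList_smul_nontrivial ⊤
      have h0 : 0 ≤ supportDim R (M ⧸ (Ideal.ofList (y :: ys) • ⊤ : Submodule R M)) := by
        have hne := supportDim_ne_bot_of_nontrivial R
          (M ⧸ (Ideal.ofList (y :: ys) • ⊤ : Submodule R M))
        rw [← WithBot.coe_unbot _ hne]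
        exact WithBot.coe_le_coe.mpr zero_le
      exact le_add_of_nonneg_left h0
    have hdimN : supportDim R N = 1 := by
      apply le_antisymm
      · have := supportDim_le_supportDim_quotSMulTop_succ (M := N) (hxm x (by simp))
        rwa [hxN, zero_add] at this
      · have := hdimM.trans (supportDim_le_add_length xs hxm' M)
        replace this : ((n + 1 : ℕ) : WithBot ℕ∞) ≤ supportDim R N + n := by rwa [hxl] at this
        have hne : supportDim R N ≠ ⊥ := by
          intro h
          rw [h] at this
          simp at this
        rw [← WithBot.coe_unbot _ hne] at this ⊢
        generalize WithBot.unbot _ hne = e at this ⊢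
        have h2 : ((n + 1 : ℕ) : ℕ∞) ≤ e + (n : ℕ∞) := by exact_mod_cast this
        have h3 : (1 : ℕ∞) ≤ e := by
          induction e with
          | top => exact le_top
          | coe e => norm_cast at h2 ⊢; omega
        exact_mod_cast h3
    -- choose a common parameter
    obtain ⟨w, hwm, hwy, hwN⟩ : ∃ w ∈ maximalIdeal R,
        IsSMulRegular (M ⧸ (Ideal.ofList ys • ⊤ : Submodule R M)) w ∧
        ∀ p ∈ (annihilator R N).minimalPrimes, w ∉ p := by
      have hfin : (associatedPrimes R (M ⧸ (Ideal.ofList ys • ⊤ : Submodule R M)) ∪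
          (annihilator R N).minimalPrimes).Finite :=
        (associatedPrimes.finite _ _).union (Ideal.finite_minimalPrimes_of_isNoetherianRing R _)
      -- Prime avoidance: the maximal ideal is not associated to `M/ys M`, since `y` is regular
      -- there, and is not minimal over the annihilator of `N`, since `N` has dimension one.
      have key : ¬ ((maximalIdeal R : Set R) ⊆
          ⋃ p ∈ (associatedPrimes R (M ⧸ (Ideal.ofList ys • ⊤ : Submodule R M)) ∪
          (annihilator R N).minimalPrimes), (p : Set R)) := by
        intro hsub
        have hunion := Ideal.subset_union_prime_finite hfin (f := id) (I := maximalIdeal R) ⊤ ⊤ (by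
          rintro p (hp | hp) _ _
          · exact hp.isPrime
          · exact hp.isPrime)
        · obtain ⟨p, hp, hle⟩ := hunion.mp hsub
          rcases hp with hp | hp
          · have : y ∈ ⋃ p ∈ associatedPrimes R (M ⧸ (Ideal.ofList ys • ⊤ : Submodule R M)),
                (p : Set R) := by
              simp only [Set.mem_iUnion]; exact ⟨p, hp, hle (hym y (by simp))⟩
            rw [biUnion_associatedPrimes_eq_compl_regular] at this
            exact this hy'.2
          · have hpm : p = maximalIdeal R :=
              le_antisymm (le_maximalIdeal hp.isPrime.ne_top) hle
            have hsupp : ∀ q ∈ support R N, q = closedPoint R := by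
              intro q hq
              have h1 := mem_support_iff_of_finite.mp hq
              have := hp.2 ⟨q.2, h1⟩ ((le_maximalIdeal q.2.ne_top).trans hpm.ge)
              ext1
              exact le_antisymm (le_maximalIdeal q.2.ne_top) (hpm.ge.trans this)
            have : Subsingleton (support R N) :=
              ⟨fun a b => Subtype.ext ((hsupp _ a.2).trans (hsupp _ b.2).symm)⟩
            have h0 : supportDim R N ≤ 0 := Order.krullDim_nonpos_of_subsingleton
            rw [hdimN] at h0
            exact absurd h0 (by decide)
      obtain ⟨w, hwm, hw⟩ := Set.not_subset.mp key
      simp only [Set.mem_iUnion, not_exists] at hw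
      refine ⟨w, hwm, ?_, fun p hp h => hw p (Or.inr hp) h⟩
      by_contra hreg
      have : w ∈ ⋃ p ∈ associatedPrimes R (M ⧸ (Ideal.ofList ys • ⊤ : Submodule R M)),
          (p : Set R) := by
        rw [biUnion_associatedPrimes_eq_compl_regular]; exact hreg
      simp only [Set.mem_iUnion] at this
      obtain ⟨p, hp, h⟩ := this
      exact hw p (Or.inl hp) h
    have hwys : IsWeaklyRegular M (w :: ys) := by
      refine isWeaklyRegular_of_perm_of_subset_maximalIdeal
        ((isWeaklyRegular_append_iff M ys [w]).mpr
          ⟨hy'.1, (isWeaklyRegular_singleton_iff _ _).mpr hwy⟩)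
        (List.perm_append_singleton w ys) ?_
      simp only [List.mem_append, List.mem_singleton]
      rintro r (hr | rfl)
      exacts [hym' r hr, hwm]
    rw [isWeaklyRegular_cons_iff] at hwys
    have hNw : supportDim R (QuotSMulTop w N) = 0 := by
      have := supportDim_quotSMulTop_succ_eq_of_notMem_minimalPrimes_of_mem_maximalIdeal hwN hwm
      rw [hdimN] at this
      have hnt : Nontrivial N := by
        rw [← supportDim_ne_bot_iff_nontrivial R, hdimN]; decide
      have hne := supportDim_ne_bot_iff_nontrivial R (QuotSMulTop w N) |>.mpr
        (nontrivial_quotSMulTop_of_mem_maximalIdeal N hwm)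
      rw [← WithBot.coe_unbot _ hne] at this ⊢
      generalize WithBot.unbot _ hne = e at this ⊢
      have h2 : e + 1 = (1 : ℕ∞) := by exact_mod_cast this
      have h3 : e = 0 := by
        induction e with
        | top => simp at h2
        | coe e => norm_cast at h2 ⊢; omega
      rw [h3]; rfl
    have hxs := ih (QuotSMulTop w M) ys xs hyl hxl hym' hxm' hwys.2 (by
      rw [← hNw]
      exact supportDim_eq_of_equiv
        ((Submodule.quotOfListConsSMulTopEquivQuotSMulTopInner M w xs).symm.trans
          (Submodule.quotOfListConsSMulTopEquivQuotSMulTopOuter M w xs)))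
    have hwxs : IsWeaklyRegular M (xs ++ [w]) := by
      refine isWeaklyRegular_of_perm_of_subset_maximalIdeal (hxs.cons hwys.1)
        (List.perm_append_singleton w xs).symm ?_
      simp only [List.mem_cons]
      rintro r (rfl | hr)
      exacts [hwm, hxm' r hr]
    rw [isWeaklyRegular_append_iff, isWeaklyRegular_singleton_iff] at hwxs
    have hxx : IsWeaklyRegular M (xs ++ [x]) :=
      (isWeaklyRegular_append_iff M xs [x]).mpr ⟨hwxs.1, (isWeaklyRegular_singleton_iff _ _).mpr
        (isSMulRegular_of_supportDim_eq_zero hwm hwxs.2 hxN)⟩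
    refine isWeaklyRegular_of_perm_of_subset_maximalIdeal hxx (List.perm_append_singleton x xs) ?_
    simp only [List.mem_append, List.mem_singleton]
    rintro r (hr | rfl)
    exacts [hxm' r hr, hxm _ (by simp)]

end Parameters

/-! ### Quasi-regular sequences -/

section QuasiRegular

open MvPolynomial (isHomogeneous_C IsHomogeneous isHomogeneous_X eval_eq' C_surjective
  totalDegree_eq_zero_iff_eq_C finSuccEquiv finSuccEquiv_coeff_coeff eval_eq_eval_mv_eval')

variable {R : Type*} [CommRing R]

/-- Each `x i` is a nonzerodivisor modulo the ideal generated by the later `x j`. -/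
def IsTailRegular : {d : ℕ} → (Fin d → R) → Prop
  | 0, _ => True
  | _ + 1, x => (∀ r, x 0 * r ∈ Ideal.span (Set.range (Fin.tail x)) →
      r ∈ Ideal.span (Set.range (Fin.tail x))) ∧ IsTailRegular (Fin.tail x)

theorem isHomogeneous_C_mul {σ : Type*} {F : MvPolynomial σ R} {n : ℕ} (hF : F.IsHomogeneous n)
    (r : R) : (MvPolynomial.C r * F).IsHomogeneous n := by
  simpa using (isHomogeneous_C σ r).mul hF

/-- Elements of `L Qⁿ`, `Q = (x₁, …, x_d)`, are values of forms of degree `n` with coefficients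
in `𝔏`. -/
theorem exists_isHomogeneous_eval_eq {d : ℕ} (x : Fin d → R) (L : Ideal R) (n : ℕ) {r : R}
    (hr : r ∈ L * Ideal.span (Set.range x) ^ n) :
    ∃ F : MvPolynomial (Fin d) R, F.IsHomogeneous n ∧ (∀ e, MvPolynomial.coeff e F ∈ L) ∧
      MvPolynomial.eval x F = r := by
  classical
  induction n generalizing r with
  | zero =>
    refine ⟨MvPolynomial.C r, isHomogeneous_C _ r, fun e => ?_, by simp⟩
    rw [pow_zero, mul_one] at hr
    rw [MvPolynomial.coeff_C]
    split_ifs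
    exacts [hr, L.zero_mem]
  | succ n ih =>
    rw [pow_succ, ← mul_assoc] at hr
    refine Submodule.mul_induction_on hr ?_ ?_
    · intro a ha q hq
      obtain ⟨F, hF, hFL, rfl⟩ := ih ha
      obtain ⟨c, rfl⟩ := Ideal.mem_span_range_iff_exists_fun.mp hq
      refine ⟨F * ∑ i, MvPolynomial.C (c i) * MvPolynomial.X i, hF.mul (IsHomogeneous.sum _ _ _ fun i _ =>
        isHomogeneous_C_mul (isHomogeneous_X R i) (c i)), ?_, by simp⟩
      rw [← MvPolynomial.mem_map_C_iff] at hFL ⊢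
      exact Ideal.mul_mem_right _ _ hFL
    · rintro _ _ ⟨F, hF, hFL, rfl⟩ ⟨G, hG, hGL, rfl⟩
      exact ⟨F + G, hF.add hG, fun e => by rw [MvPolynomial.coeff_add]; exact L.add_mem (hFL e) (hGL e),
        by simp⟩

theorem eval_mem_mul_pow {d : ℕ} (x : Fin d → R) (L : Ideal R) {n : ℕ} {F : MvPolynomial (Fin d) R}
    (hF : F.IsHomogeneous n) (hFL : ∀ e, MvPolynomial.coeff e F ∈ L) :
    MvPolynomial.eval x F ∈ L * Ideal.span (Set.range x) ^ n := by
  rw [eval_eq']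
  refine Ideal.sum_mem _ fun e he => Ideal.mul_mem_mul (hFL e) ?_
  have hdeg : n = ∑ i, e i := by
    rw [← hF (MvPolynomial.mem_support_iff.mp he), Finsupp.weight_apply,
      Finsupp.sum_fintype _ _ (by simp)]
    simp
  rw [hdeg, ← Finset.prod_pow_eq_pow_sum]
  exact Ideal.prod_mem_prod fun i _ =>
    Ideal.pow_mem_pow (Ideal.subset_span (Set.mem_range_self i)) _

theorem eval_mem_pow {d : ℕ} (x : Fin d → R) {n : ℕ} {F : MvPolynomial (Fin d) R}
    (hF : F.IsHomogeneous n) : MvPolynomial.eval x F ∈ Ideal.span (Set.range x) ^ n := by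
  simpa [Ideal.top_mul] using eval_mem_mul_pow x ⊤ hF fun _ => trivial

/-- `x` is quasi-regular: forms vanishing at `x` have coefficients in `(x)`. -/
def IsQuasiRegular {d : ℕ} (x : Fin d → R) : Prop :=
  ∀ (n : ℕ) (F : MvPolynomial (Fin d) R), F.IsHomogeneous n → MvPolynomial.eval x F = 0 →
    ∀ e, MvPolynomial.coeff e F ∈ Ideal.span (Set.range x)

/-- Subtracting a form with the same value and coefficients in `L` gives a form vanishing at `x`.
Only the degree `n` is assumed, so that the lemma is available inside an induction on the degree. -/
theorem coeff_mem_of_eval_mem {d : ℕ} {x : Fin d → R} {n : ℕ}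
    (hx : ∀ F : MvPolynomial (Fin d) R, F.IsHomogeneous n → MvPolynomial.eval x F = 0 →
      ∀ e, MvPolynomial.coeff e F ∈ Ideal.span (Set.range x))
    {L : Ideal R} (hL : Ideal.span (Set.range x) ≤ L)
    {F : MvPolynomial (Fin d) R} (hF : F.IsHomogeneous n)
    (hev : MvPolynomial.eval x F ∈ L * Ideal.span (Set.range x) ^ n) (e : Fin d →₀ ℕ) :
    MvPolynomial.coeff e F ∈ L := by
  obtain ⟨G, hG, hGL, hGe⟩ := exists_isHomogeneous_eval_eq x L n hev
  have := hL (hx (F - G) (hF.sub hG) (by rw [map_sub, hGe, sub_self]) e)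
  rw [MvPolynomial.coeff_sub] at this
  simpa using L.add_mem this (hGL e)

theorem IsQuasiRegular.coeff_mem {d : ℕ} {x : Fin d → R} (hx : IsQuasiRegular x)
    {L : Ideal R} (hL : Ideal.span (Set.range x) ≤ L) {n : ℕ}
    {F : MvPolynomial (Fin d) R} (hF : F.IsHomogeneous n)
    (hev : MvPolynomial.eval x F ∈ L * Ideal.span (Set.range x) ^ n) (e : Fin d →₀ ℕ) :
    MvPolynomial.coeff e F ∈ L :=
  coeff_mem_of_eval_mem (hx n) hL hF hev e

/-- If `r` is the value of a form `F` of degree `n` and `y r ∈ Qⁿ⁺¹`, quasi-regularity puts the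
coefficients of `y F` in `Q`, so `y` can be cancelled coefficientwise. -/
theorem IsQuasiRegular.mem_pow_of_mul_mem_pow {d : ℕ} {x : Fin d → R} (hx : IsQuasiRegular x)
    {y : R} (hy : ∀ r, y * r ∈ Ideal.span (Set.range x) → r ∈ Ideal.span (Set.range x)) (n : ℕ)
    {r : R} (hr : y * r ∈ Ideal.span (Set.range x) ^ n) : r ∈ Ideal.span (Set.range x) ^ n := by
  induction n generalizing r with
  | zero => simp
  | succ n ih =>
    have hr' := ih (Ideal.pow_le_pow_right n.le_succ hr)
    obtain ⟨F, hF, -, rfl⟩ := exists_isHomogeneous_eval_eq x ⊤ n (by rwa [Ideal.top_mul])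
    rw [pow_succ']
    refine eval_mem_mul_pow x _ hF fun e => hy _ ?_
    rw [← MvPolynomial.coeff_C_mul]
    refine hx.coeff_mem le_rfl (isHomogeneous_C_mul hF y) ?_ e
    rwa [← pow_succ', map_mul, MvPolynomial.eval_C]

/-- Induction on `d`, then on the degree. Split `F = G + X₀ H` with `G` free of `X₀`, and let `x'`
be the tail. If `F` vanishes at `x`, then `x₀ H(x) = -G(x')` lies in `(x')ⁿ⁺¹`, hence so does
`H(x)`; the smaller degree handles `H`. Writing `H(x) = h(x')`, the form `G + x₀ h` vanishes at
`x'`, and fewer variables handle `G`. -/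
theorem IsTailRegular.isQuasiRegular {d : ℕ} {x : Fin d → R} (hx : IsTailRegular x) :
    IsQuasiRegular x := by
  induction d with
  | zero =>
    intro n F hF hev e
    obtain ⟨r, rfl⟩ := C_surjective (R := R) (Fin 0) F
    rw [MvPolynomial.eval_C] at hev
    simp [hev]
  | succ d ihd =>
    obtain ⟨hx0, hxt⟩ := hx
    have hq := ihd hxt
    set x' := Fin.tail x with hx'
    have hcons : x = Fin.cons (x 0) x' := (Fin.cons_self_tail x).symm
    have hle : Ideal.span (Set.range x') ≤ Ideal.span (Set.range x) :=
      Ideal.span_mono (by rintro _ ⟨i, rfl⟩; exact ⟨i.succ, rfl⟩)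
    have h0 : x 0 ∈ Ideal.span (Set.range x) := Ideal.subset_span ⟨0, rfl⟩
    intro n
    induction n with
    | zero =>
      intro F hF hev e
      have hFC : F = MvPolynomial.C (MvPolynomial.coeff 0 F) := by
        rw [← totalDegree_eq_zero_iff_eq_C]
        exact Nat.le_zero.mp hF.totalDegree_le
      rw [hFC, MvPolynomial.eval_C] at hev
      rw [hFC, hev]
      simp
    | succ n ihn =>
      intro F hF hev e
      set p := finSuccEquiv R d F with hp
      set H := (finSuccEquiv R d).symm p.divX with hH
      have hcoeffH : ∀ i m, MvPolynomial.coeff (Finsupp.cons i m) H =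
          MvPolynomial.coeff (Finsupp.cons (i + 1) m) F := by
        intro i m
        rw [← finSuccEquiv_coeff_coeff, ← finSuccEquiv_coeff_coeff, hH, AlgEquiv.apply_symm_apply,
          Polynomial.coeff_divX]
      have hwt : ∀ i (m : Fin d →₀ ℕ), Finsupp.weight (1 : Fin (d + 1) → ℕ) (Finsupp.cons i m) =
          i + Finsupp.weight (1 : Fin d → ℕ) m := by
        intro i m
        rw [Finsupp.weight_apply, Finsupp.weight_apply,
          Finsupp.sum_fintype _ _ (by simp),
          Finsupp.sum_fintype _ _ (by simp), Fin.sum_univ_succ]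
        simp
      have hHh : H.IsHomogeneous n := by
        intro m hm
        rw [← Finsupp.cons_tail m] at hm ⊢
        rw [hcoeffH] at hm
        have := hF hm
        rw [hwt] at this ⊢
        omega
      have hGh : (p.coeff 0).IsHomogeneous (n + 1) := by
        intro m hm
        rw [hp, finSuccEquiv_coeff_coeff] at hm
        have := hF hm
        rw [hwt] at this
        omega
      have hevF : MvPolynomial.eval x F =
          MvPolynomial.eval x' (p.coeff 0) + x 0 * MvPolynomial.eval x H := by
        rw [hcons, eval_eq_eval_mv_eval', eval_eq_eval_mv_eval', hH, AlgEquiv.apply_symm_apply,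
          ← hp, Fin.cons_zero]
        conv_lhs => rw [← Polynomial.divX_mul_X_add p]
        simp [mul_comm, add_comm]
      have hHx : MvPolynomial.eval x H ∈ Ideal.span (Set.range x') ^ (n + 1) := by
        refine hq.mem_pow_of_mul_mem_pow hx0 (n + 1) ?_
        have h1 : x 0 * MvPolynomial.eval x H = - MvPolynomial.eval x' (p.coeff 0) := by
          rw [hev] at hevF
          linear_combination -hevF
        rw [h1]
        exact neg_mem (eval_mem_pow x' hGh)
      have hHc : ∀ e, MvPolynomial.coeff e H ∈ Ideal.span (Set.range x) := by
        refine coeff_mem_of_eval_mem ihn le_rfl hHh ?_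
        rw [← pow_succ']
        exact Ideal.pow_right_mono hle _ hHx
      obtain ⟨h, hh, -, hhe⟩ := exists_isHomogeneous_eval_eq x' ⊤ (n + 1)
        (by rwa [Ideal.top_mul])
      have hGc : ∀ m, MvPolynomial.coeff m (p.coeff 0) ∈ Ideal.span (Set.range x) := by
        intro m
        have := hle (hq (n + 1) (p.coeff 0 + MvPolynomial.C (x 0) * h) (hGh.add (isHomogeneous_C_mul hh _))
          (by rw [map_add, map_mul, MvPolynomial.eval_C, hhe, ← hevF, hev]) m)
        rw [MvPolynomial.coeff_add, MvPolynomial.coeff_C_mul] at this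
        have h2 := (Ideal.span (Set.range x)).sub_mem this
          (Ideal.mul_mem_right (MvPolynomial.coeff m h) _ h0)
        simpa using h2
      rw [← Finsupp.cons_tail e]
      rcases h : e 0 with _ | i
      · rw [← finSuccEquiv_coeff_coeff]
        exact hGc _
      · rw [← hcoeffH]
        exact hHc _

/-- The list is reversed because `IsTailRegular` works modulo the later elements, whereas a regular
sequence works modulo the earlier ones. -/
theorem isTailRegular_of_isWeaklyRegular {d : ℕ} {x : Fin d → R}
    (hx : RingTheory.Sequence.IsWeaklyRegular R (List.ofFn x).reverse) : IsTailRegular x := by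
  induction d with
  | zero => trivial
  | succ d ih =>
    rw [List.ofFn_succ, List.reverse_cons, RingTheory.Sequence.isWeaklyRegular_append_iff,
      RingTheory.Sequence.isWeaklyRegular_singleton_iff] at hx
    refine ⟨fun r hr => ?_, ih hx.1⟩
    have hspan : (Ideal.ofList (List.ofFn fun i : Fin d => x i.succ).reverse • ⊤ : Submodule R R) =
        Ideal.span (Set.range (Fin.tail x)) := by
      rw [smul_eq_mul, Ideal.mul_top, Ideal.ofList]
      congr 1
      ext y
      simp [Fin.tail, List.mem_ofFn]
    have := mem_of_isSMulRegular_quotient_of_smul_mem hx.2 (x := r)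
      (by rw [hspan, smul_eq_mul]; exact hr)
    rwa [hspan] at this

end QuasiRegular

/-! ### Extended ideals of Rees algebras -/

section Rees

variable {R : Type u} [CommRing R]

theorem reesVal_injective (Q : Ideal R) : Function.Injective (reesVal Q) := Subtype.val_injective

theorem coeff_reesVal_mem {Q : Ideal R} (f : Rees Q) (k : ℕ) : (reesVal Q f).coeff k ∈ Q ^ k :=
  f.2 k

/-- The monomial `c tᵏ`, `c ∈ Qᵏ`, of the Rees algebra. -/
def reesMonomial (Q : Ideal R) (k : ℕ) (c : R) (hc : c ∈ Q ^ k) : Rees Q :=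
  ⟨monomial k c, reesAlgebra.monomial_mem.mpr hc⟩

@[simp]
theorem reesVal_reesMonomial (Q : Ideal R) (k : ℕ) (c : R) (hc : c ∈ Q ^ k) :
    reesVal Q (reesMonomial Q k c hc) = monomial k c := rfl

@[simp]
theorem reesVal_algebraMap (Q : Ideal R) (r : R) : reesVal Q (algebraMap R (Rees Q) r) = C r := rfl

theorem reesVal_surj {Q : Ideal R} (f : R[X]) (hf : ∀ k, f.coeff k ∈ Q ^ k) :
    ∃ g : Rees Q, reesVal Q g = f := ⟨⟨f, hf⟩, rfl⟩

theorem rees_eq_sum {Q : Ideal R} (f : Rees Q) :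
    f = ∑ k ∈ (reesVal Q f).support,
      reesMonomial Q k ((reesVal Q f).coeff k) (coeff_reesVal_mem f k) := by
  apply reesVal_injective
  rw [map_sum]
  simp only [reesVal_reesMonomial]
  exact (reesVal Q f).as_sum_support

/-- Extended ideals are homogeneous. Testing degree by degree turns questions about `Rees Q` into
questions about ideals of `R`. -/
theorem mem_map_algebraMap_rees_iff {Q L : Ideal R} (f : Rees Q) :
    f ∈ L.map (algebraMap R (Rees Q)) ↔ ∀ k, (reesVal Q f).coeff k ∈ L * Q ^ k := by
  constructor
  · intro hf
    rw [Ideal.map] at hf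
    refine Submodule.span_induction ?_ ?_ ?_ ?_ hf
    · rintro _ ⟨l, hl, rfl⟩ k
      rw [reesVal_algebraMap, coeff_C]
      split_ifs with h
      · subst h; simpa using hl
      · exact zero_mem _
    · intro k; simp
    · intro f g _ _ hf hg k
      rw [map_add, coeff_add]
      exact add_mem (hf k) (hg k)
    · intro a f _ hf k
      rw [smul_eq_mul, map_mul, coeff_mul]
      refine Ideal.sum_mem _ fun ij hij => ?_
      rw [Finset.HasAntidiagonal.mem_antidiagonal] at hij
      rw [← hij, pow_add, mul_left_comm]
      exact Ideal.mul_mem_mul (coeff_reesVal_mem a _) (hf _)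
  · intro hf
    rw [rees_eq_sum f]
    refine Ideal.sum_mem _ fun k _ => ?_
    have key : ∀ c ∈ L * Q ^ k, ∃ hc : c ∈ Q ^ k, reesMonomial Q k c hc ∈
        L.map (algebraMap R (Rees Q)) := by
      intro c hc
      refine Submodule.mul_induction_on hc ?_ ?_
      · intro l hl q hq
        refine ⟨Ideal.mul_mem_left _ _ hq, ?_⟩
        have : reesMonomial Q k (l * q) (Ideal.mul_mem_left _ _ hq) =
            algebraMap R (Rees Q) l * reesMonomial Q k q hq := by
          apply reesVal_injective
          rw [map_mul, reesVal_reesMonomial, reesVal_reesMonomial, reesVal_algebraMap,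
            C_mul_monomial]
        rw [this]
        exact Ideal.mul_mem_right _ _ (Ideal.mem_map_of_mem _ hl)
      · rintro a b ⟨ha, h1⟩ ⟨hb, h2⟩
        refine ⟨add_mem ha hb, ?_⟩
        have : reesMonomial Q k (a + b) (add_mem ha hb) =
            reesMonomial Q k a ha + reesMonomial Q k b hb := by
          apply reesVal_injective
          rw [map_add, reesVal_reesMonomial, reesVal_reesMonomial, reesVal_reesMonomial,
            ← map_add]
        rw [this]
        exact add_mem h1 h2
    exact (key _ (hf k)).2

end Rees

/-! ### Rees algebras of quasi-regular sequences -/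

section ReesQuasiRegular

variable {R : Type u} [CommRing R] {d : ℕ} {x : Fin d → R}

/-- Here `L'` is the colon ideal `L : s`. Representing `f` by a form, membership is decided on
coefficients, where the colon condition applies. -/
theorem mul_mem_mul_pow_iff (hx : IsQuasiRegular x) {L L' : Ideal R}
    (hL : Ideal.span (Set.range x) ≤ L) {s : R} (hs : ∀ r, r ∈ L' ↔ s * r ∈ L) (k : ℕ) {f : R}
    (hf : f ∈ Ideal.span (Set.range x) ^ k) :
    s * f ∈ L * Ideal.span (Set.range x) ^ k ↔ f ∈ L' * Ideal.span (Set.range x) ^ k := by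
  obtain ⟨F, hF, -, rfl⟩ := exists_isHomogeneous_eval_eq x ⊤ k (by rwa [Ideal.top_mul])
  constructor
  · intro h
    refine eval_mem_mul_pow x _ hF fun e => (hs _).mpr ?_
    rw [← MvPolynomial.coeff_C_mul]
    exact hx.coeff_mem hL (isHomogeneous_C_mul hF s) (by rwa [map_mul, MvPolynomial.eval_C]) e
  · intro h
    obtain ⟨G, hG, hGL, hGe⟩ := exists_isHomogeneous_eval_eq x L' k h
    rw [← hGe, ← MvPolynomial.eval_C (f := x) s, ← map_mul]
    refine eval_mem_mul_pow x _ (isHomogeneous_C_mul hG s) fun e => ?_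
    rw [MvPolynomial.coeff_C_mul]
    exact (hs _).mp (hGL e)

/-- The colon ideals of extended ideals of the Rees algebra of a quasi-regular sequence. -/
theorem algebraMap_mul_mem_map_iff (hx : IsQuasiRegular x) {L L' : Ideal R}
    (hL : Ideal.span (Set.range x) ≤ L) {s : R} (hs : ∀ r, r ∈ L' ↔ s * r ∈ L)
    (f : Rees (Ideal.span (Set.range x))) :
    algebraMap R (Rees (Ideal.span (Set.range x))) s * f ∈ L.map (algebraMap R _) ↔
      f ∈ L'.map (algebraMap R (Rees (Ideal.span (Set.range x)))) := by
  rw [mem_map_algebraMap_rees_iff, mem_map_algebraMap_rees_iff]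
  refine forall_congr' fun k => ?_
  rw [map_mul, reesVal_algebraMap, coeff_C_mul]
  exact mul_mem_mul_pow_iff hx hL hs k (coeff_reesVal_mem f k)

/-- The presentation `R[T₁, …, T_d] → R(Q)`, `Tᵢ ↦ xᵢ t`. -/
def reesPresentation (x : Fin d → R) :
    MvPolynomial (Fin d) R →ₐ[R] Rees (Ideal.span (Set.range x)) :=
  MvPolynomial.aeval fun i => reesMonomial _ 1 (x i) (by
    rw [pow_one]; exact Ideal.subset_span ⟨i, rfl⟩)

theorem reesVal_reesPresentation (F : MvPolynomial (Fin d) R) :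
    reesVal _ (reesPresentation x F) =
      MvPolynomial.aeval (fun i => (monomial 1 (x i) : R[X])) F := by
  have : (IsScalarTower.toAlgHom R (Rees (Ideal.span (Set.range x))) R[X]).comp
      (reesPresentation x) = MvPolynomial.aeval (fun i => (monomial 1 (x i) : R[X])) := by
    ext i
    simp only [reesPresentation, AlgHom.comp_apply, MvPolynomial.aeval_X]
    rfl
  exact DFunLike.congr_fun this F

theorem reesVal_reesPresentation_of_isHomogeneous {F : MvPolynomial (Fin d) R} {n : ℕ}
    (hF : F.IsHomogeneous n) :
    reesVal _ (reesPresentation x F) = monomial n (MvPolynomial.eval x F) := by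
  rw [reesVal_reesPresentation, MvPolynomial.aeval_def, MvPolynomial.eval₂_eq',
    MvPolynomial.eval_eq', map_sum]
  refine Finset.sum_congr rfl fun e he => ?_
  have hdeg : n = ∑ i, e i := by
    rw [← hF (MvPolynomial.mem_support_iff.mp he), Finsupp.weight_apply,
      Finsupp.sum_fintype _ _ (by simp)]
    simp
  have h1 : ∏ i, (monomial 1 (x i) : R[X]) ^ e i = monomial n (∏ i, x i ^ e i) := by
    simp only [monomial_pow, one_mul]
    rw [hdeg]
    simp only [← C_mul_X_pow_eq_monomial]
    rw [Finset.prod_mul_distrib, Finset.prod_pow_eq_pow_sum, map_prod]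
  rw [h1, ← C_eq_algebraMap, C_mul_monomial]

theorem reesPresentation_surjective : Function.Surjective (reesPresentation x) := by
  intro f
  rw [rees_eq_sum f]
  have : ∀ k, ∃ F, reesPresentation x F = reesMonomial _ k ((reesVal _ f).coeff k)
      (coeff_reesVal_mem f k) := by
    intro k
    obtain ⟨F, hF, -, hFe⟩ := exists_isHomogeneous_eval_eq x ⊤ k (by
      rw [Ideal.top_mul]; exact coeff_reesVal_mem f k)
    refine ⟨F, reesVal_injective _ ?_⟩
    rw [reesVal_reesPresentation_of_isHomogeneous hF, hFe, reesVal_reesMonomial]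
  choose F hF using this
  exact ⟨∑ k ∈ (reesVal _ f).support, F k, by simp only [map_sum, hF]⟩

/-- In other words `R(Q)/LR(Q)` is the polynomial ring over `R/L`. The degree `k` coefficient of the
image of `F` is the value at `x` of its degree `k` component, to which quasi-regularity applies. -/
theorem reesPresentation_mem_map_iff (hx : IsQuasiRegular x) {L : Ideal R}
    (hL : Ideal.span (Set.range x) ≤ L) (F : MvPolynomial (Fin d) R) :
    reesPresentation x F ∈ L.map (algebraMap R _) ↔ F ∈ L.map MvPolynomial.C := by
  constructor
  · intro h
    rw [MvPolynomial.mem_map_C_iff]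
    rw [mem_map_algebraMap_rees_iff] at h
    have key : ∀ k, (reesVal _ (reesPresentation x F)).coeff k =
        MvPolynomial.eval x (MvPolynomial.homogeneousComponent k F) := by
      intro k
      conv_lhs => rw [← MvPolynomial.sum_homogeneousComponent F]
      simp only [map_sum, reesVal_reesPresentation_of_isHomogeneous
        (MvPolynomial.homogeneousComponent_isHomogeneous _ F), finsetSum_coeff, coeff_monomial]
      rw [Finset.sum_ite_eq' (Finset.range (F.totalDegree + 1)) k]
      split_ifs with hk
      · rfl
      · rw [MvPolynomial.homogeneousComponent_eq_zero, map_zero]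
        simpa using hk
    intro e
    have h1 := hx.coeff_mem hL (MvPolynomial.homogeneousComponent_isHomogeneous e.degree F)
      (key _ ▸ h e.degree) e
    rwa [MvPolynomial.coeff_homogeneousComponent, if_pos rfl] at h1
  · intro h
    have : L.map (algebraMap R (Rees (Ideal.span (Set.range x)))) =
        (L.map MvPolynomial.C).map (reesPresentation x).toRingHom := by
      rw [Ideal.map_map]
      congr 1
      ext r
      exact ((reesPresentation x).commutes r).symm
    rw [this]
    exact Ideal.mem_map_of_mem _ h

/-- Extensions of primes to the Rees algebra of a quasi-regular sequence are prime. -/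
theorem isPrime_map_algebraMap_rees (hx : IsQuasiRegular x) {p : Ideal R} [hp : p.IsPrime]
    (hL : Ideal.span (Set.range x) ≤ p) :
    (p.map (algebraMap R (Rees (Ideal.span (Set.range x))))).IsPrime := by
  have hcomap : (p.map (algebraMap R (Rees (Ideal.span (Set.range x))))).comap
      (reesPresentation x) = p.map MvPolynomial.C := by
    ext F
    exact reesPresentation_mem_map_iff hx hL F
  rw [← Ideal.map_comap_of_surjective _ reesPresentation_surjective
    (p.map (algebraMap R (Rees (Ideal.span (Set.range x))))), hcomap]
  -- The extension of `p` is the kernel of the map to the polynomial ring over the domain `R/p`.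
  have hprime : (p.map (MvPolynomial.C : R →+* MvPolynomial (Fin d) R)).IsPrime := by
    rw [← Ideal.mk_ker (I := p), ← MvPolynomial.ker_map]
    exact RingHom.ker_isPrime _
  refine Ideal.map_isPrime_of_surjective reesPresentation_surjective ?_
  rw [← hcomap]
  exact Ideal.ker_le_comap _

end ReesQuasiRegular

/-! ### Vanishing of Ext and coextension of scalars -/

section Homological

open CategoryTheory Abelian

variable {A : Type u} [CommRing A]

/-- If `M` is a retract of its own first syzygy, then `Extⁱ(M, N) = 0` for all `i ≥ 1` and all
modules `N` of finite injective dimension. -/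
theorem subsingleton_ext_of_retract_syzygy {M X P N : Type u} [AddCommGroup M] [Module A M]
    [AddCommGroup X] [Module A X] [AddCommGroup P] [Module A P] [Module.Projective A P]
    [AddCommGroup N] [Module A N] {f : X →ₗ[A] P} {g : P →ₗ[A] M} (hfg : Function.Exact f g)
    (hf : Function.Injective f) (hg : Function.Surjective g) (s : M →ₗ[A] X) (r : X →ₗ[A] M)
    (hrs : r ∘ₗ s = LinearMap.id) (hN : HasFiniteInjectiveDimension A N) (i : ℕ) (hi : 1 ≤ i) :
    Subsingleton (Ext.{u} (ModuleCat.of A M) (ModuleCat.of A N) i) := by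
  obtain ⟨n, hn⟩ := hN
  let S : ShortComplex (ModuleCat.{u} A) :=
    ModuleCat.shortComplexOfCompEqZero f g hfg.linearMap_comp_eq_zero
  have hS : S.ShortExact := ModuleCat.shortComplex_shortExact S hfg hf hg
  have hP : Projective S.X₂ := (IsProjective.iff_projective P).mp inferInstance
  -- Descending induction on `i`, starting above the injective dimension of `N`: vanishing for `M`
  -- in degree `i + 1` gives vanishing for the syzygy `X` in degree `i`, hence for its retract `M`.
  suffices H : ∀ k i : ℕ, 1 ≤ i → n + 1 ≤ i + k → ∀ e : Ext.{u} (ModuleCat.of A M)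
      (ModuleCat.of A N) i, e = 0 from
    ⟨fun a b => by rw [H (n + 1) i hi (by omega) a, H (n + 1) i hi (by omega) b]⟩
  intro k
  induction k with
  | zero => exact fun i _ hin e => e.eq_zero_of_hasInjectiveDimensionLT (n + 1) hin
  | succ k ih =>
    intro i hi hin e
    obtain ⟨j, rfl⟩ : ∃ j, i = j + 1 := ⟨i - 1, by omega⟩
    have hX : ∀ x : Ext.{u} S.X₁ (ModuleCat.of A N) (j + 1), x = 0 := by
      intro x
      obtain ⟨y, rfl⟩ := Ext.contravariant_sequence_exact₁ hS (ModuleCat.of A N) x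
        (add_comm 1 (j + 1)) (ih _ (by omega) (by omega) _)
      rw [y.eq_zero_of_projective, Ext.comp_zero]
    have h1 : ModuleCat.ofHom s ≫ ModuleCat.ofHom r = 𝟙 (ModuleCat.of A M) := by
      rw [← ModuleCat.ofHom_comp, hrs]; rfl
    rw [← e.mk₀_id_comp, ← h1, ← Ext.mk₀_comp_mk₀_assoc]
    have := hX ((Ext.mk₀ (ModuleCat.ofHom r)).comp e (zero_add _))
    exact (congrArg (fun z => (Ext.mk₀ (ModuleCat.ofHom s)).comp z (zero_add _)) this).trans
      (Ext.comp_zero _ _ _ _ _)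

/-- The obstruction to extending `φ` along `f` lives in the first Ext group. -/
theorem exists_extension_of_subsingleton_ext {M X P N : Type u} [AddCommGroup M] [Module A M]
    [AddCommGroup X] [Module A X] [AddCommGroup P] [Module A P]
    [AddCommGroup N] [Module A N] {f : X →ₗ[A] P} {g : P →ₗ[A] M} (hfg : Function.Exact f g)
    (hf : Function.Injective f) (hg : Function.Surjective g)
    (h : Subsingleton (Ext.{u} (ModuleCat.of A M) (ModuleCat.of A N) 1)) (φ : X →ₗ[A] N) :
    ∃ ψ : P →ₗ[A] N, ψ ∘ₗ f = φ := by
  let S : ShortComplex (ModuleCat.{u} A) :=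
    ModuleCat.shortComplexOfCompEqZero f g hfg.linearMap_comp_eq_zero
  have hS : S.ShortExact := ModuleCat.shortComplex_shortExact S hfg hf hg
  obtain ⟨y, hy⟩ := Ext.contravariant_sequence_exact₁ hS (ModuleCat.of A N)
    (Ext.mk₀ (ModuleCat.ofHom φ)) (add_zero 1) (h.elim _ _)
  obtain ⟨ψ, rfl⟩ := Ext.homEquiv₀.symm.surjective y
  refine ⟨ψ.hom, ?_⟩
  have h2 : S.f ≫ ψ = ModuleCat.ofHom φ := by
    apply Ext.homEquiv₀.symm.injective
    simpa using hy
  exact congrArg ModuleCat.Hom.hom h2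

/-- Allowing `P = 0` lets the lemma also transport vanishing along an isomorphism. -/
theorem subsingleton_ext_of_exact_projective {M X P N : Type u} [AddCommGroup M] [Module A M]
    [AddCommGroup X] [Module A X] [AddCommGroup P] [Module A P] [Module.Projective A P]
    [AddCommGroup N] [Module A N] {f : X →ₗ[A] M} {g : M →ₗ[A] P} (hfg : Function.Exact f g)
    (hf : Function.Injective f) (hg : Function.Surjective g) {i : ℕ} (hi : 1 ≤ i)
    (h : Subsingleton (Ext.{u} (ModuleCat.of A X) (ModuleCat.of A N) i)) :
    Subsingleton (Ext.{u} (ModuleCat.of A M) (ModuleCat.of A N) i) := by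
  let S : ShortComplex (ModuleCat.{u} A) :=
    ModuleCat.shortComplexOfCompEqZero f g hfg.linearMap_comp_eq_zero
  have hS : S.ShortExact := ModuleCat.shortComplex_shortExact S hfg hf hg
  have hP : Projective S.X₃ := (IsProjective.iff_projective P).mp inferInstance
  obtain ⟨j, rfl⟩ : ∃ j, i = j + 1 := ⟨i - 1, by omega⟩
  have key : ∀ e : Ext.{u} S.X₂ (ModuleCat.of A N) (j + 1), e = 0 := by
    intro e
    obtain ⟨y, rfl⟩ := Ext.contravariant_sequence_exact₂ hS (ModuleCat.of A N) e (h.elim _ _)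
    rw [y.eq_zero_of_projective, Ext.comp_zero]
  exact ⟨fun a b => (key a).trans (key b).symm⟩

variable {B : Type u} [CommRing B] [Algebra A B]

/-- If `Extⁱ_A(B, N) = 0` for `i ≥ 1`, the `B`-module `Hom_A(B, N)` has at most the injective
dimension of the `A`-module `N`. -/
theorem hasInjectiveDimensionLE_coextendScalars (n : ℕ) (N : ModuleCat.{u} A)
    (hN : HasInjectiveDimensionLE N n)
    (hext : ∀ i, 1 ≤ i → Subsingleton (Ext.{u}
      ((ModuleCat.restrictScalars (algebraMap A B)).obj (ModuleCat.of B B)) N i)) :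
    HasInjectiveDimensionLE ((ModuleCat.coextendScalars (algebraMap A B)).obj N) n := by
  have hinj : ∀ E : ModuleCat.{u} A, Injective E →
      Injective ((ModuleCat.coextendScalars (algebraMap A B)).obj E) := fun E hE =>
    Injective.injective_of_adjoint (ModuleCat.restrictCoextendScalarsAdj (algebraMap A B)) E
  induction n generalizing N with
  | zero =>
    have : Injective N := injective_iff_hasInjectiveDimensionLT_one.mpr hN
    have := hinj N this
    exact injective_iff_hasInjectiveDimensionLT_one.mp this
  | succ n ih =>
    let ⟨E, _, f, _⟩ := EnoughInjectives.presentation N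
    have injf : Function.Injective f.hom := (ModuleCat.mono_iff_injective f).mp ‹_›
    let S : ShortComplex (ModuleCat.{u} A) :=
      ModuleCat.shortComplexOfCompEqZero f.hom (LinearMap.range f.hom).mkQ
        f.hom.exact_map_mkQ_range.linearMap_comp_eq_zero
    have hS : S.ShortExact := ModuleCat.shortComplex_shortExact S
      f.hom.exact_map_mkQ_range injf (Submodule.mkQ_surjective _)
    have hE : Injective S.X₂ := ‹Injective E›
    have h3 : HasInjectiveDimensionLE S.X₃ n :=
      (hS.hasInjectiveDimensionLT_X₃_iff n hE).mpr hN
    have hext3 : ∀ i, 1 ≤ i → Subsingleton (Ext.{u}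
      ((ModuleCat.restrictScalars (algebraMap A B)).obj (ModuleCat.of B B)) S.X₃ i) := by
      intro i hi
      obtain ⟨j, rfl⟩ : ∃ j, i = j + 1 := ⟨i - 1, by omega⟩
      have key : ∀ e : Ext.{u} ((ModuleCat.restrictScalars (algebraMap A B)).obj
          (ModuleCat.of B B)) S.X₃ (j + 1), e = 0 := by
        intro e
        obtain ⟨y, rfl⟩ := Ext.covariant_sequence_exact₃ _ hS e rfl ((hext _ (by omega)).elim _ _)
        rw [y.eq_zero_of_injective, Ext.zero_comp]
      exact ⟨fun a b => (key a).trans (key b).symm⟩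
    have hT := ih S.X₃ h3 hext3
    let F : ModuleCat.{u} A ⥤ ModuleCat.{u} B := ModuleCat.coextendScalars (algebraMap A B)
    have hadj : F.IsRightAdjoint :=
      (ModuleCat.restrictCoextendScalarsAdj (algebraMap A B)).isRightAdjoint
    have : F.Additive := ⟨by intros; rfl⟩
    have hmono : Mono S.f := hS.mono_f
    -- As a right adjoint, coextension preserves kernels; exactness on the right is the vanishing of
    -- `Ext¹(B, N)`.
    have hFS : (S.map F).ShortExact := by
      refine { exact := hS.exact.map_of_mono_of_preservesKernel F inferInstance inferInstance
               mono_f := ?_, epi_g := ?_ }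
      · exact inferInstanceAs (Mono (F.map S.f))
      · rw [ModuleCat.epi_iff_surjective]
        intro (φ : F.obj S.X₃)
        let φ' : (ModuleCat.restrictScalars (algebraMap A B)).obj (ModuleCat.of B B) ⟶ S.X₃ :=
          
          ModuleCat.ofHom (X := (ModuleCat.restrictScalars (algebraMap A B)).obj (ModuleCat.of B B))
            (ModuleCat.CoextendScalars.equiv _ _ φ)
        obtain ⟨y, hy⟩ := Ext.covariant_sequence_exact₃ _ hS (Ext.mk₀ φ') (zero_add 1)
          ((hext 1 le_rfl).elim _ _)
        obtain ⟨ψ, rfl⟩ := Ext.homEquiv₀.symm.surjective y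
        have h2 : ψ ≫ S.g = φ' := by
          apply Ext.homEquiv₀.symm.injective
          simpa using hy
        refine ⟨(ModuleCat.CoextendScalars.equiv (algebraMap A B) S.X₂).symm ψ.hom, ?_⟩
        apply ModuleCat.CoextendScalars.ext
        exact congrArg ModuleCat.Hom.hom h2
    exact hFS.hasInjectiveDimensionLT_X₁ (n + 1) hT
      (@hasInjectiveDimensionLT_of_ge _ _ _ _ 1 _ (by omega)
        (injective_iff_hasInjectiveDimensionLT_one.mp (hinj _ hE)))

end Homological

/-! ### Ulrich ideals with a principal reduction have two generators -/

section UlrichStructure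

open CategoryTheory Abelian

variable {A : Type u} [CommRing A]

/-- Division by a nonzerodivisor is unique, hence linear. It serves for maps such as `m ↦ mc/a` on
an ideal with `I² = aI`. -/
theorem exists_linearMap_mul_eq {M : Type*} [AddCommGroup M] [Module A M] {a : A}
    (ha : ∀ x, a * x = 0 → x = 0) (φ : M →ₗ[A] A) (h : ∀ m, a ∣ φ m) :
    ∃ δ : M →ₗ[A] A, ∀ m, φ m = a * δ m := by
  choose δ hδ using h
  have hc : ∀ x y, a * x = a * y → x = y := fun x y hxy =>
    sub_eq_zero.mp (ha _ (by rw [mul_sub, hxy, sub_self]))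
  refine ⟨⟨⟨δ, fun x y => hc _ _ ?_⟩, fun r x => hc _ _ ?_⟩, hδ⟩
  · rw [← hδ, map_add, mul_add, ← hδ, ← hδ]
  · rw [← hδ, map_smul, RingHom.id_apply, smul_eq_mul, smul_eq_mul, mul_left_comm, ← hδ]

variable [IsLocalRing A]

/-- Lift a basis of `I/I²`. Some coordinate of the class of `a` is a unit, so `a` can be exchanged
for that basis element, and Nakayama shows that the result generates `I`. A relation has
coefficients in `I` because it becomes trivial in the free module `I/I²`. -/
theorem exists_generators_of_free_cotangent [IsNoetherianRing A] {I : Ideal A} (hI : I ≠ ⊤) {a : A}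
    (haI : a ∈ I) (ha : ∀ x, a * x = 0 → x = 0) (hsq : I * I = Ideal.span {a} * I)
    (hfree : Module.Free (A ⧸ I) I.Cotangent) :
    ∃ (ι : Type) (_ : Fintype ι) (c : ι → A), (∀ j, c j ∈ I) ∧
      (∀ x ∈ I, ∃ (u : A) (v : ι → A), x = u * a + ∑ j, v j * c j) ∧
      (∀ (u : A) (v : ι → A), u * a = ∑ j, v j * c j → ∀ j, v j ∈ I) := by
  classical
  have hmI : I ≤ IsLocalRing.maximalIdeal A := IsLocalRing.le_maximalIdeal hI
  have hnt : Nontrivial (A ⧸ I) := Ideal.Quotient.nontrivial_iff.mpr hI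
  have hfinA : Module.Finite A I.Cotangent :=
    Module.Finite.of_surjective I.toCotangent I.toCotangent_surjective
  have hfin : Module.Finite (A ⧸ I) I.Cotangent := Module.Finite.of_restrictScalars_finite A _ _
  let e := Module.finBasis (A ⧸ I) I.Cotangent
  set n := Module.finrank (A ⧸ I) I.Cotangent
  choose c hc using fun i => Ideal.toCotangent_surjective I (e i)
  -- coordinates of the class of `a`
  choose l hl using fun i => Ideal.Quotient.mk_surjective (e.repr (I.toCotangent ⟨a, haI⟩) i)
  have hrep : ∀ x : I, ∃ v : Fin n → A, (x : A) - ∑ i, v i * c i ∈ I ^ 2 := by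
    intro x
    choose v hv using fun i => Ideal.Quotient.mk_surjective (e.repr (I.toCotangent x) i)
    refine ⟨v, ?_⟩
    have h1 : I.toCotangent x = I.toCotangent (∑ i, v i • c i) := by
      rw [map_sum]
      conv_lhs => rw [← e.sum_repr (I.toCotangent x)]
      refine Finset.sum_congr rfl fun i _ => ?_
      rw [map_smul, hc, ← hv]
      rfl
    rw [Ideal.toCotangent_eq] at h1
    simpa using h1
  have ha0 : a - ∑ i, l i * c i ∈ I ^ 2 := by
    have h1 : I.toCotangent ⟨a, haI⟩ = I.toCotangent (∑ i, l i • c i) := by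
      rw [map_sum]
      conv_lhs => rw [← e.sum_repr (I.toCotangent ⟨a, haI⟩)]
      refine Finset.sum_congr rfl fun i _ => ?_
      rw [map_smul, hc, ← hl]
      rfl
    rw [Ideal.toCotangent_eq] at h1
    simpa using h1
  have hind : ∀ v : Fin n → A, ∑ i, v i * c i ∈ I ^ 2 → ∀ i, v i ∈ I := by
    intro v hv i
    have h1 : I.toCotangent (∑ i, v i • c i) = 0 := by
      rw [Ideal.toCotangent_eq_zero]
      simpa using hv
    rw [map_sum] at h1
    have h2 : ∑ i, (Ideal.Quotient.mk I (v i)) • e i = 0 := by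
      rw [← h1]
      refine Finset.sum_congr rfl fun i _ => ?_
      rw [map_smul, hc]
      rfl
    exact Ideal.Quotient.eq_zero_iff_mem.mp
      (Fintype.linearIndependent_iff.mp e.linearIndependent _ h2 i)
  have hI2m : I ^ 2 ≤ IsLocalRing.maximalIdeal A * I := by
    rw [pow_two]; exact Ideal.mul_mono_left hmI
  -- Otherwise `a ∈ 𝔪I`, so `I² = aI ⊆ 𝔪I²` and `I² = 0` by Nakayama, which is impossible for a
  -- nonzerodivisor `a ∈ I`.
  obtain ⟨i₀, hi₀⟩ : ∃ i, IsUnit (l i) := by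
    by_contra hno
    push Not at hno
    have hamI : a ∈ IsLocalRing.maximalIdeal A * I := by
      have : a = (a - ∑ i, l i * c i) + ∑ i, l i * c i := by ring
      rw [this]
      exact add_mem (hI2m ha0) (sum_mem fun i _ =>
        Ideal.mul_mem_mul ((IsLocalRing.mem_maximalIdeal _).mpr (hno i)) (c i).2)
    have hle : I * I ≤ IsLocalRing.maximalIdeal A * (I * I) := by
      conv_lhs => rw [hsq]
      rw [← mul_assoc]
      exact Ideal.mul_mono_left ((Ideal.span_singleton_le_iff_mem _).mpr hamI)
    have hbot : I * I = ⊥ := Submodule.eq_bot_of_le_smul_of_le_jacobson_bot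
      (IsLocalRing.maximalIdeal A) (I * I) (IsNoetherian.noetherian _) hle
      (IsLocalRing.maximalIdeal_le_jacobson _)
    have haa : a * a = 0 := by
      have := Ideal.mul_mem_mul haI haI
      rwa [hbot, Ideal.mem_bot] at this
    have ha1 : a = 0 := ha a haa
    have := ha 1 (by rw [ha1, zero_mul])
    exact one_ne_zero this
  obtain ⟨li, hli⟩ := hi₀.exists_left_inv
  have hsplit : ∀ v : Fin n → A, ∑ i, v i * c i =
      v i₀ * c i₀ + ∑ j : {i // i ≠ i₀}, v j * c j := by
    intro v
    exact Fintype.sum_eq_add_sum_subtype_ne _ i₀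
  refine ⟨{i // i ≠ i₀}, inferInstance, fun j => c j, fun j => (c j).2, ?_, ?_⟩
  · -- generation, by Nakayama
    have hle : I ≤ Ideal.span ({a} ∪ Set.range fun j : {i // i ≠ i₀} => (c j : A)) := by
      set N := Ideal.span ({a} ∪ Set.range fun j : {i // i ≠ i₀} => (c j : A)) with hN
      have haN : a ∈ N := Ideal.subset_span (Or.inl rfl)
      have hcN : ∀ j : {i // i ≠ i₀}, (c j : A) ∈ N := fun j => Ideal.subset_span (Or.inr ⟨j, rfl⟩)
      refine Submodule.le_of_le_smul_of_le_jacobson_bot (I := IsLocalRing.maximalIdeal A)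
        (IsNoetherian.noetherian _) (IsLocalRing.maximalIdeal_le_jacobson _) ?_
      have hc0 : (c i₀ : A) ∈ N ⊔ I ^ 2 := by
        have : (c i₀ : A) = li * a - li * (∑ j : {i // i ≠ i₀}, l j * c j) -
            li * (a - ∑ i, l i * c i) := by
          rw [hsplit]
          linear_combination (-(c i₀ : A)) * hli
        rw [this]
        refine sub_mem (sub_mem ?_ ?_) ?_
        · exact Ideal.mul_mem_left _ _ (Ideal.mem_sup_left haN)
        · exact Ideal.mul_mem_left _ _ (sum_mem fun j _ =>
            Ideal.mul_mem_left _ _ (Ideal.mem_sup_left (hcN j)))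
        · exact Ideal.mul_mem_left _ _ (Ideal.mem_sup_right ha0)
      intro x hx
      refine (sup_le_sup_left hI2m N : N ⊔ I ^ 2 ≤ N ⊔ _) ?_
      obtain ⟨v, hv⟩ := hrep ⟨x, hx⟩
      have : x = (x - ∑ i, v i * c i) + ∑ i, v i * c i := by ring
      rw [this, hsplit]
      refine add_mem (Ideal.mem_sup_right (by rw [← hsplit]; exact hv)) (add_mem
        (Ideal.mul_mem_left _ _ hc0) (sum_mem fun j _ => Ideal.mul_mem_left _ _
          (Ideal.mem_sup_left (hcN j))))
    intro x hx
    have hx' := hle hx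
    rw [Ideal.span_union, Submodule.mem_sup] at hx'
    obtain ⟨y, hy, z, hz, rfl⟩ := hx'
    obtain ⟨u, rfl⟩ := Ideal.mem_span_singleton'.mp hy
    obtain ⟨v, rfl⟩ := Ideal.mem_span_range_iff_exists_fun.mp hz
    exact ⟨u, v, rfl⟩
  · intro u v huv
    -- The coordinates of `∑ vⱼcⱼ - ua` in the original basis, after replacing `a` by `∑ lᵢcᵢ`,
    -- which is congruent to it modulo `I²`.
    let w : Fin n → A := fun i => if h : i ≠ i₀ then v ⟨i, h⟩ - u * l i else - (u * l i)
    have hw : ∀ i, w i ∈ I := by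
      apply hind
      have : ∑ i, w i * c i = u * (a - ∑ i, l i * c i) := by
        rw [hsplit, mul_sub, huv, hsplit]
        simp only [w]
        rw [dif_neg (by simp)]
        have : ∀ j : {i // i ≠ i₀}, (if h : (j : Fin n) ≠ i₀ then v ⟨j, h⟩ - u * l j
            else - (u * l j)) * (c j : A) = v j * c j - u * (l j * c j) := by
          intro j
          rw [dif_pos j.2]
          ring
        simp only [this, Finset.sum_sub_distrib, ← Finset.mul_sum]
        ring
      rw [this]
      exact Ideal.mul_mem_left _ _ ha0
    have hu : u ∈ I := by
      have h0 := hw i₀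
      simp only [w] at h0
      rw [dif_neg (by simp)] at h0
      have : u = - (li * (-(u * l i₀))) := by linear_combination (-u) * hli
      rw [this]
      exact neg_mem (Ideal.mul_mem_left _ _ h0)
    intro j
    have hj := hw j
    simp only [w] at hj
    rw [dif_pos j.2] at hj
    have : v j = (v j - u * l j) + u * l j := by ring
    rw [this]
    exact add_mem hj (Ideal.mul_mem_right _ _ hu)

/-- `Q = (a)` is a reduction of `I = (a, c)` with `I² = a I`, and `I / (a) ≅ A / I` via `c`. -/
structure IsGoodPair (I : Ideal A) (a c : A) : Prop where
  ne_top : I ≠ ⊤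
  left_mem : a ∈ I
  right_mem : c ∈ I
  regular : ∀ x, a * x = 0 → x = 0
  exists_eq : ∀ x ∈ I, ∃ u v, x = u * a + v * c
  mem_of_dvd : ∀ v, a ∣ v * c → v ∈ I
  exists_mul_eq : ∀ x ∈ I, ∀ y ∈ I, ∃ z ∈ I, x * y = a * z

/-- Present `I` by `a` and the `cⱼ`, with relation module `Z`. Relations have `cⱼ`-coefficients in
`I`, and `m ↦ (-m c/a, m)` in the `j₀`-th slot splits the `j₀`-th coefficient, so `I` is a retract
of `Z` and `Extⁱ(I, A) = 0`. Every linear map `Z → A` therefore extends to the free module, and a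
well-chosen one excludes a second index. -/
theorem exists_isGoodPair [IsNoetherianRing A] {I : Ideal A} (hI : I ≠ ⊤) {a : A}
    (haI : a ∈ I) (ha : ∀ x, a * x = 0 → x = 0) (hsq : I * I = Ideal.span {a} * I)
    (hfree : Module.Free (A ⧸ I) I.Cotangent) (hne : I ≠ Ideal.span {a})
    (hinj : HasFiniteInjectiveDimension A A) : ∃ c, IsGoodPair I a c := by
  classical
  obtain ⟨ι, _, c, hcI, hgen, hind⟩ := exists_generators_of_free_cotangent hI haI ha hsq hfree
  have hmul : ∀ x ∈ I, ∀ y ∈ I, ∃ z ∈ I, x * y = a * z := by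
    intro x hx y hy
    have := Ideal.mul_mem_mul hx hy
    rw [hsq, Ideal.mem_span_singleton_mul] at this
    obtain ⟨z, hz, h⟩ := this
    exact ⟨z, hz, h.symm⟩
  -- the presentation of `I`
  let g₀ : A × (ι → A) →ₗ[A] A :=
    LinearMap.coprod (LinearMap.toSpanSingleton A A a) (Fintype.linearCombination A c)
  have hg₀ : ∀ u v, g₀ (u, v) = u * a + ∑ j, v j * c j := by
    intro u v
    simp [g₀, Fintype.linearCombination_apply]
  have hg₀I : ∀ p, g₀ p ∈ I := by
    rintro ⟨u, v⟩
    rw [hg₀]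
    exact add_mem (Ideal.mul_mem_left _ _ haI) (sum_mem fun j _ => Ideal.mul_mem_left _ _ (hcI j))
  let g : A × (ι → A) →ₗ[A] I := g₀.codRestrict I hg₀I
  have hgval : ∀ p, (g p : A) = g₀ p := fun _ => rfl
  have hgs : Function.Surjective g := by
    rintro ⟨x, hx⟩
    obtain ⟨u, v, rfl⟩ := hgen x hx
    exact ⟨(u, v), Subtype.ext (hg₀ u v)⟩
  let Z := LinearMap.ker g
  have hZ : ∀ p : A × (ι → A), p ∈ Z ↔ p.1 * a + ∑ j, p.2 j * c j = 0 := by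
    rintro ⟨u, v⟩
    rw [LinearMap.mem_ker, ← hg₀, ← hgval, ZeroMemClass.coe_eq_zero]
  have hZI : ∀ p ∈ Z, ∀ j, p.2 j ∈ I := by
    intro p hp
    rw [hZ] at hp
    exact hind (-p.1) p.2 (by linear_combination -hp)
  have hexact : Function.Exact Z.subtype g := by
    intro p
    rw [← LinearMap.mem_ker]
    exact ⟨fun h => ⟨⟨p, h⟩, rfl⟩, by rintro ⟨q, rfl⟩; exact q.2⟩
  -- some index exists
  obtain ⟨j₀⟩ : Nonempty ι := by
    by_contra hem
    rw [not_nonempty_iff] at hem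
    refine hne (le_antisymm (fun x hx => ?_) ((Ideal.span_singleton_le_iff_mem _).mpr haI))
    obtain ⟨u, v, rfl⟩ := hgen x hx
    simpa using Ideal.mul_mem_left _ u (Ideal.mem_span_singleton_self a)
  -- `I` is a retract of its syzygy module
  let r : Z →ₗ[A] I := ((LinearMap.proj j₀ ∘ₗ LinearMap.snd A A (ι → A)) ∘ₗ Z.subtype).codRestrict I
    fun p => hZI p.1 p.2 j₀
  obtain ⟨δ, hδ⟩ := exists_linearMap_mul_eq ha (LinearMap.toSpanSingleton A A (c j₀) ∘ₗ I.subtype)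
    (fun m => by
      obtain ⟨z, -, hz⟩ := hmul m m.2 (c j₀) (hcI j₀)
      exact ⟨z, by simpa using hz⟩)
  let s : I →ₗ[A] Z := (LinearMap.prod (-δ) (LinearMap.single A (fun _ => A) j₀ ∘ₗ
    I.subtype)).codRestrict Z fun m => by
      rw [hZ]
      have := hδ m
      simp only [LinearMap.comp_apply, LinearMap.toSpanSingleton_apply, Submodule.subtype_apply,
        smul_eq_mul] at this
      simp only [LinearMap.prod_apply, Function.prod_apply, LinearMap.neg_apply,
        LinearMap.comp_apply, Submodule.subtype_apply, LinearMap.coe_single]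
      rw [Finset.sum_eq_single j₀]
      · rw [Pi.single_eq_same, this]; ring
      · intro j _ hj
        rw [Pi.single_eq_of_ne hj, zero_mul]
      · simp
  have hrs : r ∘ₗ s = LinearMap.id := by
    ext m
    exact Pi.single_eq_same (M := fun _ => A) j₀ (m : A)
  have hext : ∀ i, 1 ≤ i → Subsingleton (Ext.{u} (ModuleCat.of A I) (ModuleCat.of A A) i) :=
    subsingleton_ext_of_retract_syzygy hexact Z.injective_subtype hgs s r hrs hinj
  -- there is only one index
  have hone : ∀ j, j = j₀ := by
    intro j₁
    by_contra hj₁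
    -- The map `p ↦ p_{j₀} c_{j₀}/a` on relations, to be extended to the free module as `ψ`.
    obtain ⟨φ, hφ⟩ := exists_linearMap_mul_eq ha (LinearMap.toSpanSingleton A A (c j₀) ∘ₗ
      I.subtype ∘ₗ r) (fun m => by
        obtain ⟨z, -, hz⟩ := hmul (r m) (r m).2 (c j₀) (hcI j₀)
        exact ⟨z, by simpa using hz⟩)
    obtain ⟨ψ, hψ⟩ := exists_extension_of_subsingleton_ext hexact Z.injective_subtype hgs
      (hext 1 le_rfl) φ
    have hcan : ∀ x y, a * x = a * y → x = y := fun x y hxy =>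
      sub_eq_zero.mp (ha _ (by rw [mul_sub, hxy, sub_self]))
    have hkey : ∀ j, (Pi.single j₀ (c j₀) : ι → A) j = a * ψ (0, Pi.single j 1) -
        c j * ψ (1, 0) := by
      intro j
      -- The Koszul relation between `a` and `cⱼ`; evaluating `ψ` on it gives `hkey`.
      have hmem : ((-c j, Pi.single j a) : A × (ι → A)) ∈ Z := by
        rw [hZ]
        dsimp only
        rw [Finset.sum_eq_single j]
        · rw [Pi.single_eq_same]; ring
        · intro k _ hk
          rw [Pi.single_eq_of_ne hk, zero_mul]
        · simp
      have h1 : ψ (-c j, Pi.single j a) = φ ⟨_, hmem⟩ := by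
        rw [← hψ]; rfl
      have h2 : ((-c j, Pi.single j a) : A × (ι → A)) =
          a • ((0 : A), (Pi.single j (1 : A) : ι → A)) - c j • ((1 : A), (0 : ι → A)) := by
        ext k
        · simp
        · by_cases hk : k = j
          · subst hk; simp
          · simp [Pi.single_eq_of_ne hk]
      rw [congrArg ψ h2, map_sub, map_smul, map_smul, smul_eq_mul, smul_eq_mul] at h1
      rw [h1]
      apply hcan
      rw [← hφ]
      have h3 : ((r ⟨_, hmem⟩ : I) : A) = (Pi.single j a : ι → A) j₀ := rfl
      simp only [LinearMap.comp_apply, Submodule.subtype_apply, LinearMap.toSpanSingleton_apply,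
        h3, smul_eq_mul]
      by_cases hk : j = j₀
      · subst hk; simp
      · rw [Pi.single_eq_of_ne hk, Pi.single_eq_of_ne (Ne.symm hk)]; simp
    -- The index `j₁` gives `ψ(1, 0) ∈ I` while `j₀` gives `1 + ψ(1, 0) ∈ I`, so `I` would contain
    -- `1`.
    have hα : ψ (1, 0) ∈ I := by
      have h1 := hkey j₁
      rw [Pi.single_eq_of_ne hj₁] at h1
      have := hind (ψ (0, Pi.single j₁ 1)) (Pi.single j₁ (ψ (1, 0))) (by
        rw [Finset.sum_eq_single j₁]
        · rw [Pi.single_eq_same]; linear_combination -h1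
        · intro k _ hk
          rw [Pi.single_eq_of_ne hk, zero_mul]
        · simp) j₁
      rwa [Pi.single_eq_same] at this
    have h1 := hkey j₀
    rw [Pi.single_eq_same] at h1
    have := hind (ψ (0, Pi.single j₀ 1)) (Pi.single j₀ (1 + ψ (1, 0))) (by
        rw [Finset.sum_eq_single j₀]
        · rw [Pi.single_eq_same]; linear_combination -h1
        · intro k _ hk
          rw [Pi.single_eq_of_ne hk, zero_mul]
        · simp) j₀
    rw [Pi.single_eq_same] at this
    refine hI ((Ideal.eq_top_iff_one _).mpr ?_)
    simpa using sub_mem this hα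
  have : Unique ι := ⟨⟨j₀⟩, hone⟩
  have hsum : ∀ v : ι → A, ∑ j, v j * c j = v j₀ * c j₀ := fun v => by
    exact Finset.sum_eq_single j₀ (fun j _ hj => absurd (hone j) hj)
      (fun h => absurd (Finset.mem_univ _) h)
  refine ⟨c j₀, hI, haI, hcI j₀, ha, fun x hx => ?_, fun v hv => ?_, hmul⟩
  · obtain ⟨u, v, rfl⟩ := hgen x hx
    exact ⟨u, v j₀, by rw [hsum]⟩
  · obtain ⟨u, hu⟩ := hv
    exact hind u (fun _ => v) (by rw [hsum, hu, mul_comm]) j₀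

end UlrichStructure

/-! ### The one-periodic resolution of `I` -/

section GoodPair

open CategoryTheory Abelian

variable {A : Type u} [CommRing A] {I : Ideal A} {a c : A}

namespace IsGoodPair

theorem cancel (h : IsGoodPair I a c) {x y : A} (hxy : a * x = a * y) : x = y :=
  sub_eq_zero.mp (h.regular _ (by rw [mul_sub, hxy, sub_self]))

/-- The short exact sequence `0 → I → A² → I → 0`. -/
theorem exists_exact (h : IsGoodPair I a c) : ∃ (f : I →ₗ[A] A × A) (g : A × A →ₗ[A] I),
    Function.Exact f g ∧ Function.Injective f ∧ Function.Surjective g := by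
  obtain ⟨δ, hδ⟩ := exists_linearMap_mul_eq h.regular (LinearMap.toSpanSingleton A A c ∘ₗ I.subtype)
    (fun m => by
      obtain ⟨z, -, hz⟩ := h.exists_mul_eq m m.2 c h.right_mem
      exact ⟨z, by simpa using hz⟩)
  have hδ' : ∀ m : I, (m : A) * c = a * δ m := by simpa using hδ
  refine ⟨LinearMap.prod (-δ) I.subtype, (LinearMap.coprod (LinearMap.toSpanSingleton A A a)
    (LinearMap.toSpanSingleton A A c)).codRestrict I fun p => ?_, ?_, ?_, ?_⟩
  · simpa using add_mem (Ideal.mul_mem_left _ p.1 h.left_mem)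
      (Ideal.mul_mem_left _ p.2 h.right_mem)
  · rintro ⟨u, v⟩
    have : (u, v) ∈ Set.range (LinearMap.prod (-δ) I.subtype) ↔ u * a + v * c = 0 := by
      constructor
      · rintro ⟨m, hm⟩
        simp only [LinearMap.prod_apply, Function.prod_apply, LinearMap.neg_apply,
          Submodule.subtype_apply, Prod.mk.injEq] at hm
        rw [← hm.1, ← hm.2, hδ']
        ring
      · intro huv
        have hv : v ∈ I := h.mem_of_dvd v ⟨-u, by linear_combination huv⟩
        refine ⟨⟨v, hv⟩, ?_⟩
        simp only [LinearMap.prod_apply, Function.prod_apply, LinearMap.neg_apply,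
          Submodule.subtype_apply, Prod.mk.injEq, and_true]
        apply h.cancel
        rw [mul_neg, ← hδ']
        linear_combination -huv
    rw [this, Subtype.ext_iff]
    simp
  · intro m m' hmm
    have := congrArg Prod.snd hmm
    exact Subtype.ext (by simpa using this)
  · rintro ⟨x, hx⟩
    obtain ⟨u, v, rfl⟩ := h.exists_eq x hx
    exact ⟨(u, v), Subtype.ext (by simp)⟩

/-- By `exists_exact` a first syzygy of `I` is `I` itself, so the retraction is the identity. -/
theorem subsingleton_ext (h : IsGoodPair I a c) (hinj : HasFiniteInjectiveDimension A A) (i : ℕ)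
    (hi : 1 ≤ i) : Subsingleton (Ext.{u} (ModuleCat.of A I) (ModuleCat.of A A) i) := by
  obtain ⟨f, g, hfg, hf, hg⟩ := h.exists_exact
  exact subsingleton_ext_of_retract_syzygy hfg hf hg LinearMap.id LinearMap.id rfl hinj i hi

end IsGoodPair

end GoodPair

/-! ### The monomial property in Cohen–Macaulay local rings -/

section CohenMacaulay

open RingTheory.Sequence IsLocalRing

variable {R : Type u} [CommRing R] [IsLocalRing R]

theorem ringKrullDim_quotient_eq_zero_of_radical_eq {J : Ideal R}
    (hJ : J.radical = maximalIdeal R) : ringKrullDim (R ⧸ J) = 0 := by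
  have hJt : J ≠ ⊤ := by
    rintro rfl
    rw [Ideal.radical_top] at hJ
    exact Ideal.IsPrime.ne_top' hJ.symm
  have : Nontrivial (R ⧸ J) := Ideal.Quotient.nontrivial_iff.mpr hJt
  rw [← ringKrullDimZero_iff_ringKrullDim_eq_zero,
    Ideal.krullDimLE_zero_quotient_iff_forall_minimalPrimes_isMaximal]
  intro p hp
  have h1 : maximalIdeal R ≤ p := hJ ▸ hp.isPrime.radical_le_iff.mpr hp.1.2
  have h2 : p = maximalIdeal R := le_antisymm (le_maximalIdeal hp.isPrime.ne_top) h1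
  rw [h2]
  infer_instance

/-- Systems of parameters of a Cohen–Macaulay local ring are regular sequences. -/
theorem IsCohenMacaulayLocalRing.isWeaklyRegular (hR : IsCohenMacaulayLocalRing R) {xs : List R}
    (hdim : ringKrullDim R = xs.length) (hxs : (Ideal.ofList xs).radical = maximalIdeal R) :
    IsWeaklyRegular R xs := by
  obtain ⟨hN, -, ys, hym, hyr, hyl⟩ := hR
  have hlen : ys.length = xs.length := by
    rw [hyl] at hdim
    exact_mod_cast hdim
  refine isWeaklyRegular_of_supportDim_eq_zero xs.length R ys xs hlen rfl hym (fun r hr => ?_)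
    hyr.toIsWeaklyRegular ?_
  · rw [← hxs]
    exact Ideal.le_radical (Ideal.subset_span hr)
  · rw [smul_eq_mul, Ideal.mul_top, Module.supportDim_quotient_eq_ringKrullDim]
    exact ringKrullDim_quotient_eq_zero_of_radical_eq hxs

/-- A system of parameters is regular in any order, in particular with `xⱼ` last. -/
theorem IsCohenMacaulayLocalRing.mem_span_of_mul_mem (hR : IsCohenMacaulayLocalRing R) {n : ℕ}
    (hdim : ringKrullDim R = n) {x : Fin n → R}
    (hx : (Ideal.span (Set.range x)).radical = maximalIdeal R) (j : Fin n) {r : R}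
    (hr : x j * r ∈ Ideal.span (x '' {i | i ≠ j})) : r ∈ Ideal.span (x '' {i | i ≠ j}) := by
  have hperm : ((List.finRange n).erase j ++ [j]).Perm (List.finRange n) :=
    (List.perm_append_singleton j _).trans (List.perm_cons_erase (List.mem_finRange j)).symm
  have hreg : IsWeaklyRegular R (((List.finRange n).erase j ++ [j]).map x) := by
    refine hR.isWeaklyRegular ?_ ?_
    · rw [hdim, (hperm.map x).length_eq]; simp
    · rw [← hx]
      rw [Ideal.ofList]
      congr 2
      ext y
      change y ∈ List.map x _ ↔ _
      rw [(hperm.map x).mem_iff]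
      simp
  rw [List.map_append, List.map_singleton, isWeaklyRegular_append_iff,
    isWeaklyRegular_singleton_iff] at hreg
  have hspan : (Ideal.ofList (((List.finRange n).erase j).map x) • ⊤ : Submodule R R) =
      Ideal.span (x '' {i | i ≠ j}) := by
    rw [smul_eq_mul, Ideal.mul_top, Ideal.ofList]
    congr 1
    ext y
    simp only [Set.mem_ofPred_eq, List.mem_map, (List.nodup_finRange n).mem_erase_iff, Set.mem_image]
    simp
  have := mem_of_isSMulRegular_quotient_of_smul_mem hreg.2 (x := r)
    (by rw [hspan, smul_eq_mul]; exact hr)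
  rwa [hspan] at this

theorem radical_span_pow {S : Type*} [CommRing S] {n : ℕ} (x : Fin n → S) {e : Fin n → ℕ}
    (he : ∀ i, e i ≠ 0) : (Ideal.span (Set.range fun i => x i ^ e i)).radical =
      (Ideal.span (Set.range x)).radical := by
  apply le_antisymm
  · refine Ideal.radical_mono (Ideal.span_le.mpr ?_)
    rintro _ ⟨i, rfl⟩
    exact Ideal.pow_mem_of_mem _ (Ideal.subset_span (Set.mem_range_self i)) _
      (Nat.pos_of_ne_zero (he i))
  · rw [Ideal.radical_le_radical_iff, Ideal.span_le]
    rintro _ ⟨i, rfl⟩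
    exact ⟨e i, Ideal.subset_span (Set.mem_range_self i)⟩

/-- Powers of parameters are again parameters, so `xⱼ` is regular modulo the powers of the others,
and `xⱼᵗ` can be cancelled against `xⱼᵗ⁺¹`. -/
theorem IsCohenMacaulayLocalRing.mem_span_of_pow_mul_mem (hR : IsCohenMacaulayLocalRing R) {n : ℕ}
    (hdim : ringKrullDim R = n) {x : Fin n → R}
    (hx : (Ideal.span (Set.range x)).radical = maximalIdeal R) {e : Fin n → ℕ}
    (he : ∀ i, e i ≠ 0) (j : Fin n) {t : ℕ} (hj : e j = t + 1) {r : R}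
    (hr : x j ^ t * r ∈ Ideal.span (Set.range fun i => x i ^ e i)) :
    r ∈ Ideal.span (Set.range fun i => x i ^ (Function.update e j 1) i) := by
  set J := Ideal.span ((fun i => x i ^ (Function.update e j 1) i) '' {i | i ≠ j}) with hJ
  have hJ1 : Ideal.span (Set.range fun i => x i ^ e i) = Ideal.span {x j ^ (t + 1)} ⊔ J := by
    rw [hJ, ← Ideal.span_union]
    congr 1
    ext y
    simp only [Set.mem_range, Set.mem_union, Set.mem_singleton_iff, Set.mem_image,
      Set.mem_ofPred_eq]
    constructor
    · rintro ⟨i, rfl⟩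
      by_cases h : i = j
      · left; rw [h, hj]
      · exact Or.inr ⟨i, h, by rw [Function.update_of_ne h]⟩
    · rintro (rfl | ⟨i, h, rfl⟩)
      · exact ⟨j, by rw [hj]⟩
      · exact ⟨i, by rw [Function.update_of_ne h]⟩
  have hJ2 : Ideal.span (Set.range fun i => x i ^ (Function.update e j 1) i) =
      Ideal.span {x j} ⊔ J := by
    rw [hJ, ← Ideal.span_union]
    congr 1
    ext y
    simp only [Set.mem_range, Set.mem_union, Set.mem_singleton_iff, Set.mem_image,
      Set.mem_ofPred_eq]
    constructor
    · rintro ⟨i, rfl⟩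
      by_cases h : i = j
      · left; rw [h, Function.update_self, pow_one]
      · exact Or.inr ⟨i, h, rfl⟩
    · rintro (rfl | ⟨i, h, rfl⟩)
      · exact ⟨j, by rw [Function.update_self, pow_one]⟩
      · exact ⟨i, rfl⟩
  have he' : ∀ i, Function.update e j 1 i ≠ 0 := by
    intro i
    by_cases h : i = j
    · rw [h, Function.update_self]; exact one_ne_zero
    · rw [Function.update_of_ne h]; exact he i
  have hreg : ∀ y, x j * y ∈ J → y ∈ J := fun y hy =>
    hR.mem_span_of_mul_mem hdim (x := fun i => x i ^ (Function.update e j 1) i)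
      ((radical_span_pow x he').trans hx) j (by simpa using hy)
  have hreg' : ∀ (k : ℕ) (y), x j ^ k * y ∈ J → y ∈ J := by
    intro k
    induction k with
    | zero => intro y hy; simpa using hy
    | succ k ih =>
      intro y hy
      rw [pow_succ, mul_assoc] at hy
      exact hreg y (ih _ hy)
  rw [hJ1, Submodule.mem_sup] at hr
  obtain ⟨y, hy, z, hz, hyz⟩ := hr
  obtain ⟨u, rfl⟩ := Ideal.mem_span_singleton'.mp hy
  have : r - u * x j ∈ J := by
    refine hreg' t _ ?_
    have : x j ^ t * (r - u * x j) = z := by rw [mul_sub, ← hyz]; ring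
    rwa [this]
  rw [hJ2]
  have h2 : r = u * x j + (r - u * x j) := by ring
  rw [h2]
  exact add_mem (Ideal.mem_sup_left (Ideal.mul_mem_left _ _ (Ideal.mem_span_singleton_self _)))
    (Ideal.mem_sup_right this)

/-- The monomial property of systems of parameters of Cohen–Macaulay local rings. -/
theorem IsCohenMacaulayLocalRing.mem_span_of_mul_prod_pow_mem (hR : IsCohenMacaulayLocalRing R)
    {n : ℕ} (hdim : ringKrullDim R = n) {x : Fin n → R}
    (hx : (Ideal.span (Set.range x)).radical = maximalIdeal R) {t : ℕ} {g : R}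
    (hg : g * (∏ i, x i) ^ t ∈ Ideal.span (Set.range fun i => x i ^ (t + 1))) :
    g ∈ Ideal.span (Set.range x) := by
  -- `T` is the set of indices whose exponent still has to be lowered from `t + 1` to `1`.
  have key : ∀ T : Finset (Fin n), ∀ g, g * ∏ i ∈ T, x i ^ t ∈
      Ideal.span (Set.range fun i => x i ^ (if i ∈ T then t + 1 else 1)) →
      g ∈ Ideal.span (Set.range x) := by
    intro T
    induction T using Finset.induction_on with
    | empty => intro g hg; simpa using hg
    | insert j T hjT ih =>
      intro g hg
      refine ih g ?_
      rw [Finset.prod_insert hjT, mul_left_comm] at hg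
      have := hR.mem_span_of_pow_mul_mem hdim hx
        (e := fun i => if i ∈ insert j T then t + 1 else 1)
        (fun i => by split_ifs <;> omega) j (by simp) hg
      convert this using 5 with i
      by_cases h : i = j
      · subst h; simp [hjT]
      · simp [h]
  refine key Finset.univ g ?_
  simpa [Finset.prod_pow] using hg

end CohenMacaulay

/-! ### Coboundaries in the top Čech module -/

section Cech

variable {G : Type u} [CommRing G]

theorem cechRes_algebraMap {r : ℕ} (x : Fin r → G) {S S' : Finset (Fin r)} (h : S ⊆ S') (g : G) :
    cechRes x h (algebraMap G (CechLoc x S) g) = algebraMap G (CechLoc x S') g :=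
  IsLocalization.Away.lift_eq _ (cech_isUnit x h) g

/-- Only the variables other than `xⱼ` occur in the denominator, so clearing with the full product
leaves a factor `xⱼⁿ`. All large `n` are allowed, so that one exponent can serve every `j`. -/
theorem exists_cechRes_mul_pow_eq {r : ℕ} (x : Fin r → G) (j : Fin r)
    (z : CechLoc x (Finset.univ.erase j)) : ∃ n₀ : ℕ, ∀ n ≥ n₀, ∃ a : G,
      cechRes x (Finset.univ.erase_subset j) z *
        algebraMap G (CechLoc x Finset.univ) (∏ i, x i) ^ n =
        algebraMap G (CechLoc x Finset.univ) (a * x j ^ n) := by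
  obtain ⟨n₀, a, ha⟩ := IsLocalization.Away.surj (∏ i ∈ Finset.univ.erase j, x i) z
  refine ⟨n₀, fun n hn => ⟨a * (∏ i ∈ Finset.univ.erase j, x i) ^ (n - n₀), ?_⟩⟩
  have h1 := congrArg (cechRes x (Finset.univ.erase_subset j)) ha
  rw [map_mul, map_pow, cechRes_algebraMap, cechRes_algebraMap] at h1
  have hp : ∏ i, x i = x j * ∏ i ∈ Finset.univ.erase j, x i :=
    (Finset.mul_prod_erase _ _ (Finset.mem_univ j)).symm
  have hp' := congrArg (algebraMap G (CechLoc x Finset.univ)) hp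
  rw [map_mul] at hp'
  rw [hp', map_mul, map_mul, ← h1, map_pow, map_pow, mul_pow]
  obtain ⟨k, rfl⟩ := Nat.exists_eq_add_of_le hn
  rw [Nat.add_sub_cancel_left, pow_add _ n₀ k, pow_add _ n₀ k]
  ring

/-- An element of the top Čech module that is a coboundary. -/
theorem exists_mul_prod_pow_mem_of_cechD_eq {r : ℕ} (x : Fin r → G) (b : ∀ S, CechLoc x S) {g : G}
    (h : cechD x b Finset.univ * algebraMap G (CechLoc x Finset.univ) (∏ i, x i) =
      algebraMap G (CechLoc x Finset.univ) g) :
    ∃ t : ℕ, g * (∏ i, x i) ^ t ∈ Ideal.span (Set.range fun i => x i ^ (t + 1)) := by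
  choose n₀ hn₀ using fun j => exists_cechRes_mul_pow_eq x j (b (Finset.univ.erase j))
  obtain ⟨n, hn⟩ : ∃ n, ∀ j, n₀ j ≤ n + 1 := by
    refine ⟨∑ j, n₀ j, fun j => ?_⟩
    exact (Finset.single_le_sum (fun _ _ => Nat.zero_le _) (Finset.mem_univ j)).trans (Nat.le_succ _)
  choose a ha using fun j => hn₀ j (n + 1) (hn j)
  have h1 : algebraMap G (CechLoc x Finset.univ) (g * (∏ i, x i) ^ n) =
      algebraMap G (CechLoc x Finset.univ)
        (∑ j, (-1) ^ (Finset.univ.filter (· < j)).card * (a j * x j ^ (n + 1))) := by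
    rw [map_mul, ← h, map_pow, mul_assoc, ← pow_succ', cechD, Finset.sum_mul, map_sum]
    refine Finset.sum_congr rfl fun j _ => ?_
    rw [mul_assoc, ha]
    simp only [map_mul, map_pow, map_neg, map_one]
  obtain ⟨k, hk⟩ := IsLocalization.Away.exists_of_eq (S := CechLoc x Finset.univ) (∏ i, x i) h1
  -- The extra factor `(∏ xᵢ)ᵏ` turns the equality in the localization into one in `G`, and raises
  -- each `xⱼⁿ⁺¹` to `xⱼⁿ⁺ᵏ⁺¹`.
  refine ⟨n + k, ?_⟩
  have h2 : g * (∏ i, x i) ^ (n + k) = (∏ i, x i) ^ k * (g * (∏ i, x i) ^ n) := by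
    rw [pow_add]; ring
  rw [h2, hk, Finset.mul_sum]
  refine Ideal.sum_mem _ fun j _ => ?_
  have h3 : (∏ i, x i) ^ k * ((-1) ^ (Finset.univ.filter (· < j)).card * (a j * x j ^ (n + 1))) =
      ((-1) ^ (Finset.univ.filter (· < j)).card * a j * (∏ i ∈ Finset.univ.erase j, x i) ^ k) *
        x j ^ (n + k + 1) := by
    rw [← Finset.mul_prod_erase _ _ (Finset.mem_univ j)]
    ring
  rw [h3]
  exact Ideal.mul_mem_left _ _ (Ideal.subset_span (Set.mem_range_self j))

end Cech

/-! ### Homogeneous elements of the associated graded ring -/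

section AssociatedGraded

variable {A : Type u} [CommRing A] (I : Ideal A)

/-- The class of `c tᵏ` in the associated graded ring. -/
def grMonomial (k : ℕ) (c : A) (hc : c ∈ I ^ k) : AssocGraded I :=
  Ideal.Quotient.mk _ (reesMonomial I k c hc)

variable {I}

theorem mem_grPart_iff {k : ℕ} {g : AssocGraded I} :
    g ∈ grPart I k ↔ ∃ c hc, g = grMonomial I k c hc := by
  constructor
  · rintro ⟨f, ⟨c, hc⟩, rfl⟩
    have hc' : c ∈ I ^ k := by
      have := coeff_reesVal_mem f k
      have h2 : (reesVal I f).coeff k = c := by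
        change (RingHom.toAddMonoidHom (reesVal I) f).coeff k = c
        rw [← hc]; simp
      rwa [h2] at this
    refine ⟨c, hc', ?_⟩
    change Ideal.Quotient.mk _ f = _
    congr 1
    exact reesVal_injective I hc.symm
  · rintro ⟨c, hc, rfl⟩
    exact ⟨reesMonomial I k c hc, ⟨c, rfl⟩, rfl⟩

theorem mk_eq_zero_iff_coeff (f : Rees I) :
    (Ideal.Quotient.mk (I.map (algebraMap A (Rees I))) f) = 0 ↔
      ∀ k, (reesVal I f).coeff k ∈ I ^ (k + 1) := by
  rw [Ideal.Quotient.eq_zero_iff_mem, mem_map_algebraMap_rees_iff]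
  simp only [pow_succ']

theorem grMonomial_mul_grMonomial {k l : ℕ} {c c' : A} (hc : c ∈ I ^ k) (hc' : c' ∈ I ^ l) :
    grMonomial I k c hc * grMonomial I l c' hc' =
      grMonomial I (k + l) (c * c') (pow_add I k l ▸ Ideal.mul_mem_mul hc hc') := by
  rw [grMonomial, grMonomial, ← map_mul, grMonomial]
  congr 1
  apply reesVal_injective
  simp [monomial_mul_monomial]

theorem algebraMap_eq_grMonomial (c : A) :
    algebraMap A (AssocGraded I) c = grMonomial I 0 c (by simp) := by
  rw [grMonomial, IsScalarTower.algebraMap_apply A (Rees I)]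
  rfl

theorem grMonomial_pow {k n : ℕ} {c : A} (hc : c ∈ I ^ k) :
    grMonomial I k c hc ^ n =
      grMonomial I (k * n) (c ^ n) (pow_mul I k n ▸ Ideal.pow_mem_pow hc n) := by
  rw [grMonomial, ← map_pow, grMonomial]
  congr 1
  apply reesVal_injective
  simp [monomial_pow]

theorem grMonomial_congr {k k' : ℕ} {c c' : A} (hk : k = k') (h : c = c') (hc : c ∈ I ^ k) :
    grMonomial I k c hc = grMonomial I k' c' (by rw [← hk, ← h]; exact hc) := by
  subst hk h; rfl

variable (I) in
/-- The projection of the associated graded ring onto its degree zero part. -/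
def grProj : AssocGraded I →+* A ⧸ I :=
  Ideal.Quotient.lift _ ((Ideal.Quotient.mk I).comp (constantCoeff.comp (reesVal I))) (by
    intro f hf
    have := (mem_map_algebraMap_rees_iff f).mp hf 0
    simpa [Ideal.Quotient.eq_zero_iff_mem] using this)

theorem grProj_mk (f : Rees I) :
    grProj I (Ideal.Quotient.mk _ f) = Ideal.Quotient.mk I ((reesVal I f).coeff 0) := rfl

theorem grProj_algebraMap (c : A) :
    grProj I (algebraMap A (AssocGraded I) c) = Ideal.Quotient.mk I c := by
  rw [algebraMap_eq_grMonomial, grMonomial, grProj_mk]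
  simp

theorem grProj_grMonomial_succ {k : ℕ} {c : A} (hc : c ∈ I ^ (k + 1)) :
    grProj I (grMonomial I (k + 1) c hc) = 0 := by
  rw [grMonomial, grProj_mk]
  simp [coeff_monomial]

theorem grProj_surjective : Function.Surjective (grProj I) := by
  intro y
  obtain ⟨c, rfl⟩ := Ideal.Quotient.mk_surjective y
  exact ⟨_, grProj_algebraMap c⟩

/-- Elements of positive degree die in `A/I`, so only the degree zero part matters. As a preimage
under a surjection, the ideal is seen to be maximal. -/
theorem grMaximalIdeal_eq_comap [IsLocalRing A] [IsLocalRing (A ⧸ I)] :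
    grMaximalIdeal I = (IsLocalRing.maximalIdeal (A ⧸ I)).comap (grProj I) := by
  have hmk : ∀ c : A, Ideal.Quotient.mk I c ∈ IsLocalRing.maximalIdeal (A ⧸ I) ↔
      c ∈ IsLocalRing.maximalIdeal A := by
    intro c
    rw [← Ideal.mem_comap, IsLocalRing.eq_maximalIdeal
      (Ideal.comap_isMaximal_of_surjective (Ideal.Quotient.mk I) Ideal.Quotient.mk_surjective)]
  apply le_antisymm
  · refine sup_le (Ideal.map_le_iff_le_comap.mpr fun c hc => ?_) (Ideal.span_le.mpr ?_)
    · rw [Ideal.mem_comap, Ideal.mem_comap, grProj_algebraMap, hmk]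
      exact hc
    · intro g hg
      obtain ⟨n, hg⟩ := Set.mem_iUnion.mp hg
      obtain ⟨c, hc, rfl⟩ := mem_grPart_iff.mp hg
      rw [SetLike.mem_coe, Ideal.mem_comap, grProj_grMonomial_succ]
      exact zero_mem _
  · intro g hg
    obtain ⟨f, rfl⟩ := Ideal.Quotient.mk_surjective g
    rw [Ideal.mem_comap, grProj_mk, hmk] at hg
    rw [rees_eq_sum f, map_sum]
    refine Ideal.sum_mem _ fun k _ => ?_
    rcases k with _ | k
    · change grMonomial I 0 _ _ ∈ _
      rw [← algebraMap_eq_grMonomial]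
      exact Ideal.mem_sup_left (Ideal.mem_map_of_mem _ hg)
    · exact Ideal.mem_sup_right (Ideal.subset_span
        (Set.mem_iUnion.mpr ⟨k, mem_grPart_iff.mpr ⟨_, _, rfl⟩⟩))

end AssociatedGraded

/-! ### Principal reductions -/

section Reduction

variable {A : Type u} [CommRing A] {I : Ideal A} {a : A} {r : ℕ}

theorem pow_eq_span_pow_mul (hred : I ^ (r + 1) = Ideal.span {a} * I ^ r) (n : ℕ) :
    I ^ (n + r) = Ideal.span {a ^ n} * I ^ r := by
  induction n with
  | zero => simp
  | succ n ih =>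
    have : I ^ (n + 1 + r) = I * I ^ (n + r) := by rw [← pow_succ']; congr 1; omega
    rw [this, ih, mul_left_comm, ← pow_succ', hred, ← mul_assoc,
      Ideal.span_singleton_mul_span_singleton, ← pow_succ]

/-- Multiplying by `Iʳ` and cancelling `aⁿ` gives `f Iʳ ⊆ a Iʳ`. Iterating `r + 1` times on `aʳ ∈
Iʳ` and cancelling `aʳ` leaves `fʳ⁺¹ ∈ aA ⊆ I`. -/
theorem pow_mem_of_mul_pow_mem (ha : ∀ x, a * x = 0 → x = 0) (haI : a ∈ I)
    (hred : I ^ (r + 1) = Ideal.span {a} * I ^ r) {f : A} {n : ℕ} (h : f * a ^ n ∈ I ^ (n + 1)) :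
    f ^ (r + 1) ∈ I := by
  have hapow : ∀ n x, a ^ n * x = 0 → x = 0 := by
    intro n
    induction n with
    | zero => intro x hx; simpa using hx
    | succ n ih => intro x hx; rw [pow_succ, mul_assoc] at hx; exact ha _ (ih _ hx)
  have h1 : ∀ y ∈ I ^ r, ∃ z ∈ I ^ r, f * y = a * z := by
    intro y hy
    have h2 : f * a ^ n * y ∈ I ^ (n + 1 + r) := pow_add I (n + 1) r ▸ Ideal.mul_mem_mul h hy
    rw [pow_eq_span_pow_mul hred, Ideal.mem_span_singleton_mul] at h2
    obtain ⟨z, hz, hz'⟩ := h2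
    refine ⟨z, hz, sub_eq_zero.mp (hapow n _ ?_)⟩
    rw [mul_sub, sub_eq_zero]
    calc a ^ n * (f * y) = f * a ^ n * y := by ring
      _ = a ^ n * (a * z) := by rw [← hz']; ring
  have h3 : ∀ k, ∀ y ∈ I ^ r, ∃ z ∈ I ^ r, f ^ k * y = a ^ k * z := by
    intro k
    induction k with
    | zero => intro y hy; exact ⟨y, hy, by simp⟩
    | succ k ih =>
      intro y hy
      obtain ⟨z, hz, hz'⟩ := ih y hy
      obtain ⟨w, hw, hw'⟩ := h1 z hz
      refine ⟨w, hw, ?_⟩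
      calc f ^ (k + 1) * y = f * (f ^ k * y) := by ring
        _ = a ^ k * (f * z) := by rw [hz']; ring
        _ = a ^ (k + 1) * w := by rw [hw']; ring
  obtain ⟨z, hz, hz'⟩ := h3 (r + 1) (a ^ r) (Ideal.pow_mem_pow haI r)
  have h4 : f ^ (r + 1) = a * z := by
    refine sub_eq_zero.mp (hapow r _ ?_)
    rw [mul_sub, sub_eq_zero, mul_comm, hz']
    ring
  rw [h4]
  exact Ideal.mul_mem_right _ _ haI

end Reduction

/-! ### A lower bound for the dimension of the associated graded ring -/

section GradedDimension

/-- The hypothesis says that `y` is not nilpotent in `G_P`, so some prime of `G_P` avoids it. -/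
theorem exists_isPrime_lt {G : Type u} [CommRing G] {P : Ideal G} [hP : P.IsPrime] {y : G}
    (hy : y ∈ P) (h : ∀ s ∉ P, ∀ n : ℕ, s * y ^ n ≠ 0) : ∃ P' : Ideal G, P'.IsPrime ∧ P' < P := by
  obtain ⟨P', hP', -, hd⟩ := Ideal.exists_le_prime_disjoint (⊥ : Ideal G)
    (P.primeCompl ⊔ Submonoid.powers y) (by
      rw [Set.disjoint_left]
      intro z hz hz'
      obtain ⟨s, hs, _, ⟨n, rfl⟩, hsz⟩ := Submonoid.mem_sup.mp hz'
      exact h s hs n (hsz.trans hz))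
  rw [Set.disjoint_left] at hd
  refine ⟨P', hP', lt_of_le_of_ne (fun z hz => ?_) ?_⟩
  · by_contra hzP
    exact hd hz (Submonoid.mem_sup_left (show z ∈ P.primeCompl from hzP))
  · rintro rfl
    exact hd hy (Submonoid.mem_sup_right (Submonoid.mem_powers y))

variable {A : Type u} [CommRing A] {I : Ideal A} {a : A} {r : ℕ}

/-- In degree `n` the product has coefficient `s₀aⁿ`, with `s₀` the constant term of `s`. Its
vanishing would make a power of `s₀` lie in `I`. -/
theorem grMonomial_ne_zero_of_notMem (ha : ∀ x, a * x = 0 → x = 0) (haI : a ∈ I)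
    (hred : I ^ (r + 1) = Ideal.span {a} * I ^ r) {q : Ideal (A ⧸ I)} [hq : q.IsPrime]
    {s : AssocGraded I} (hs : s ∉ q.comap (grProj I)) (n : ℕ) :
    s * grMonomial I 1 a (by rwa [pow_one]) ^ n ≠ 0 := by
  intro h
  obtain ⟨f, rfl⟩ := Ideal.Quotient.mk_surjective s
  rw [Ideal.mem_comap, grProj_mk] at hs
  rw [grMonomial, ← map_pow, ← map_mul, mk_eq_zero_iff_coeff] at h
  have h1 := h n
  have h2 : (reesVal I (f * reesMonomial I 1 a (by rwa [pow_one]) ^ n)).coeff n =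
      (reesVal I f).coeff 0 * a ^ n := by
    rw [map_mul, map_pow, reesVal_reesMonomial, monomial_pow, one_mul]
    simpa using coeff_mul_monomial (reesVal I f) n 0 (a ^ n)
  rw [h2] at h1
  have h3 := pow_mem_of_mul_pow_mem ha haI hred h1
  refine hs (hq.mem_of_pow_mem (r + 1) ?_)
  rw [← map_pow, Ideal.Quotient.eq_zero_iff_mem.mpr h3]
  exact zero_mem _

/-- A chain of primes of `A/I` pulls back to primes containing `a t`. The lowest of them is not
minimal, since `a t` is not nilpotent locally there, so the chain can be prolonged downwards by one.
-/
theorem ringKrullDim_quotient_succ_le_height_grMaximalIdeal [IsLocalRing A]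
    (hI : I ≠ ⊤) (ha : ∀ x, a * x = 0 → x = 0) (haI : a ∈ I)
    (hred : I ^ (r + 1) = Ideal.span {a} * I ^ r) {m : ℕ} (hm : ringKrullDim (A ⧸ I) = m) :
    ((m + 1 : ℕ) : ℕ∞) ≤ (grMaximalIdeal I).height := by
  have := Ideal.Quotient.nontrivial_iff.mpr hI
  have : IsLocalRing (A ⧸ I) := IsLocalRing.of_surjective' (Ideal.Quotient.mk I)
    Ideal.Quotient.mk_surjective
  have hM := grMaximalIdeal_eq_comap (I := I)
  have hMp : (grMaximalIdeal I).IsPrime := by rw [hM]; infer_instance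
  obtain ⟨l, hl⟩ : ∃ l : LTSeries (PrimeSpectrum (A ⧸ I)), l.length = m :=
    Order.le_krullDim_iff.mp hm.ge
  have hmono : StrictMono (PrimeSpectrum.comap (grProj I)) :=
    (OrderEmbedding.ofMapLEIff (PrimeSpectrum.comap (grProj I)) fun p q => by
      rw [← PrimeSpectrum.asIdeal_le_asIdeal, ← PrimeSpectrum.asIdeal_le_asIdeal]
      exact Ideal.comap_le_comap_iff_of_surjective _ grProj_surjective _ _).strictMono
  obtain ⟨P', hP', hlt⟩ := exists_isPrime_lt (P := l.head.asIdeal.comap (grProj I))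
    (y := grMonomial I 1 a (by rwa [pow_one]))
    (by rw [Ideal.mem_comap, grProj_grMonomial_succ]; exact zero_mem _)
    (fun s hs n => grMonomial_ne_zero_of_notMem ha haI hred hs n)
  obtain ⟨l', hlen, hlast⟩ : ∃ l' : LTSeries (PrimeSpectrum (AssocGraded I)),
      l'.length = m + 1 ∧ l'.last = PrimeSpectrum.comap (grProj I) l.last :=
    ⟨(l.map _ hmono).cons ⟨P', hP'⟩ (show _ < _ from hlt), by
      rw [← hl]; exact (RelSeries.cons_length _ _ _).trans rfl,
      (RelSeries.last_cons _ _ _).trans (LTSeries.last_map _ _ hmono)⟩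
  have hl' : l'.last ≤ (⟨grMaximalIdeal I, hMp⟩ : PrimeSpectrum (AssocGraded I)) := by
    rw [hlast]
    change Ideal.comap (grProj I) l.last.asIdeal ≤ grMaximalIdeal I
    rw [hM]
    exact Ideal.comap_mono (IsLocalRing.le_maximalIdeal l.last.2.ne_top)
  have h1 := Order.length_le_height hl'
  rwa [← PrimeSpectrum.height_eq_orderHeight, hlen] at h1

end GradedDimension

/-! ### The monomial property at a maximal ideal -/

section MonomialProperty

/-- The monomial property, for a sequence of elements of a Cohen–Macaulay ring that generates a
maximal ideal up to radical. -/
theorem IsCohenMacaulayRing.mem_span_of_mul_prod_pow_mem {G : Type u} [CommRing G]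
    (hG : IsCohenMacaulayRing G) {n : ℕ} {M : Ideal G} [hM : M.IsMaximal] (hn : M.height = n)
    {x : Fin n → G} (hx : (Ideal.span (Set.range x)).radical = M) {t : ℕ} {g : G}
    (hg : g * (∏ i, x i) ^ t ∈ Ideal.span (Set.range fun i => x i ^ (t + 1))) :
    g ∈ Ideal.span (Set.range x) := by
  have hcm := hG.2 M
  set f := algebraMap G (Localization.AtPrime M) with hf
  have hdim : ringKrullDim (Localization.AtPrime M) = n := by
    rw [IsLocalization.AtPrime.ringKrullDim_eq_height M (Localization.AtPrime M), hn]
    rfl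
  have hrange : ∀ y : Fin n → G, Ideal.span (Set.range fun i => f (y i)) =
      (Ideal.span (Set.range y)).map f := by
    intro y
    rw [Ideal.map_span, ← Set.range_comp]
    rfl
  have hrad : (Ideal.span (Set.range fun i => f (x i))).radical =
      IsLocalRing.maximalIdeal (Localization.AtPrime M) := by
    rw [hrange]
    apply le_antisymm
    · rw [Ideal.IsPrime.radical_le_iff inferInstance, ← Localization.AtPrime.map_eq_maximalIdeal]
      exact Ideal.map_mono (hx ▸ Ideal.le_radical)
    · rw [← Localization.AtPrime.map_eq_maximalIdeal]
      exact (Ideal.map_mono hx.ge).trans (Ideal.map_radical_le f)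
  have h1 : f g ∈ Ideal.span (Set.range fun i => f (x i)) := by
    refine hcm.mem_span_of_mul_prod_pow_mem hdim hrad (t := t) ?_
    have h2 := Ideal.mem_map_of_mem f hg
    rw [← hrange] at h2
    simpa only [map_mul, map_pow, map_prod] using h2
  rw [hrange, IsLocalization.algebraMap_mem_map_algebraMap_iff M.primeCompl] at h1
  obtain ⟨s, hs, hsg⟩ := h1
  -- An ideal primary to `M` is contracted from the localization at `M`.
  have hprim : (Ideal.span (Set.range x)).IsPrimary :=
    Ideal.isPrimary_of_isMaximal_radical (hx.symm ▸ hM)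
  rcases (Ideal.isPrimary_iff.mp hprim).2 (mul_comm s g ▸ hsg) with h | h
  · exact h
  · exact absurd (hx ▸ h) hs

end MonomialProperty

/-! ### Consequences of a-invariant zero -/

section AInvariant

variable {A : Type u} [CommRing A] [IsLocalRing A] {I : Ideal A} {a : A} {r : ℕ}

/-- The sequence of a degree one element and degree zero elements of the associated graded ring. -/
def grParameters (haI : a ∈ I) {m : ℕ} (b : Fin m → A) : Fin (m + 1) → AssocGraded I :=
  Fin.cons (grMonomial I 1 a (by rwa [pow_one])) fun i => algebraMap A _ (b i)

theorem mem_maximalIdeal_of_radical {m : ℕ} {b : Fin m → A}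
    (hb : (I ⊔ Ideal.span (Set.range b)).radical = IsLocalRing.maximalIdeal A) (i : Fin m) :
    b i ∈ IsLocalRing.maximalIdeal A := by
  rw [← hb]
  exact Ideal.le_radical (Ideal.mem_sup_right (Ideal.subset_span (Set.mem_range_self i)))

/-- In degree zero this is the assumption on `b`, as `I` maps to zero. In positive degree the power
`r + 1` of an element is a multiple of `a t`, by the reduction equation. -/
theorem radical_span_grParameters (hI : I ≠ ⊤) (haI : a ∈ I)
    (hred : I ^ (r + 1) = Ideal.span {a} * I ^ r) {m : ℕ} {b : Fin m → A}
    (hb : (I ⊔ Ideal.span (Set.range b)).radical = IsLocalRing.maximalIdeal A) :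
    (Ideal.span (Set.range (grParameters haI b))).radical = grMaximalIdeal I := by
  have := Ideal.Quotient.nontrivial_iff.mpr hI
  have : IsLocalRing (A ⧸ I) := IsLocalRing.of_surjective' (Ideal.Quotient.mk I)
    Ideal.Quotient.mk_surjective
  have hM := grMaximalIdeal_eq_comap (I := I)
  have hMp : (grMaximalIdeal I).IsPrime := by rw [hM]; infer_instance
  have hx0 : grMonomial I 1 a (by rwa [pow_one]) ∈ Ideal.span (Set.range (grParameters haI b)) :=
    Ideal.subset_span ⟨0, rfl⟩
  have hxs : ∀ i, algebraMap A (AssocGraded I) (b i) ∈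
    Ideal.span (Set.range (grParameters haI b)) := fun i => Ideal.subset_span ⟨i.succ, rfl⟩
  apply le_antisymm
  · rw [hMp.radical_le_iff, Ideal.span_le]
    rintro _ ⟨i, rfl⟩
    refine Fin.cases ?_ (fun i => ?_) i
    · exact Ideal.mem_sup_right (Ideal.subset_span (Set.mem_iUnion.mpr
        ⟨0, mem_grPart_iff.mpr ⟨_, _, rfl⟩⟩))
    · exact Ideal.mem_sup_left (Ideal.mem_map_of_mem _ (mem_maximalIdeal_of_radical hb i))
  · refine sup_le (Ideal.map_le_iff_le_comap.mpr fun c hc => ?_) (Ideal.span_le.mpr ?_)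
    · rw [← hb] at hc
      obtain ⟨n, hn⟩ := hc
      refine ⟨n, ?_⟩
      rw [← map_pow]
      have h1 : I ⊔ Ideal.span (Set.range b) ≤
          (Ideal.span (Set.range (grParameters haI b))).comap (algebraMap A (AssocGraded I)) := by
        refine sup_le (fun y hy => ?_) (Ideal.span_le.mpr ?_)
        · rw [Ideal.mem_comap, IsScalarTower.algebraMap_apply A (Rees I),
            Ideal.Quotient.algebraMap_eq, Ideal.Quotient.eq_zero_iff_mem.mpr
            (Ideal.mem_map_of_mem _ hy)]
          exact zero_mem _
        · rintro _ ⟨i, rfl⟩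
          exact hxs i
      exact h1 hn
    · intro g hg
      obtain ⟨n, hg⟩ := Set.mem_iUnion.mp hg
      obtain ⟨c, hc, rfl⟩ := mem_grPart_iff.mp hg
      refine ⟨r + 1, ?_⟩
      rw [grMonomial_pow]
      have h1 : c ^ (r + 1) ∈ I ^ ((n + 1) * (r + 1)) :=
        pow_mul I (n + 1) (r + 1) ▸ Ideal.pow_mem_pow hc (r + 1)
      -- The last exponent is `(n + 1)(r + 1) - 1`: exactly one factor `a` is split off.
      have h2 : I ^ ((n + 1) * (r + 1)) = Ideal.span {a} * I ^ (n * r + n + r) := by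
        have h3 : (n + 1) * (r + 1) = (n * r + n + 1) + r := by ring
        rw [h3, pow_eq_span_pow_mul hred, pow_eq_span_pow_mul hred, ← mul_assoc,
          Ideal.span_singleton_mul_span_singleton, ← pow_succ']
      rw [h2, Ideal.mem_span_singleton_mul] at h1
      obtain ⟨z, hz, hz'⟩ := h1
      have h4 : grMonomial I ((n + 1) * (r + 1)) (c ^ (r + 1))
          (pow_mul I (n + 1) (r + 1) ▸ Ideal.pow_mem_pow hc (r + 1)) =
          grMonomial I 1 a (by rwa [pow_one]) * grMonomial I (n * r + n + r) z hz := by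
        rw [grMonomial_mul_grMonomial]
        exact grMonomial_congr (by ring) hz'.symm _
      rw [h4]
      exact Ideal.mul_mem_right _ _ hx0

/-- An ideal with a principal reduction such that the associated graded ring is Cohen–Macaulay of
`a`-invariant zero is stable, and is not principal. -/
theorem sq_eq_and_ne_of_hasAInvariant_zero [IsNoetherianRing A] (hI : I ≠ ⊤)
    (ha : ∀ x, a * x = 0 → x = 0) (haI : a ∈ I)
    (hred : I ^ (r + 1) = Ideal.span {a} * I ^ r) {m : ℕ} {b : Fin m → A}
    (hb : IsSystemOfParametersMod I b) (hcm : IsCohenMacaulayRing (AssocGraded I))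
    (hainv : HasAInvariant (grPart I) (grMaximalIdeal I) 0) :
    I * I = Ideal.span {a} * I ∧ I ≠ Ideal.span {a} := by
  have := Ideal.Quotient.nontrivial_iff.mpr hI
  have : IsLocalRing (A ⧸ I) := IsLocalRing.of_surjective' (Ideal.Quotient.mk I)
    Ideal.Quotient.mk_surjective
  have hM := grMaximalIdeal_eq_comap (I := I)
  have hMm : (grMaximalIdeal I).IsMaximal := by
    rw [hM]; exact Ideal.comap_isMaximal_of_surjective _ grProj_surjective
  set x := grParameters haI b with hx
  have hxrad := radical_span_grParameters hI haI hred hb.2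
  obtain ⟨d, hd, hgreat⟩ := hainv
  let δ : Fin (m + 1) → ℕ := Fin.cons 1 0
  have hδ : ∀ i, x i ∈ grPart I (δ i) := by
    intro i
    refine Fin.cases ?_ (fun i => ?_) i
    · exact mem_grPart_iff.mpr ⟨_, _, rfl⟩
    · exact mem_grPart_iff.mpr ⟨_, _, algebraMap_eq_grMonomial _⟩
  have hδsum : ∑ i ∈ Finset.univ, (δ i : ℤ) = 1 := by
    rw [Fin.sum_univ_succ]; simp [δ]
  have hg := hgreat (m + 1) x δ hδ hxrad
  have hcard : ∀ S : Finset (Fin (m + 1)), S.card = m + 1 → S = Finset.univ := fun S hS =>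
    Finset.eq_univ_of_card S (by simpa using hS)
  have hcard' : ∀ S : Finset (Fin (m + 1)), S.card ≤ m + 1 := fun S => by
    simpa using S.card_le_univ
  -- The Čech complex of `m + 1` elements has no terms beyond `m + 1`, but its cohomology in
  -- position `d = dim G` is nonzero.
  have hdle : d ≤ m + 1 := by
    by_contra h
    obtain ⟨c, -, -, hc⟩ := hg.1
    exact hc ⟨fun _ => 0, fun S hS => absurd (hcard' S) (by omega)⟩
  have hht := ringKrullDim_quotient_succ_le_height_grMaximalIdeal hI ha haI hred hb.1
  have hht2 : (grMaximalIdeal I).height ≤ d := by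
    have h1 := Ideal.height_le_ringKrullDim_of_ne_top hMm.ne_top
    rw [hd] at h1
    exact_mod_cast h1
  obtain rfl : d = m + 1 := by
    have : m + 1 ≤ d := by exact_mod_cast hht.trans hht2
    omega
  have hheight : (grMaximalIdeal I).height = (m + 1 : ℕ) := le_antisymm hht2 hht
  -- For `g` of degree `k` outside the parameter ideal, `g / ∏ xᵢ` has degree `k - 1`, because the
  -- `xᵢ` have total degree one. It is not a coboundary by the monomial property, against the
  -- maximality of the degree zero.
  have hvan : ∀ k, 2 ≤ k → ∀ g ∈ grPart I k, g ∈ Ideal.span (Set.range x) := by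
    intro k hk g hgk
    by_contra hgx
    have hnz : CechCohomologyNonzero (grPart I) x δ (m + 1) ((k : ℤ) - 1) := by
      let z : CechLoc x Finset.univ := IsLocalization.mk' _ g
        (⟨∏ i, x i, Submonoid.mem_powers _⟩ : Submonoid.powers (∏ i, x i))
      have hz : z * algebraMap _ (CechLoc x Finset.univ) (∏ i, x i) =
          algebraMap _ (CechLoc x Finset.univ) g := IsLocalization.mk'_spec _ _ _
      refine ⟨Pi.single Finset.univ z, fun S hS => ?_, fun S hS => ?_, ?_⟩
      · obtain rfl := hcard S hS
        refine ⟨1, g, Or.inr ⟨k, hgk, ?_⟩, ?_⟩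
        · rw [hδsum]; ring
        · rw [Pi.single_eq_same, pow_one, hz]
      · exact absurd (hcard' S) (by omega)
      · rintro ⟨b', hb'⟩
        have h1 := hb' Finset.univ (by simp)
        rw [Pi.single_eq_same] at h1
        obtain ⟨t, ht⟩ := exists_mul_prod_pow_mem_of_cechD_eq x b' (g := g) (by rw [h1, hz])
        exact hgx (hcm.mem_span_of_mul_prod_pow_mem hheight hxrad ht)
    have := hg.2 hnz
    omega
  have hbm := mem_maximalIdeal_of_radical hb.2
  constructor
  · apply le_antisymm
    · have h1 : I * I ≤ Ideal.span {a} * I ⊔ IsLocalRing.maximalIdeal A • (I * I) := by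
        intro c hc
        rw [← pow_two] at hc
        have h2 := hvan 2 le_rfl (grMonomial I 2 c hc) (mem_grPart_iff.mpr ⟨_, _, rfl⟩)
        obtain ⟨y, hy⟩ := (Submodule.mem_span_range_iff_exists_fun _).mp h2
        choose f hf using fun i => Ideal.Quotient.mk_surjective (y i)
        have h3 : Ideal.Quotient.mk (I.map (algebraMap A (Rees I))) (reesMonomial I 2 c hc -
            (f 0 * reesMonomial I 1 a (by rwa [pow_one]) +
              ∑ i : Fin m, f i.succ * algebraMap A (Rees I) (b i))) = 0 := by
          rw [map_sub, sub_eq_zero]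
          refine Eq.trans hy.symm ?_
          rw [Fin.sum_univ_succ, map_add, map_sum, map_mul]
          simp only [map_mul, hf, smul_eq_mul]
          rfl
        have h4 := (mk_eq_zero_iff_coeff _).mp h3 2
        have h5 : (reesVal I (reesMonomial I 2 c hc -
            (f 0 * reesMonomial I 1 a (by rwa [pow_one]) +
              ∑ i : Fin m, f i.succ * algebraMap A (Rees I) (b i)))).coeff 2 =
            c - ((reesVal I (f 0)).coeff 1 * a +
              ∑ i : Fin m, (reesVal I (f i.succ)).coeff 2 * b i) := by
          simp only [map_sub, map_add, map_mul, map_sum, reesVal_reesMonomial, reesVal_algebraMap,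
            coeff_sub, coeff_add, finsetSum_coeff, coeff_mul_C, coeff_monomial, if_true]
          congr 2
          exact coeff_mul_monomial (reesVal I (f 0)) 1 1 a
        rw [h5] at h4
        have h6 : c = (a * (reesVal I (f 0)).coeff 1) + ((∑ i : Fin m, b i *
            (reesVal I (f i.succ)).coeff 2) + (c - ((reesVal I (f 0)).coeff 1 * a +
              ∑ i : Fin m, (reesVal I (f i.succ)).coeff 2 * b i))) := by
          simp only [mul_comm (b _)]
          ring
        rw [h6]
        refine add_mem (Ideal.mem_sup_left ?_) (Ideal.mem_sup_right (add_mem ?_ ?_))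
        · refine Ideal.mul_mem_mul (Ideal.mem_span_singleton_self a) ?_
          simpa using coeff_reesVal_mem (f 0) 1
        · refine Ideal.sum_mem _ fun i _ => ?_
          rw [smul_eq_mul, ← pow_two]
          exact Ideal.mul_mem_mul (hbm i) (coeff_reesVal_mem _ 2)
        · rw [smul_eq_mul, ← pow_two]
          have h7 : I ^ (2 + 1) = I * I ^ 2 := pow_succ' I 2
          rw [h7] at h4
          exact Ideal.mul_mono_left (IsLocalRing.le_maximalIdeal hI) h4
      exact Submodule.le_of_le_smul_of_le_jacobson_bot (IsNoetherian.noetherian _)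
        (IsLocalRing.maximalIdeal_le_jacobson _) h1
    · exact Ideal.mul_mono_left ((Ideal.span_singleton_le_iff_mem _).mpr haI)
  · intro hIa
    -- A class of degree zero is `g / (∏ xᵢ)ᵗ` with `g` of degree `t`. If `I = (a)`, then `g` is
    -- divisible by `x₀ᵗ`, so `x₀` disappears from the denominator and the class is a coboundary.
    obtain ⟨c, hc1, -, hc3⟩ := hg.1
    obtain ⟨t, g, hgt, hcg⟩ := hc1 Finset.univ (by simp)
    have hg' : ∃ c', g = x 0 ^ t * c' := by
      rcases hgt with rfl | ⟨k, hk, hkt⟩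
      · exact ⟨0, by simp⟩
      · obtain rfl : k = t := by rw [hδsum] at hkt; omega
        obtain ⟨e, he, rfl⟩ := mem_grPart_iff.mp hk
        have he' := he
        rw [hIa, Ideal.span_singleton_pow, Ideal.mem_span_singleton'] at he'
        obtain ⟨c', rfl⟩ := he'
        refine ⟨algebraMap A _ c', ?_⟩
        change _ = grMonomial I 1 a _ ^ k * _
        rw [grMonomial_pow, algebraMap_eq_grMonomial, grMonomial_mul_grMonomial]
        exact grMonomial_congr (by ring) (by ring) _
    obtain ⟨c', rfl⟩ := hg'
    set S₀ : Finset (Fin (m + 1)) := Finset.univ.erase 0 with hS₀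
    let z : CechLoc x S₀ := IsLocalization.mk' _ c'
      (⟨(∏ i ∈ S₀, x i) ^ t, ⟨t, rfl⟩⟩ : Submonoid.powers (∏ i ∈ S₀, x i))
    have hz : z * algebraMap _ (CechLoc x S₀) ((∏ i ∈ S₀, x i) ^ t) =
        algebraMap _ (CechLoc x S₀) c' := IsLocalization.mk'_spec _ _ _
    refine hc3 ⟨Pi.single S₀ z, fun S hS => ?_⟩
    obtain rfl := hcard S hS
    have h1 : cechD x (Pi.single S₀ z) Finset.univ = cechRes x (Finset.univ.erase_subset 0) z := by
      rw [cechD, Finset.sum_eq_single_of_mem 0 (Finset.mem_univ _)]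
      · rw [show (Pi.single S₀ z : ∀ S, CechLoc x S) (Finset.univ.erase 0) = z from
          Pi.single_eq_same _ _]
        simp
      · intro j _ hj
        rw [Pi.single_eq_of_ne, map_zero, mul_zero]
        intro h
        have : (0 : Fin (m + 1)) ∈ S₀ := by rw [← h]; simp [Ne.symm hj]
        simp [hS₀] at this
    have hu : IsUnit (algebraMap (AssocGraded I) (CechLoc x Finset.univ) (∏ i, x i) ^ t) :=
      (IsLocalization.Away.algebraMap_isUnit _).pow t
    rw [h1, ← hu.mul_left_inj, hcg]
    have hp : ∏ i, x i = x 0 * ∏ i ∈ S₀, x i :=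
      (Finset.mul_prod_erase _ _ (Finset.mem_univ 0)).symm
    have hp' := congrArg (algebraMap (AssocGraded I) (CechLoc x Finset.univ)) hp
    rw [map_mul] at hp'
    have h2 := congrArg (cechRes x (Finset.univ.erase_subset 0)) hz
    rw [map_mul, cechRes_algebraMap, cechRes_algebraMap, map_pow] at h2
    rw [hp', mul_pow, mul_left_comm, h2, map_mul, map_pow]

end AInvariant

/-! ### Regular sequences and lengths in short exact sequences -/

section ExactSequences

open RingTheory.Sequence
open scoped Pointwise

variable {R : Type u} [CommRing R]

/-- A case of the snake lemma: the obstruction is the `r`-torsion of `P`, which is zero. -/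
theorem quotSMulTop_map_injective {N M P : Type u} [AddCommGroup N] [AddCommGroup M]
    [AddCommGroup P] [Module R N] [Module R M] [Module R P] {f : N →ₗ[R] M} {g : M →ₗ[R] P}
    (hf : Function.Injective f) (hfg : Function.Exact f g) {r : R} (hr : IsSMulRegular P r) :
    Function.Injective (QuotSMulTop.map r f) := by
  rw [injective_iff_map_eq_zero]
  intro y hy
  obtain ⟨n, rfl⟩ := Submodule.Quotient.mk_surjective _ y
  have h1 : f n ∈ r • (⊤ : Submodule R M) := by
    rw [← Submodule.Quotient.mk_eq_zero]
    exact hy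
  obtain ⟨m, -, hm⟩ := (Submodule.mem_smul_pointwise_iff_exists _ _ _).mp h1
  have h2 : g m = 0 := by
    apply hr
    change r • g m = r • (0 : P)
    rw [← map_smul, hm, smul_zero]
    exact hfg.apply_apply_eq_zero n
  obtain ⟨n', rfl⟩ := (hfg m).mp h2
  rw [← map_smul] at hm
  rw [Submodule.Quotient.mk_eq_zero, ← hf hm]
  exact Submodule.smul_mem_pointwise_smul _ _ _ Submodule.mem_top

theorem isWeaklyRegular_of_exact (rs : List R) : ∀ {N M P : Type u} [AddCommGroup N]
    [AddCommGroup M] [AddCommGroup P] [Module R N] [Module R M] [Module R P] {f : N →ₗ[R] M}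
    {g : M →ₗ[R] P}, Function.Injective f → Function.Exact f g → Function.Surjective g →
    IsWeaklyRegular N rs → IsWeaklyRegular P rs → IsWeaklyRegular M rs := by
  induction rs with
  | nil => intros; exact IsWeaklyRegular.nil _ _
  | cons r rs ih =>
    intro N M P _ _ _ _ _ _ f g hf hfg hg hN hP
    rw [isWeaklyRegular_cons_iff] at hN hP ⊢
    refine ⟨?_, ih (quotSMulTop_map_injective hf hfg hP.1) (QuotSMulTop.map_exact r hfg hg)
      (QuotSMulTop.map_surjective r hg) hN.2 hP.2⟩
    rw [isSMulRegular_iff_right_eq_zero_of_smul]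
    intro m hm
    have h1 : g m = 0 := hP.1.right_eq_zero_of_smul (by rw [← map_smul, hm, map_zero])
    obtain ⟨n, rfl⟩ := (hfg m).mp h1
    have h2 : n = 0 := hN.1.right_eq_zero_of_smul (hf (by rw [map_smul, hm, map_zero]))
    rw [h2, map_zero]

/-- A weakly regular sequence on a module which is a self-extension of `N`. -/
theorem isWeaklyRegular_and_length_of_exact_self (rs : List R) : ∀ {N M : Type u} [AddCommGroup N]
    [AddCommGroup M] [Module R N] [Module R M] {f : N →ₗ[R] M}
    {g : M →ₗ[R] N}, Function.Injective f → Function.Exact f g → Function.Surjective g →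
    IsWeaklyRegular M rs → IsWeaklyRegular N rs ∧
      Module.length R (M ⧸ (Ideal.ofList rs • ⊤ : Submodule R M)) =
        2 * Module.length R (N ⧸ (Ideal.ofList rs • ⊤ : Submodule R N)) := by
  induction rs with
  | nil =>
    intro N M _ _ _ _ f g hf hfg hg _
    refine ⟨IsWeaklyRegular.nil _ _, ?_⟩
    have h : ∀ (L : Type u) [AddCommGroup L] [Module R L],
        Module.length R (L ⧸ (Ideal.ofList ([] : List R) • ⊤ : Submodule R L)) =
          Module.length R L := fun L _ _ =>
      (Submodule.quotEquivOfEqBot _ (by rw [Ideal.ofList_nil, Submodule.bot_smul])).length_eq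
    rw [h, h, Module.length_eq_add_of_exact f g hf hg hfg, two_mul]
  | cons r rs ih =>
    intro N M _ _ _ _ f g hf hfg hg hM
    rw [isWeaklyRegular_cons_iff] at hM ⊢
    -- Regularity descends to the submodule `N`; as `N` is also the quotient, the sequence remains
    -- exact modulo `r`.
    have hr : IsSMulRegular N r := hM.1.of_injective f hf
    obtain ⟨h1, h2⟩ := ih (quotSMulTop_map_injective hf hfg hr) (QuotSMulTop.map_exact r hfg hg)
      (QuotSMulTop.map_surjective r hg) hM.2
    refine ⟨⟨hr, h1⟩, ?_⟩
    rw [(Submodule.quotOfListConsSMulTopEquivQuotSMulTopInner M r rs).length_eq,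
      (Submodule.quotOfListConsSMulTopEquivQuotSMulTopInner N r rs).length_eq, h2]

/-- `(R/I)/J(R/I) = R/(I + J)`. -/
def quotientSMulTopEquiv (I J : Ideal R) :
    ((R ⧸ I) ⧸ (J • ⊤ : Submodule R (R ⧸ I))) ≃ₗ[R] R ⧸ (I ⊔ J) :=
  (Submodule.quotEquivOfEq _ _ (by
    rw [← Submodule.range_mkQ I, LinearMap.range_eq_map, ← Submodule.map_smul'', smul_eq_mul,
      Ideal.mul_top])).trans (Submodule.quotientQuotientEquivQuotientSup I J)

theorem length_quotient_ne_top [IsLocalRing R] [IsNoetherianRing R] {J : Ideal R}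
    (hJ : J.radical = IsLocalRing.maximalIdeal R) : Module.length R (R ⧸ J) ≠ ⊤ := by
  have h1 := ringKrullDim_quotient_eq_zero_of_radical_eq hJ
  have h2 : Ring.KrullDimLE 0 (R ⧸ J) := by
    rw [Ring.krullDimLE_iff, h1]; rfl
  have h3 : IsArtinianRing (R ⧸ J) :=
    isArtinianRing_iff_isNoetherianRing_krullDimLE_zero.mpr ⟨inferInstance, h2⟩
  rw [Module.length_eq_of_surjective (S := R) (R := R ⧸ J) (M := R ⧸ J)
    Ideal.Quotient.mk_surjective]
  exact Module.length_ne_top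

end ExactSequences

/-! ### Lengths and regular sequences for `I` -/

section GoodPair

open RingTheory.Sequence

variable {A : Type u} [CommRing A] {I : Ideal A} {a c : A}

/-- The first map is multiplication by `c`: modulo `a` its image is `I/(a)` and its kernel is `I`.
-/
theorem IsGoodPair.exists_quotient_exact (h : IsGoodPair I a c) :
    ∃ (f : (A ⧸ I) →ₗ[A] A ⧸ Ideal.span {a}) (g : (A ⧸ Ideal.span {a}) →ₗ[A] A ⧸ I),
      Function.Injective f ∧ Function.Exact f g ∧ Function.Surjective g := by
  have hle : Ideal.span {a} ≤ I := (Ideal.span_singleton_le_iff_mem _).mpr h.left_mem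
  refine ⟨Submodule.liftQ I ((Submodule.mkQ (Ideal.span {a})).comp
    (LinearMap.mulRight A c)) fun x hx => ?_, Submodule.factor hle, ?_, ?_,
    Submodule.factor_surjective hle⟩
  · obtain ⟨z, -, hz⟩ := h.exists_mul_eq _ hx _ h.right_mem
    rw [LinearMap.mem_ker, LinearMap.comp_apply, LinearMap.mulRight_apply, Submodule.mkQ_apply,
      Submodule.Quotient.mk_eq_zero, hz]
    exact Ideal.mul_mem_right _ _ (Ideal.mem_span_singleton_self a)
  · rw [injective_iff_map_eq_zero]
    intro y hy
    obtain ⟨v, rfl⟩ := Submodule.Quotient.mk_surjective _ y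
    have h1 : v * c ∈ Ideal.span {a} := by
      rw [← Submodule.Quotient.mk_eq_zero]; exact hy
    rw [Submodule.Quotient.mk_eq_zero]
    exact h.mem_of_dvd _ (Ideal.mem_span_singleton.mp h1)
  · intro y
    obtain ⟨x, rfl⟩ := Submodule.Quotient.mk_surjective _ y
    change Submodule.Quotient.mk x = (0 : A ⧸ I) ↔ _
    rw [Submodule.Quotient.mk_eq_zero]
    constructor
    · intro hx
      obtain ⟨u, v, rfl⟩ := h.exists_eq _ hx
      refine ⟨Submodule.Quotient.mk v, ?_⟩
      change Submodule.Quotient.mk (v * c) =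
        (Submodule.Quotient.mk (u * a + v * c) : A ⧸ Ideal.span {a})
      rw [Submodule.Quotient.eq]
      rw [sub_add_cancel_right, neg_mem_iff]
      exact Ideal.mul_mem_left _ _ (Ideal.mem_span_singleton_self a)
    · rintro ⟨w, hw⟩
      obtain ⟨v, rfl⟩ := Submodule.Quotient.mk_surjective _ w
      have h1 : v * c - x ∈ Ideal.span {a} := by
        rw [← Submodule.Quotient.eq]; exact hw
      have h2 := sub_mem (I.mul_mem_left v h.right_mem) (hle h1)
      rwa [sub_sub_cancel] at h2

/-- The source of the evenness of the multiplicity: `A/(a)` is an extension of `A/I` by itself. -/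
theorem IsGoodPair.length_quotient_eq (h : IsGoodPair I a c) {rs : List A}
    (hrs : IsWeaklyRegular A (a :: rs)) :
    Module.length A (A ⧸ (Ideal.span {a} ⊔ Ideal.ofList rs)) =
      2 * Module.length A (A ⧸ (I ⊔ Ideal.ofList rs)) := by
  obtain ⟨f, g, hf, hfg, hg⟩ := h.exists_quotient_exact
  have h1 : IsWeaklyRegular (A ⧸ Ideal.span {a}) rs := by
    have h2 := ((isWeaklyRegular_cons_iff A a rs).mp hrs).2
    refine (LinearEquiv.isWeaklyRegular_congr (Submodule.quotEquivOfEq _ _ ?_) rs).mp h2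
    rw [← Submodule.ideal_span_singleton_smul, smul_eq_mul, Ideal.mul_top]
  have h3 := (isWeaklyRegular_and_length_of_exact_self rs hf hfg hg h1).2
  rwa [(quotientSMulTopEquiv (Ideal.span {a}) _).length_eq,
    (quotientSMulTopEquiv I _).length_eq] at h3

/-- The free module `A²` is an extension of `I` by itself, so regularity passes from `A²` to `I`. -/
theorem IsGoodPair.isWeaklyRegular (h : IsGoodPair I a c) {rs : List A}
    (hrs : IsWeaklyRegular A rs) : IsWeaklyRegular I rs := by
  obtain ⟨f, g, hfg, hf, hg⟩ := h.exists_exact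
  refine (isWeaklyRegular_and_length_of_exact_self rs hf hfg hg ?_).1
  exact isWeaklyRegular_of_exact rs (LinearMap.inl_injective (R := A) (M := A) (M₂ := A))
    Function.Exact.inl_snd LinearMap.snd_surjective hrs hrs

end GoodPair

/-! ### Injective dimension of modules isomorphic to a coextension -/

section Coextension

open CategoryTheory Abelian

variable {A B : Type u} [CommRing A] [CommRing B] [Algebra A B]

/-- A `B`-module isomorphic to `Hom_A(B, N)`, with the isomorphism given by evaluation of `τ`. -/
theorem hasInjectiveDimensionLE_of_coextension {K N : Type u} [AddCommGroup K] [Module A K]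
    [Module B K] [IsScalarTower A B K] [AddCommGroup N] [Module A N] (τ : K →ₗ[A] N)
    (hinj : ∀ k, (∀ b : B, τ (b • k) = 0) → k = 0)
    (hsurj : ∀ f : B →ₗ[A] N, ∃ k, ∀ b : B, f b = τ (b • k)) {n : ℕ}
    (hN : HasInjectiveDimensionLE (ModuleCat.of A N) n)
    (hext : ∀ i, 1 ≤ i → Subsingleton (Ext.{u} (ModuleCat.of A B) (ModuleCat.of A N) i)) :
    HasInjectiveDimensionLE (ModuleCat.of B K) n := by
  let F := ModuleCat.restrictScalars.{u} (algebraMap A B)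
  -- The identity on elements, reconciling two presentations of the `A`-module `B`.
  let e : B ≃ₗ[A] F.obj (ModuleCat.of B B) :=
    { toFun := fun b => b
      invFun := fun b => b
      left_inv := fun _ => rfl
      right_inv := fun _ => rfl
      map_add' := fun _ _ => rfl
      map_smul' := fun r b => Algebra.smul_def r b }
  let τ' : F.obj (ModuleCat.of B K) ⟶ ModuleCat.of A N :=
    ModuleCat.ofHom (X := F.obj (ModuleCat.of B K))
    { toFun := fun k => τ k
      map_add' := fun x y => τ.map_add x y
      map_smul' := fun r k =>
        (congrArg τ (algebraMap_smul B r (show K from k))).trans (τ.map_smul r (show K from k)) }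
  let Φ : ModuleCat.of B K →ₗ[B]
      (ModuleCat.coextendScalars (algebraMap A B)).obj (ModuleCat.of A N) :=
    (ModuleCat.RestrictionCoextensionAdj.HomEquiv.fromRestriction (algebraMap A B) τ').hom
  have hΦ : ∀ (k : K) (b : B), ModuleCat.CoextendScalars.equiv (algebraMap A B) (ModuleCat.of A N)
      (Φ k) b = τ (b • k) := fun _ _ => rfl
  have hbij : Function.Bijective Φ := by
    constructor
    · rw [injective_iff_map_eq_zero]
      intro k hk
      refine hinj k fun b => ?_
      rw [← hΦ, hk]
      rfl
    · intro f
      obtain ⟨k, hk⟩ := hsurj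
        ((ModuleCat.CoextendScalars.equiv (algebraMap A B) (ModuleCat.of A N) f).comp
          e.toLinearMap)
      refine ⟨k, ModuleCat.CoextendScalars.ext (LinearMap.ext fun b => ?_)⟩
      exact (hΦ k b).trans (hk b).symm
  rw [ModuleCat.hasInjectiveDimensionLE_iff_of_linearEquiv (LinearEquiv.ofBijective Φ hbij)]
  refine hasInjectiveDimensionLE_coextendScalars n _ hN fun i hi => ?_
  exact subsingleton_ext_of_exact_projective (M := F.obj (ModuleCat.of B B)) (P := PUnit.{u + 1})
    (f := e.toLinearMap) (g := 0)
    (fun y => ⟨fun _ => e.surjective y, fun _ => rfl⟩) e.injective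
    (fun y => ⟨0, Subsingleton.elim _ _⟩) hi (hext i hi)

end Coextension

/-! ### Dimension of integral extensions -/

section IntegralDimension

theorem ringKrullDim_le_of_isIntegral (A B : Type*) [CommRing A] [CommRing B] [Algebra A B]
    [Algebra.IsIntegral A B] : ringKrullDim B ≤ ringKrullDim A :=
  Order.krullDim_le_of_strictMono (PrimeSpectrum.comap (algebraMap A B)) fun _ _ hpq =>
    Ideal.IsIntegral.comap_lt_comap hpq

end IntegralDimension

/-! ### The rings `A ⊕ I` -/

section IdealExtension

/-- `R = A ⊕ I` with the multiplication `(a, x)(b, y) = (ab, ay + bx + αxy)`. -/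
structure IsIdealExtension {A : Type u} [CommRing A] (I : Ideal A) (α : A) {R : Type u}
    [CommRing R] [Algebra A R] (j : I →ₗ[A] R) : Prop where
  bijective : Function.Bijective fun p : A × I => algebraMap A R p.1 + j p.2
  mul : ∀ x y : I, j x * j y = j ((α * x) • y)

namespace IsIdealExtension

variable {A : Type u} [CommRing A] {I : Ideal A} {α : A} {R : Type u} [CommRing R] [Algebra A R]
  {j : I →ₗ[A] R} (h : IsIdealExtension I α j)
include h

theorem exists_eq (r : R) : ∃ (s : A) (x : I), r = algebraMap A R s + j x := by
  obtain ⟨p, hp⟩ := h.bijective.2 r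
  exact ⟨p.1, p.2, hp.symm⟩

theorem ext_iff {s t : A} {x y : I} :
    algebraMap A R s + j x = algebraMap A R t + j y ↔ s = t ∧ x = y := by
  constructor
  · intro hst
    have := h.bijective.1 (a₁ := (s, x)) (a₂ := (t, y)) hst
    exact ⟨congrArg Prod.fst this, congrArg Prod.snd this⟩
  · rintro ⟨rfl, rfl⟩; rfl

theorem eq_zero_iff {s : A} {x : I} : algebraMap A R s + j x = 0 ↔ s = 0 ∧ x = 0 := by
  rw [← h.ext_iff]; simp

theorem mul_eq (s t : A) (x y : I) : (algebraMap A R s + j x) * (algebraMap A R t + j y) =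
    algebraMap A R (s * t) + j (s • y + t • x + (α * x) • y) := by
  rw [map_add, map_add, ← h.mul, map_smul, map_smul, Algebra.smul_def, Algebra.smul_def, map_mul]
  ring

/-- The decomposition `R = A ⊕ I`. -/
def equiv : (A × I) ≃ₗ[A] R :=
  LinearEquiv.ofBijective ((Algebra.linearMap A R).coprod j) h.bijective

theorem equiv_apply (s : A) (x : I) : h.equiv (s, x) = algebraMap A R s + j x := rfl

/-- The projection `R → A`. -/
def proj : R →+* A where
  toFun r := (h.equiv.symm r).1
  map_zero' := by simp
  map_add' := by simp
  map_one' := by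
    have : (1 : R) = h.equiv (1, 0) := by rw [h.equiv_apply]; simp
    rw [this, LinearEquiv.symm_apply_apply]
  map_mul' p q := by
    obtain ⟨s, x, rfl⟩ := h.exists_eq p
    obtain ⟨t, y, rfl⟩ := h.exists_eq q
    rw [h.mul_eq]
    simp only [← h.equiv_apply, LinearEquiv.symm_apply_apply]

theorem proj_apply (s : A) (x : I) : h.proj (algebraMap A R s + j x) = s :=
  congrArg Prod.fst (h.equiv.symm_apply_apply (s, x))

theorem injective_algebraMap : Function.Injective (algebraMap A R) := by
  rw [injective_iff_map_eq_zero]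
  intro s hs
  exact (h.eq_zero_iff (x := 0) |>.mp (by simpa using hs)).1

theorem isUnit_iff [IsLocalRing A] (hI : I ≠ ⊤) {s : A} {x : I} :
    IsUnit (algebraMap A R s + j x) ↔ IsUnit s := by
  constructor
  · intro hu
    rw [← h.proj_apply s x]
    exact hu.map h.proj
  · intro hs
    obtain ⟨u, rfl⟩ := hs
    have h1 : IsUnit ((u : A) + α * x) := by
      by_contra hn
      have h2 : (u : A) + α * x ∈ IsLocalRing.maximalIdeal A := hn
      have h3 : (u : A) ∈ IsLocalRing.maximalIdeal A :=
        (Ideal.add_mem_iff_left _ (Ideal.mul_mem_left _ _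
          (IsLocalRing.le_maximalIdeal hI x.2))).mp h2
      exact h3 u.isUnit
    obtain ⟨v, hv⟩ := h1
    -- Solving `uy + u⁻¹x + αxy = 0` for `y` gives the second component `-u⁻¹(u + αx)⁻¹x`; here `v =
    -- u + αx`.
    refine IsUnit.of_mul_eq_one (algebraMap A R (u⁻¹ : Aˣ) +
      j (-(((u⁻¹ : Aˣ) : A) * ((v⁻¹ : Aˣ) : A)) • x)) ?_
    rw [h.mul_eq]
    have h4 : (1 : R) = algebraMap A R 1 + j 0 := by simp
    rw [h4, h.ext_iff]
    refine ⟨u.mul_inv, Subtype.ext ?_⟩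
    push_cast
    simp only [smul_eq_mul]
    have h5 : ((u : A) + α * x) * (v⁻¹ : Aˣ) = 1 := by rw [← hv, Units.mul_inv]
    linear_combination (-((u⁻¹ : Aˣ) : A) * x) * h5

theorem isLocalRing [IsLocalRing A] (hI : I ≠ ⊤) : IsLocalRing R := by
  have : Nontrivial R := h.injective_algebraMap.nontrivial
  have : IsLocalHom h.proj := ⟨fun r hr => by
    obtain ⟨s, x, rfl⟩ := h.exists_eq r
    rw [h.proj_apply] at hr
    exact (h.isUnit_iff hI).mpr hr⟩
  exact RingHom.domain_isLocalRing h.proj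

theorem mem_maximalIdeal_iff [IsLocalRing A] [IsLocalRing R] (hI : I ≠ ⊤) {s : A} {x : I} :
    algebraMap A R s + j x ∈ IsLocalRing.maximalIdeal R ↔ s ∈ IsLocalRing.maximalIdeal A := by
  rw [IsLocalRing.mem_maximalIdeal, IsLocalRing.mem_maximalIdeal, mem_nonunits_iff,
    mem_nonunits_iff, h.isUnit_iff hI]

theorem algebraMap_mem_maximalIdeal_iff [IsLocalRing A] [IsLocalRing R] (hI : I ≠ ⊤) {s : A} :
    algebraMap A R s ∈ IsLocalRing.maximalIdeal R ↔ s ∈ IsLocalRing.maximalIdeal A := by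
  rw [← h.mem_maximalIdeal_iff hI (x := 0), map_zero, add_zero]

theorem finite [IsNoetherianRing A] : Module.Finite A R := Module.Finite.equiv h.equiv

theorem isNoetherianRing [IsNoetherianRing A] : IsNoetherianRing R :=
  have := h.finite
  IsNoetherianRing.of_finite A R

theorem ringKrullDim_eq [IsNoetherianRing A] : ringKrullDim R = ringKrullDim A := by
  have := h.finite
  refine le_antisymm (ringKrullDim_le_of_isIntegral A R)
    (ringKrullDim_le_of_surjective h.proj fun s => ⟨algebraMap A R s + j 0, h.proj_apply s 0⟩)

open RingTheory.Sequence in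
theorem isWeaklyRegular {rs : List A} (hA : IsWeaklyRegular A rs) (hI : IsWeaklyRegular I rs) :
    IsWeaklyRegular R (rs.map (algebraMap A R)) := by
  rw [isWeaklyRegular_map_algebraMap_iff, ← h.equiv.isWeaklyRegular_congr]
  exact isWeaklyRegular_of_exact rs (LinearMap.inl_injective (R := A) (M := A) (M₂ := I))
    Function.Exact.inl_snd LinearMap.snd_surjective hA hI

theorem radical_map_eq [IsLocalRing A] [IsLocalRing R] (hI : I ≠ ⊤) {q : Ideal A}
    (hq : q.radical = IsLocalRing.maximalIdeal A) :
    (q.map (algebraMap A R)).radical = IsLocalRing.maximalIdeal R := by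
  have hle : (IsLocalRing.maximalIdeal A).map (algebraMap A R) ≤
      (q.map (algebraMap A R)).radical := (Ideal.map_mono hq.ge).trans (Ideal.map_radical_le _)
  apply le_antisymm
  · rw [Ideal.IsPrime.radical_le_iff inferInstance, Ideal.map_le_iff_le_comap]
    intro s hs
    rw [Ideal.mem_comap, h.algebraMap_mem_maximalIdeal_iff hI, ← hq]
    exact Ideal.le_radical hs
  · intro r hr
    obtain ⟨s, x, rfl⟩ := h.exists_eq r
    rw [h.mem_maximalIdeal_iff hI] at hr
    refine add_mem (hle (Ideal.mem_map_of_mem _ hr)) ?_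
    -- The square of `j x` is `αx · j x`, and `αx` lies in the maximal ideal of `A`.
    refine Ideal.mem_radical_of_pow_mem (m := 2) ?_
    rw [pow_two, h.mul, map_smul, Algebra.smul_def]
    exact Ideal.mul_mem_right _ _ (hle (Ideal.mem_map_of_mem _
      (Ideal.mul_mem_left _ _ (IsLocalRing.le_maximalIdeal hI x.2))))

end IsIdealExtension

end IdealExtension

/-! ### The canonical ideal `I ⊕ aA` -/

section CanonicalIdeal

variable {A : Type u} [CommRing A] {I : Ideal A} {α a c : A} {R : Type u} [CommRing R]
  [Algebra A R] {j : I →ₗ[A] R}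

namespace IsIdealExtension

/-- The canonical ideal `I ⊕ aA` of `R = A ⊕ I`. -/
def canonicalIdeal (h : IsIdealExtension I α j) (hg : IsGoodPair I a c) : Ideal R where
  carrier := {r | ∃ (x : I) (y : A), r = algebraMap A R x + j (y • ⟨a, hg.left_mem⟩)}
  zero_mem' := ⟨0, 0, by simp⟩
  add_mem' := by
    rintro _ _ ⟨x, y, rfl⟩ ⟨x', y', rfl⟩
    refine ⟨x + x', y + y', ?_⟩
    rw [add_smul, map_add, Submodule.coe_add, map_add]
    ring
  smul_mem' := by
    rintro r _ ⟨x, y, rfl⟩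
    obtain ⟨s, u, rfl⟩ := h.exists_eq r
    obtain ⟨z, hz, hz'⟩ := hg.exists_mul_eq _ x.2 _ u.2
    -- The cross term `x u` lies in `I² = aI`, which is why `aA` suffices in the second summand; `z`
    -- is its quotient by `a`.
    refine ⟨s • x, s * y + z + α * u * y, ?_⟩
    rw [smul_eq_mul, h.mul_eq, h.ext_iff]
    refine ⟨rfl, Subtype.ext ?_⟩
    push_cast
    simp only [smul_eq_mul]
    rw [hz']
    ring

variable (h : IsIdealExtension I α j) (hg : IsGoodPair I a c)

theorem mem_canonicalIdeal {r : R} : r ∈ h.canonicalIdeal hg ↔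
    ∃ (x : I) (y : A), r = algebraMap A R x + j (y • ⟨a, hg.left_mem⟩) := Iff.rfl

theorem algebraMap_mem_canonicalIdeal {x : A} (hx : x ∈ I) :
    algebraMap A R x ∈ h.canonicalIdeal hg := ⟨⟨x, hx⟩, 0, by simp⟩

theorem map_mem_canonicalIdeal (y : A) :
    j (y • ⟨a, hg.left_mem⟩) ∈ h.canonicalIdeal hg := ⟨0, y, by simp⟩

theorem canonicalIdeal_eq_span : h.canonicalIdeal hg =
    Ideal.span {algebraMap A R a, algebraMap A R c, j ⟨a, hg.left_mem⟩} := by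
  apply le_antisymm
  · rintro _ ⟨x, y, rfl⟩
    obtain ⟨u, v, huv⟩ := hg.exists_eq _ x.2
    rw [huv, map_add, map_mul, map_mul, map_smul, Algebra.smul_def]
    refine add_mem (add_mem ?_ ?_) ?_ <;> exact Ideal.mul_mem_left _ _ (Ideal.subset_span (by simp))
  · rw [Ideal.span_le]
    rintro _ (rfl | rfl | rfl)
    · exact h.algebraMap_mem_canonicalIdeal hg hg.left_mem
    · exact h.algebraMap_mem_canonicalIdeal hg hg.right_mem
    · simpa using h.map_mem_canonicalIdeal hg 1

include h in
theorem canonicalIdeal_ext_iff {x x' : I} {y y' : A} :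
    algebraMap A R x + j (y • ⟨a, hg.left_mem⟩) =
      algebraMap A R x' + j (y' • ⟨a, hg.left_mem⟩) ↔ x = x' ∧ y = y' := by
  rw [h.ext_iff, Subtype.ext_iff, Subtype.ext_iff (a1 := x)]
  refine and_congr_right fun _ => ⟨fun hy => ?_, fun hy => by rw [hy]⟩
  have h1 : y * a = y' * a := hy
  refine sub_eq_zero.mp (hg.regular _ ?_)
  rw [mul_sub, mul_comm, h1]
  ring

/-- `I ⊕ aA ≅ I × A`. -/
def canonicalIdealEquiv : (I × A) ≃ₗ[A] h.canonicalIdeal hg :=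
  LinearEquiv.ofBijective
    { toFun := fun p => ⟨algebraMap A R p.1 + j (p.2 • ⟨a, hg.left_mem⟩), p.1, p.2, rfl⟩
      map_add' := fun p q => Subtype.ext (by
        change algebraMap A R ((p.1 + q.1 : I) : A) + j ((p.2 + q.2) • _) =
          (algebraMap A R p.1 + j (p.2 • _)) + (algebraMap A R q.1 + j (q.2 • _))
        rw [add_smul, map_add, Submodule.coe_add, map_add]
        ring)
      map_smul' := fun s p => Subtype.ext (by
        change algebraMap A R ((s • p.1 : I) : A) + j ((s • p.2) • _) =
          s • (algebraMap A R p.1 + j (p.2 • _))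
        rw [smul_add, smul_assoc, map_smul, Submodule.coe_smul, smul_eq_mul, map_mul,
          ← Algebra.smul_def]) } (by
    constructor
    · intro p q hpq
      exact Prod.ext_iff.mpr ((h.canonicalIdeal_ext_iff hg).mp (congrArg Subtype.val hpq))
    · rintro ⟨_, x, y, rfl⟩
      exact ⟨(x, y), rfl⟩)

theorem coe_canonicalIdealEquiv (x : I) (y : A) : (h.canonicalIdealEquiv hg (x, y) : R) =
    algebraMap A R x + j (y • ⟨a, hg.left_mem⟩) := rfl

/-- The coefficient `I ⊕ aA → aA ≅ A`. -/
def canonicalTrace : h.canonicalIdeal hg →ₗ[A] A :=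
  LinearMap.snd A I A ∘ₗ (h.canonicalIdealEquiv hg).symm.toLinearMap

theorem canonicalTrace_apply {k : h.canonicalIdeal hg} {x : I} {y : A}
    (hk : (k : R) = algebraMap A R x + j (y • ⟨a, hg.left_mem⟩)) :
    h.canonicalTrace hg k = y := by
  obtain rfl : k = h.canonicalIdealEquiv hg (x, y) := Subtype.ext hk
  exact congrArg Prod.snd ((h.canonicalIdealEquiv hg).symm_apply_apply (x, y))

/-- This computes the pairing `(r, k) ↦ tr(rk)`. The factor `a` clears the denominator of `ux/a`. -/
theorem canonicalTrace_mul_eq {k : h.canonicalIdeal hg} {x : I} {y : A}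
    (hk : (k : R) = algebraMap A R x + j (y • ⟨a, hg.left_mem⟩)) (s : A) (u : I) :
    a * h.canonicalTrace hg ((algebraMap A R s + j u) • k) =
      u * x + a * (s * y + α * u * y) := by
  obtain ⟨z, hz, hz'⟩ := hg.exists_mul_eq _ u.2 _ x.2
  rw [h.canonicalTrace_apply hg (x := s • x) (y := s * y + z + α * u * y)]
  · rw [hz']; ring
  · rw [Submodule.coe_smul, smul_eq_mul, hk, h.mul_eq, h.ext_iff]
    refine ⟨rfl, Subtype.ext ?_⟩
    push_cast
    simp only [smul_eq_mul]
    linear_combination hz'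

include h hg in
theorem subsingleton_ext (hinj : HasFiniteInjectiveDimension A A) (i : ℕ) (hi : 1 ≤ i) :
    Subsingleton (CategoryTheory.Abelian.Ext.{u} (ModuleCat.of A R) (ModuleCat.of A A) i) := by
  refine subsingleton_ext_of_exact_projective (P := A) (f := j)
    (g := LinearMap.fst A A I ∘ₗ h.equiv.symm.toLinearMap) ?_ ?_ ?_ hi
    (hg.subsingleton_ext hinj i hi)
  · intro r
    obtain ⟨s, x, rfl⟩ := h.exists_eq r
    change (h.equiv.symm (h.equiv (s, x))).1 = 0 ↔ _
    rw [LinearEquiv.symm_apply_apply]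
    constructor
    · intro hs
      change s = 0 at hs
      exact ⟨x, by simp [hs]⟩
    · rintro ⟨y, hy⟩
      exact ((h.ext_iff (s := 0) (x := y)).mp (by simpa using hy)).1.symm
  · rw [injective_iff_map_eq_zero]
    intro x hx
    exact ((h.eq_zero_iff (s := 0) (x := x)).mp (by simpa using hx)).2
  · intro s
    exact ⟨h.equiv (s, 0), by simp⟩

/-- The trace pairing identifies the ideal with `Hom_A(R, A)`, and coextension preserves the bound
on injective dimension because `Extⁱ_A(R, A) = 0` for `i ≥ 1`. -/
theorem hasFiniteInjectiveDimension_canonicalIdeal (hinj : HasFiniteInjectiveDimension A A) :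
    HasFiniteInjectiveDimension R (h.canonicalIdeal hg) := by
  obtain ⟨n, hn⟩ := id hinj
  refine ⟨n, hasInjectiveDimensionLE_of_coextension (h.canonicalTrace hg) (fun k hk => ?_)
    (fun f => ?_) hn (h.subsingleton_ext hg hinj)⟩
  -- Pairing with `1` detects `y`; then pairing with `j a` detects `x`.
  · obtain ⟨x, y, hxy⟩ := (h.mem_canonicalIdeal hg).mp k.2
    have h1 := h.canonicalTrace_mul_eq hg hxy 1 0
    have h2 := h.canonicalTrace_mul_eq hg hxy 0 ⟨a, hg.left_mem⟩
    rw [hk] at h1 h2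
    have hy : y = 0 := hg.regular _ (by simpa using h1.symm)
    subst hy
    have hx : (x : A) = 0 := hg.regular _ (by simpa using h2.symm)
    apply Subtype.ext
    rw [hxy, hx]
    simp
  · set φ := f ∘ₗ j with hφ
    have hcomm : ∀ x y : I, (x : A) * φ y = y * φ x := by
      intro x y
      rw [← smul_eq_mul, ← map_smul, ← smul_eq_mul, ← map_smul]
      congr 1
      exact Subtype.ext (mul_comm _ _)
    set a' : I := ⟨a, hg.left_mem⟩ with ha'
    have hφa : φ a' ∈ I := by
      refine hg.mem_of_dvd _ ⟨φ ⟨c, hg.right_mem⟩, ?_⟩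
      rw [mul_comm]
      exact hcomm ⟨c, hg.right_mem⟩ a'
    -- Every functional on `I` satisfies `aφ(u) = uφ(a)`, so it is determined by `φ(a)`. The pairing
    -- of `j u` with `(x, y)`, multiplied by `a`, is `u(x + αay)`; matching it with `uφ(a)` for `y =
    -- f 1` dictates `x`.
    let x : I := ⟨φ a' - α * a * f 1, sub_mem hφa
      (Ideal.mul_mem_right _ _ (Ideal.mul_mem_left _ _ hg.left_mem))⟩
    refine ⟨h.canonicalIdealEquiv hg (x, f 1), fun r => ?_⟩
    obtain ⟨s, u, rfl⟩ := h.exists_eq r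
    refine sub_eq_zero.mp (hg.regular _ ?_)
    rw [mul_sub, h.canonicalTrace_mul_eq hg (h.coe_canonicalIdealEquiv hg _ _), map_add,
      Algebra.algebraMap_eq_smul_one, map_smul, smul_eq_mul]
    have h1 : a * f (j u) = u * φ a' := hcomm a' u
    linear_combination h1

/-- From `aφ(k) = kφ(a)` an endomorphism is multiplication by `φ(a)/a`, so the point is that `φ(a) =
p + j(qa)` lies in `aR`. Testing on `k = j a` gives `a ∣ p`; testing on `k = c` gives `a ∣ qc`,
hence `q ∈ I`. -/
theorem bijective_algebraMap_end_canonicalIdeal :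
    Function.Bijective (algebraMap R (Module.End R (h.canonicalIdeal hg))) := by
  have hreg : ∀ r : R, algebraMap A R a * r = 0 → r = 0 := by
    intro r hr
    obtain ⟨s, u, rfl⟩ := h.exists_eq r
    rw [mul_add, ← map_mul, ← Algebra.smul_def, ← map_smul, h.eq_zero_iff] at hr
    rw [h.eq_zero_iff]
    exact ⟨hg.regular _ hr.1, Subtype.ext (hg.regular _ (congrArg Subtype.val hr.2))⟩
  have hcan : ∀ r r' : R, algebraMap A R a * r = algebraMap A R a * r' → r = r' := fun r r' hr =>
    sub_eq_zero.mp (hreg _ (by rw [mul_sub, hr, sub_self]))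
  let ka : h.canonicalIdeal hg := ⟨_, h.algebraMap_mem_canonicalIdeal hg hg.left_mem⟩
  constructor
  · rw [injective_iff_map_eq_zero]
    intro r hr
    have h1 : algebraMap R (Module.End R (h.canonicalIdeal hg)) r ka = 0 := by rw [hr]; rfl
    refine hreg r ?_
    rw [mul_comm]
    exact congrArg Subtype.val h1
  · intro φ
    have hcomm : ∀ k : h.canonicalIdeal hg, algebraMap A R a * (φ k : R) = k * (φ ka : R) := by
      intro k
      have h1 : (ka : R) • φ k = (k : R) • φ ka := by
        rw [← map_smul, ← map_smul]
        congr 1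
        exact Subtype.ext (mul_comm _ _)
      exact congrArg Subtype.val h1
    obtain ⟨p, q, hpq⟩ := (h.mem_canonicalIdeal hg).mp (φ ka).2
    -- the value at `j a`
    have hp : ∃ p₁, (p : A) = a * p₁ := by
      let k : h.canonicalIdeal hg := ⟨_, h.map_mem_canonicalIdeal hg 1⟩
      obtain ⟨x, z, hxz⟩ := (h.mem_canonicalIdeal hg).mp (φ k).2
      have h1 := hcomm k
      have h2 : (k : R) = algebraMap A R 0 + j ⟨a, hg.left_mem⟩ := by simp [k]
      have h3 : algebraMap A R a = algebraMap A R a + j 0 := by simp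
      rw [hxz, hpq, h2, h3, h.mul_eq, h.mul_eq, h.ext_iff] at h1
      have h4 := congrArg Subtype.val h1.2
      push_cast at h4
      simp only [smul_eq_mul] at h4
      refine ⟨z - α * q, hg.cancel ?_⟩
      linear_combination -h4
    have hq : q ∈ I := by
      let k : h.canonicalIdeal hg := ⟨_, h.algebraMap_mem_canonicalIdeal hg hg.right_mem⟩
      obtain ⟨x, z, hxz⟩ := (h.mem_canonicalIdeal hg).mp (φ k).2
      have h1 := hcomm k
      have h2 : (k : R) = algebraMap A R c + j 0 := by simp [k]
      have h3 : algebraMap A R a = algebraMap A R a + j 0 := by simp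
      rw [hxz, hpq, h2, h3, h.mul_eq, h.mul_eq, h.ext_iff] at h1
      have h4 := congrArg Subtype.val h1.2
      push_cast at h4
      simp only [smul_eq_mul] at h4
      refine hg.mem_of_dvd _ ⟨z, hg.cancel ?_⟩
      linear_combination -h4
    obtain ⟨p₁, hp₁⟩ := hp
    refine ⟨algebraMap A R p₁ + j ⟨q, hq⟩, LinearMap.ext fun k => Subtype.ext (hcan _ _ ?_)⟩
    have h5 : (φ ka : R) = algebraMap A R a * (algebraMap A R p₁ + j ⟨q, hq⟩) := by
      rw [hpq, mul_add, ← map_mul, ← Algebra.smul_def, ← map_smul, h.ext_iff]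
      exact ⟨hp₁, Subtype.ext (mul_comm _ _)⟩
    rw [hcomm k, h5]
    change algebraMap A R a * ((algebraMap A R p₁ + j ⟨q, hq⟩) * k) = _
    ring

theorem canonicalIdeal_ne_top : h.canonicalIdeal hg ≠ ⊤ := by
  rw [Ideal.ne_top_iff_one]
  rintro ⟨x, y, hxy⟩
  have h1 : (1 : R) = algebraMap A R 1 + j 0 := by simp
  rw [h1, h.ext_iff] at hxy
  exact hg.ne_top ((Ideal.eq_top_iff_one I).mpr (hxy.1 ▸ x.2))

end IsIdealExtension

end CanonicalIdeal

/-! ### Cohen–Macaulayness and the canonical module of `A ⊕ I` -/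

section LocalStructure

open RingTheory.Sequence

variable {A : Type u} [CommRing A] [IsLocalRing A] {I : Ideal A} {α a c : A} {R : Type u}
  [CommRing R] [IsLocalRing R] [Algebra A R] {j : I →ₗ[A] R}

namespace IsIdealExtension

variable (h : IsIdealExtension I α j) (hg : IsGoodPair I a c)
include h hg

/-- `R` is finite over `A` of the same dimension, so a maximal regular sequence of `A` measures
depth over `R`. The lemma serves both for `R` and for its canonical ideal. -/
theorem isMaximalCohenMacaulay (hA : IsCohenMacaulayLocalRing A) (M : Type u) [AddCommGroup M]
    [Module A M] [Module R M] [IsScalarTower A R M] [Module.Finite A M] [Nontrivial M]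
    (hM : ∀ rs : List A, IsWeaklyRegular A rs → IsWeaklyRegular I rs → IsWeaklyRegular M rs) :
    IsMaximalCohenMacaulay R M := by
  obtain ⟨hN, -, rs, hrm, hrs, hdim⟩ := hA
  have hfin : Module.Finite R M := Module.Finite.of_restrictScalars_finite A R M
  refine ⟨hfin, rs.map (algebraMap A R), ?_, ?_, ?_⟩
  · intro r hr
    obtain ⟨s, hs, rfl⟩ := List.mem_map.mp hr
    exact (h.algebraMap_mem_maximalIdeal_iff hg.ne_top).mpr (hrm s hs)
  · refine IsRegular.of_isWeaklyRegular_of_mem_maximalIdeal M ?_ ?_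
    · intro r hr
      obtain ⟨s, hs, rfl⟩ := List.mem_map.mp hr
      exact (h.algebraMap_mem_maximalIdeal_iff hg.ne_top).mpr (hrm s hs)
    · rw [isWeaklyRegular_map_algebraMap_iff]
      exact hM rs hrs.toIsWeaklyRegular (hg.isWeaklyRegular hrs.toIsWeaklyRegular)
  · rw [h.ringKrullDim_eq, hdim, List.length_map]

theorem isCohenMacaulayLocalRing (hA : IsCohenMacaulayLocalRing A) :
    IsCohenMacaulayLocalRing R := by
  have := hA.1
  have := h.finite
  refine ⟨h.isNoetherianRing, h.isMaximalCohenMacaulay hg hA R fun rs h1 h2 => ?_⟩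
  rw [← isWeaklyRegular_map_algebraMap_iff (S := R)]
  exact h.isWeaklyRegular h1 h2

theorem isCanonicalModule_canonicalIdeal (hA : IsCohenMacaulayLocalRing A)
    (hinj : HasFiniteInjectiveDimension A A) : IsCanonicalModule R (h.canonicalIdeal hg) := by
  have := hA.1
  have hfin : Module.Finite A (h.canonicalIdeal hg) :=
    Module.Finite.equiv (h.canonicalIdealEquiv hg)
  have : Nontrivial (h.canonicalIdeal hg) := (h.canonicalIdealEquiv hg).symm.toEquiv.nontrivial
  refine ⟨h.isMaximalCohenMacaulay hg hA _ fun rs h1 h2 => ?_,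
    h.hasFiniteInjectiveDimension_canonicalIdeal hg hinj,
    h.bijective_algebraMap_end_canonicalIdeal hg⟩
  rw [← (h.canonicalIdealEquiv hg).isWeaklyRegular_congr]
  exact isWeaklyRegular_of_exact rs (LinearMap.inl_injective (R := A) (M := I) (M₂ := A))
    Function.Exact.inl_snd LinearMap.snd_surjective h2 h1

end IsIdealExtension

end LocalStructure

/-! ### Lengths of localized modules -/

section LocalizedLength

variable {B : Type u} [CommRing B] (p : Ideal B) [hp : p.IsPrime]

theorem length_localizedModule_eq_add_of_exact {N M P : Type u} [AddCommGroup N]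
    [AddCommGroup M] [AddCommGroup P] [Module B N] [Module B M] [Module B P] {f : N →ₗ[B] M}
    {g : M →ₗ[B] P} (hf : Function.Injective f) (hg : Function.Surjective g)
    (hfg : Function.Exact f g) :
    Module.length (Localization.AtPrime p) (LocalizedModule p.primeCompl M) =
      Module.length (Localization.AtPrime p) (LocalizedModule p.primeCompl N) +
        Module.length (Localization.AtPrime p) (LocalizedModule p.primeCompl P) :=
  Module.length_eq_add_of_exact (LocalizedModule.map p.primeCompl f)
    (LocalizedModule.map p.primeCompl g) (IsLocalizedModule.map_injective _ _ _ f hf)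
    (IsLocalizedModule.map_surjective _ _ _ g hg) (LocalizedModule.map_exact _ f g hfg)

theorem length_localizedModule_congr {N M : Type u} [AddCommGroup N]
    [AddCommGroup M] [Module B N] [Module B M] (e : N ≃ₗ[B] M) :
    Module.length (Localization.AtPrime p) (LocalizedModule p.primeCompl N) =
      Module.length (Localization.AtPrime p) (LocalizedModule p.primeCompl M) :=
  (LinearEquiv.ofBijective (LocalizedModule.map p.primeCompl e.toLinearMap)
    ⟨IsLocalizedModule.map_injective _ _ _ e.toLinearMap e.injective,
      IsLocalizedModule.map_surjective _ _ _ e.toLinearMap e.surjective⟩).length_eq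

theorem length_localizedModule_quotient_self :
    Module.length (Localization.AtPrime p) (LocalizedModule p.primeCompl (B ⧸ p)) = 1 := by
  rw [Module.length_eq_one_iff, isSimpleModule_iff_toSpanSingleton_surjective]
  constructor
  · refine ⟨LocalizedModule.mk (1 : B ⧸ p) 1, 0, fun h => ?_⟩
    rw [← LocalizedModule.zero_mk 1, LocalizedModule.mk_eq] at h
    obtain ⟨u, hu⟩ := h
    simp only [one_smul, smul_zero] at hu
    refine u.2 (Ideal.Quotient.eq_zero_iff_mem.mp ?_)
    rw [← hu]
    change _ = ((u : B) • (1 : B ⧸ p))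
    rw [Algebra.smul_def, mul_one]
    rfl
  · intro x hx y
    induction x using LocalizedModule.induction_on with
    | _ m s =>
    induction y using LocalizedModule.induction_on with
    | _ n t =>
    obtain ⟨b, rfl⟩ := Ideal.Quotient.mk_surjective m
    obtain ⟨c, rfl⟩ := Ideal.Quotient.mk_surjective n
    have hb : b ∉ p := by
      intro hb
      rw [Ideal.Quotient.eq_zero_iff_mem.mpr hb, LocalizedModule.zero_mk] at hx
      exact hx rfl
    refine ⟨Localization.mk (c * s) (⟨b, hb⟩ * t), ?_⟩
    rw [LinearMap.toSpanSingleton_apply, LocalizedModule.mk_smul_mk, LocalizedModule.mk_eq]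
    refine ⟨1, ?_⟩
    rw [one_smul, one_smul]
    change Ideal.Quotient.mk p ((t : B) * (c * s * b)) = Ideal.Quotient.mk p (b * t * s * c)
    congr 1
    ring

end LocalizedLength

/-! ### Length of quotients of the Rees algebra at `𝔪R(Q)` -/

section ReesLength

variable {R : Type u} [CommRing R] [IsLocalRing R] {d : ℕ} {x : Fin d → R}

/-- A nonzero socle element of `R/L`, taken in `𝔪ᵏ⁻¹` for the least `k` with `𝔪ᵏ ≤ L`. -/
theorem exists_notMem_mul_mem_iff {L : Ideal R} (hL : L ≠ ⊤)
    (hk : ∃ k, IsLocalRing.maximalIdeal R ^ k ≤ L) :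
    ∃ s ∉ L, ∀ r, r ∈ IsLocalRing.maximalIdeal R ↔ s * r ∈ L := by
  classical
  have hk0 : Nat.find hk ≠ 0 := fun h0 => by
    have := Nat.find_spec hk
    rw [h0, pow_zero, Ideal.one_eq_top, top_le_iff] at this
    exact hL this
  obtain ⟨k, hk1⟩ := Nat.exists_eq_succ_of_ne_zero hk0
  have hlt := Nat.find_min hk (m := k) (by omega)
  obtain ⟨s, hs, hsL⟩ := SetLike.not_le_iff_exists.mp hlt
  refine ⟨s, hsL, fun r => ⟨fun hr => ?_, fun hr => ?_⟩⟩
  · refine Nat.find_spec hk ?_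
    rw [hk1, pow_succ]
    exact Ideal.mul_mem_mul hs hr
  · by_contra hr'
    have hu : IsUnit r := by simpa using hr'
    exact hsL ((Ideal.mul_unit_mem_iff_mem L hu).mp hr)

/-- With `L' = L : s`, multiplication by `s` embeds `B/L'` in `B/L`, with image generated by `s`. -/
theorem exact_quotient_mul {B : Type u} [CommRing B] {L L' : Ideal B} {s : B}
    (hs : ∀ r, r ∈ L' ↔ s * r ∈ L) :
    ∃ (f : (B ⧸ L') →ₗ[B] B ⧸ L) (g : (B ⧸ L) →ₗ[B] B ⧸ (L ⊔ Ideal.span {s})),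
      Function.Injective f ∧ Function.Surjective g ∧ Function.Exact f g := by
  refine ⟨Submodule.liftQ L' (L.mkQ.comp (LinearMap.mulLeft B s)) fun r hr => ?_,
    Submodule.factor le_sup_left, ?_, Submodule.factor_surjective _, ?_⟩
  · rw [LinearMap.mem_ker, LinearMap.comp_apply, LinearMap.mulLeft_apply, Submodule.mkQ_apply,
      Submodule.Quotient.mk_eq_zero]
    exact (hs r).mp hr
  · rw [injective_iff_map_eq_zero]
    intro y hy
    obtain ⟨r, rfl⟩ := Submodule.Quotient.mk_surjective _ y
    have h1 : s * r ∈ L := by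
      rw [← Submodule.Quotient.mk_eq_zero]; exact hy
    rw [Submodule.Quotient.mk_eq_zero]
    exact (hs r).mpr h1
  · intro y
    obtain ⟨r, rfl⟩ := Submodule.Quotient.mk_surjective _ y
    change Submodule.Quotient.mk r = (0 : B ⧸ _) ↔ _
    rw [Submodule.Quotient.mk_eq_zero]
    constructor
    · intro hr
      obtain ⟨l, hl, z, hz, rfl⟩ := Submodule.mem_sup.mp hr
      obtain ⟨t, rfl⟩ := Ideal.mem_span_singleton'.mp hz
      refine ⟨Submodule.Quotient.mk t, ?_⟩
      change Submodule.Quotient.mk (s * t) = (Submodule.Quotient.mk (l + t * s) : B ⧸ L)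
      rw [Submodule.Quotient.eq, mul_comm t, sub_add_cancel_right, neg_mem_iff]
      exact hl
    · rintro ⟨w, hw⟩
      obtain ⟨t, rfl⟩ := Submodule.Quotient.mk_surjective _ w
      have h1 : s * t - r ∈ L := by
        rw [← Submodule.Quotient.eq]; exact hw
      have h2 : r = s * t - (s * t - r) := by ring
      rw [h2]
      exact sub_mem (Ideal.mem_sup_right (Ideal.mul_mem_right _ _
        (Ideal.mem_span_singleton_self s))) (Ideal.mem_sup_left h1)

/-- For `Q` generated by a quasi-regular sequence, the length of `R(Q)/LR(Q)` at `𝔪R(Q)` is the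
length of `R/L`. -/
theorem length_localizedModule_rees_quotient [IsNoetherianRing R] (hx : IsQuasiRegular x)
    [hp : ((IsLocalRing.maximalIdeal R).map
      (algebraMap R (Rees (Ideal.span (Set.range x))))).IsPrime]
    (L : Ideal R) (hL : Ideal.span (Set.range x) ≤ L)
    (hk : ∃ k, IsLocalRing.maximalIdeal R ^ k ≤ L) :
    Module.length (Localization.AtPrime ((IsLocalRing.maximalIdeal R).map
        (algebraMap R (Rees (Ideal.span (Set.range x))))))
      (LocalizedModule ((IsLocalRing.maximalIdeal R).map
        (algebraMap R (Rees (Ideal.span (Set.range x))))).primeCompl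
        (Rees (Ideal.span (Set.range x)) ⧸
          L.map (algebraMap R (Rees (Ideal.span (Set.range x)))))) =
      Module.length R (R ⧸ L) := by
  induction L using WellFoundedGT.induction with
  | _ L ih =>
  by_cases hLt : L = ⊤
  · subst hLt
    have h0 : Subsingleton (R ⧸ (⊤ : Ideal R)) := Ideal.Quotient.subsingleton_iff.mpr rfl
    have h1 : Subsingleton (Rees (Ideal.span (Set.range x)) ⧸
        (⊤ : Ideal (Rees (Ideal.span (Set.range x))))) := Ideal.Quotient.subsingleton_iff.mpr rfl
    rw [Ideal.map_top, Module.length_eq_zero_iff.mpr h0]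
    refine Module.length_eq_zero_iff.mpr ⟨fun y z => ?_⟩
    induction y using LocalizedModule.induction_on with
    | _ m s =>
    induction z using LocalizedModule.induction_on with
    | _ n t =>
    rw [Subsingleton.elim m 0, Subsingleton.elim n 0, LocalizedModule.zero_mk,
      LocalizedModule.zero_mk]
  -- Adding a socle element `s` to `L` lowers both lengths by one. On the Rees side,
  -- quasi-regularity gives `LR(Q) : s = 𝔪R(Q)`, whose residue ring has length one at `𝔪R(Q)`.
  · obtain ⟨s, hsL, hs⟩ := exists_notMem_mul_mem_iff hLt hk
    have hlt : L < L ⊔ Ideal.span {s} := by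
      refine lt_of_le_of_ne le_sup_left fun h => hsL ?_
      rw [h]
      exact Ideal.mem_sup_right (Ideal.mem_span_singleton_self s)
    have h1 := ih _ hlt (hL.trans le_sup_left)
      (hk.imp fun k hk' => hk'.trans le_sup_left)
    obtain ⟨f, g, hf, hg, hfg⟩ := exact_quotient_mul hs
    obtain ⟨f', g', hf', hg', hfg'⟩ := exact_quotient_mul
      (B := Rees (Ideal.span (Set.range x)))
      (s := algebraMap R _ s) fun r => (algebraMap_mul_mem_map_iff hx hL hs r).symm
    have h2 : L.map (algebraMap R (Rees (Ideal.span (Set.range x)))) ⊔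
        Ideal.span {algebraMap R _ s} = (L ⊔ Ideal.span {s}).map (algebraMap R _) := by
      rw [Ideal.map_sup, Ideal.map_span, Set.image_singleton]
    rw [length_localizedModule_eq_add_of_exact _ hf' hg' hfg',
      length_localizedModule_quotient_self,
      length_localizedModule_congr _ (Submodule.quotEquivOfEq _ _ h2), h1,
      Module.length_eq_add_of_exact f g hf hg hfg]
    congr 1
    symm
    rw [Module.length_eq_one_iff, isSimpleModule_iff_isCoatom]
    exact (IsLocalRing.maximalIdeal.isMaximal R).out

end ReesLength

/-! ### Sally modules with one generator -/

section Sally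

variable {R : Type u} [CommRing R]

theorem mem_mulRees_iff {Q J L : Ideal R} (hQL : Q ≤ L) (f : R[X]) :
    f ∈ mulRees Q J L ↔ ∀ k, f.coeff k ∈ J * L ^ k := by
  constructor
  · intro hf
    refine Submodule.span_induction ?_ ?_ ?_ ?_ hf
    · rintro _ ⟨c, hc, g, hg, rfl⟩ k
      rw [coeff_C_mul]
      exact Ideal.mul_mem_mul hc (hg k)
    · intro k; simp
    · intro f g _ _ hf hg k
      rw [coeff_add]
      exact add_mem (hf k) (hg k)
    · intro a f _ hf k
      change (reesVal Q a * f).coeff k ∈ _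
      rw [coeff_mul]
      refine Ideal.sum_mem _ fun ij hij => ?_
      rw [Finset.HasAntidiagonal.mem_antidiagonal] at hij
      rw [← hij, pow_add, mul_left_comm]
      exact Ideal.mul_mem_mul (Ideal.pow_right_mono hQL _ (coeff_reesVal_mem a _)) (hf _)
  · intro hf
    rw [f.as_sum_support]
    refine Submodule.sum_mem _ fun k _ => ?_
    refine Submodule.mul_induction_on (hf k) ?_ ?_
    · intro c hc l hl
      refine Submodule.subset_span ⟨c, hc, monomial k l, reesAlgebra.monomial_mem.mpr hl, ?_⟩
      rw [C_mul_monomial]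
    · intro a b ha hb
      rw [map_add]
      exact add_mem ha hb

/-- The Sally module in degree `k + 1` is `Jᵏ⁺²/JQᵏ⁺¹`; this shows that `σQᵏ` generates it. The
second hypothesis prevents multiplication of `σ` by `J` from creating new generators. -/
theorem mul_pow_succ_le_of_sq_le {Q J : Ideal R} {σ : R}
    (hsq : J * J ≤ Q * J ⊔ Ideal.span {σ})
    (hσ : J * Ideal.span {σ} ≤ Q * Q * J ⊔ Q * Ideal.span {σ}) (k : ℕ) :
    J * J ^ (k + 1) ≤ J * Q ^ (k + 1) ⊔ Ideal.span {σ} * Q ^ k := by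
  induction k with
  | zero => simpa [mul_comm J Q] using hsq
  | succ k ih =>
    calc J * J ^ (k + 1 + 1) = J * (J * J ^ (k + 1)) := by rw [pow_succ' J (k + 1)]
      _ ≤ J * (J * Q ^ (k + 1) ⊔ Ideal.span {σ} * Q ^ k) := Ideal.mul_mono_right ih
      _ = (J * J) * Q ^ (k + 1) ⊔ (J * Ideal.span {σ}) * Q ^ k := by
        rw [Ideal.mul_sup, mul_assoc, mul_assoc]
      _ ≤ (Q * J ⊔ Ideal.span {σ}) * Q ^ (k + 1) ⊔ (Q * Q * J ⊔ Q * Ideal.span {σ}) * Q ^ k :=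
        sup_le_sup (Ideal.mul_mono_left hsq) (Ideal.mul_mono_left hσ)
      _ = (J * Q ^ (k + 1 + 1) ⊔ Ideal.span {σ} * Q ^ (k + 1)) ⊔
          (J * Q ^ (k + 1 + 1) ⊔ Ideal.span {σ} * Q ^ (k + 1)) := by
        rw [Ideal.sup_mul, Ideal.sup_mul]
        congr 2
        all_goals simp only [pow_succ']; ac_rfl
      _ = _ := sup_idem _

/-- The data describing a cyclic Sally module generated in degree one: `J² = QJ + (σ)` with
`σ = xᵢη ∈ J²`. -/
structure IsCyclicSally {d : ℕ} (x : Fin d → R) (J : Ideal R) (i : Fin d) (η : R) : Prop where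
  span_le : Ideal.span (Set.range x) ≤ J
  mem : x i * η ∈ J * J
  sq_le : J * J ≤ Ideal.span (Set.range x) * J ⊔ Ideal.span {x i * η}
  mul_le : J * Ideal.span {x i * η} ≤
    Ideal.span (Set.range x) * Ideal.span (Set.range x) * J ⊔
      Ideal.span (Set.range x) * Ideal.span {x i * η}

variable {d : ℕ} {x : Fin d → R} {J 𝔏 : Ideal R} {η : R} {i₀ : Fin d}

/-- If `f` is the value of the form `F`, then `f xᵢη` is the value of `XᵢηF`, a form of degree `k +
1`. Quasi-regularity puts its coefficients in `J`. The factor `xᵢ` of the generator provides the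
extra degree. -/
theorem mul_mem_mul_pow_succ_iff (hx : IsQuasiRegular x) (hJ : IsCyclicSally x J i₀ η)
    (h𝔏 : ∀ r, r ∈ 𝔏 ↔ η * r ∈ J) (k : ℕ) {f : R} (hf : f ∈ Ideal.span (Set.range x) ^ k) :
    f * (x i₀ * η) ∈ J * Ideal.span (Set.range x) ^ (k + 1) ↔
      f ∈ 𝔏 * Ideal.span (Set.range x) ^ k := by
  have hxi : x i₀ ∈ Ideal.span (Set.range x) := Ideal.subset_span (Set.mem_range_self i₀)
  constructor
  · intro h
    obtain ⟨F, hF, -, rfl⟩ := exists_isHomogeneous_eval_eq x ⊤ k (by rwa [Ideal.top_mul])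
    refine eval_mem_mul_pow x _ hF fun e => (h𝔏 _).mpr ?_
    have h1 : (MvPolynomial.X i₀ * (MvPolynomial.C η * F)).IsHomogeneous (k + 1) := by
      rw [add_comm k 1]
      exact (MvPolynomial.isHomogeneous_X R i₀).mul (isHomogeneous_C_mul hF η)
    have h2 := hx.coeff_mem hJ.span_le h1 (by
      rw [map_mul, map_mul, MvPolynomial.eval_X, MvPolynomial.eval_C]
      have h3 : x i₀ * (η * MvPolynomial.eval x F) = MvPolynomial.eval x F * (x i₀ * η) := by ring
      rwa [h3]) (Finsupp.single i₀ 1 + e)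
    rwa [MvPolynomial.coeff_X_mul, MvPolynomial.coeff_C_mul] at h2
  · intro h
    refine Submodule.mul_induction_on h (fun l hl q hq => ?_) fun a b ha hb => ?_
    · have h1 : l * q * (x i₀ * η) = (η * l) * (q * x i₀) := by ring
      rw [h1, pow_succ]
      exact Ideal.mul_mem_mul ((h𝔏 l).mp hl) (Ideal.mul_mem_mul hq hxi)
    · rw [add_mul]
      exact add_mem ha hb

/-- Multiplication by the degree one generator of a cyclic Sally module. -/
def sallyGenerator (hJ : IsCyclicSally x J i₀ η) : mulRees (Ideal.span (Set.range x)) J J :=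
  ⟨monomial 1 (x i₀ * η), (mem_mulRees_iff hJ.span_le _).mpr fun k => by
    rw [coeff_monomial]
    split_ifs with h
    · rw [← h, pow_one]; exact hJ.mem
    · exact zero_mem _⟩

theorem coeff_smul_sallyGenerator (hJ : IsCyclicSally x J i₀ η)
    (f : Rees (Ideal.span (Set.range x))) (k : ℕ) :
    ((f • sallyGenerator hJ : mulRees (Ideal.span (Set.range x)) J J) : R[X]).coeff (k + 1) =
      (reesVal _ f).coeff k * (x i₀ * η) := by
  change (reesVal _ f * monomial 1 (x i₀ * η)).coeff (k + 1) = _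
  exact coeff_mul_monomial _ _ _ _

theorem coeff_zero_smul_sallyGenerator (hJ : IsCyclicSally x J i₀ η)
    (f : Rees (Ideal.span (Set.range x))) :
    ((f • sallyGenerator hJ : mulRees (Ideal.span (Set.range x)) J J) : R[X]).coeff 0 = 0 := by
  change (reesVal _ f * monomial 1 (x i₀ * η)).coeff 0 = _
  rw [mul_coeff_zero, coeff_monomial]
  simp

theorem surjective_toSpanSingleton_sallyGenerator (hJ : IsCyclicSally x J i₀ η) :
    Function.Surjective (LinearMap.toSpanSingleton (Rees (Ideal.span (Set.range x)))
      (SallyModule (Ideal.span (Set.range x)) J) (Submodule.Quotient.mk (sallyGenerator hJ))) := by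
  intro s
  obtain ⟨f, rfl⟩ := Submodule.Quotient.mk_surjective _ s
  have hf := (mem_mulRees_iff hJ.span_le _).mp f.2
  have h1 : ∀ k, ∃ g ∈ Ideal.span (Set.range x) ^ k,
      (f : R[X]).coeff (k + 1) - g * (x i₀ * η) ∈ J * Ideal.span (Set.range x) ^ (k + 1) := by
    intro k
    obtain ⟨y, hy, z, hz, hyz⟩ := Submodule.mem_sup.mp
      (mul_pow_succ_le_of_sq_le hJ.sq_le hJ.mul_le k (hf (k + 1)))
    obtain ⟨g, hg, rfl⟩ := Ideal.mem_span_singleton_mul.mp hz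
    refine ⟨g, hg, ?_⟩
    rw [← hyz, mul_comm g, add_sub_cancel_right]
    exact hy
  choose g hg hfg using h1
  -- The multiplier is assembled degree by degree; its coefficient `k` accounts for the coefficient
  -- `k + 1` of `f`, hence the cut at `natDegree`. The constant coefficient is already zero in the
  -- quotient.
  obtain ⟨G, hG⟩ := reesVal_surj (Q := Ideal.span (Set.range x))
    (∑ k ∈ Finset.range (f : R[X]).natDegree, monomial k (g k)) fun k => by
      rw [finsetSum_coeff]
      refine Ideal.sum_mem _ fun l _ => ?_
      rw [coeff_monomial]
      split_ifs with h
      · exact h ▸ hg l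
      · exact zero_mem _
  have hGc : ∀ k, (reesVal _ G).coeff k = if k < (f : R[X]).natDegree then g k else 0 := by
    intro k
    rw [hG, finsetSum_coeff]
    simp only [coeff_monomial, Finset.sum_ite_eq', Finset.mem_range]
  refine ⟨G, ?_⟩
  rw [LinearMap.toSpanSingleton_apply, ← Submodule.Quotient.mk_smul, eq_comm,
    Submodule.Quotient.eq, Submodule.submoduleOf, Submodule.mem_comap,
    Submodule.subtype_apply, mem_mulRees_iff le_rfl]
  intro k
  rw [Submodule.coe_sub, coeff_sub]
  rcases k with _ | k
  · rw [coeff_zero_smul_sallyGenerator, sub_zero, pow_zero]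
    simpa using hf 0
  · rw [coeff_smul_sallyGenerator, hGc]
    split_ifs with h
    · exact hfg k
    · rw [coeff_eq_zero_of_natDegree_lt (by omega)]
      simp

/-- With surjectivity this identifies the Sally module with `R(Q)/𝔏R(Q)`, shifted by one degree,
where `𝔏 = J : η`. -/
theorem ker_toSpanSingleton_sallyGenerator (hx : IsQuasiRegular x) (hJ : IsCyclicSally x J i₀ η)
    (h𝔏 : ∀ r, r ∈ 𝔏 ↔ η * r ∈ J) :
    LinearMap.ker (LinearMap.toSpanSingleton (Rees (Ideal.span (Set.range x)))
      (SallyModule (Ideal.span (Set.range x)) J) (Submodule.Quotient.mk (sallyGenerator hJ))) =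
      𝔏.map (algebraMap R _) := by
  ext f
  rw [LinearMap.mem_ker, LinearMap.toSpanSingleton_apply, ← Submodule.Quotient.mk_smul,
    Submodule.Quotient.mk_eq_zero, Submodule.submoduleOf, Submodule.mem_comap,
    Submodule.subtype_apply, mem_mulRees_iff le_rfl,
    mem_map_algebraMap_rees_iff]
  constructor
  · intro h k
    have h1 := h (k + 1)
    rw [coeff_smul_sallyGenerator] at h1
    exact (mul_mem_mul_pow_succ_iff hx hJ h𝔏 k (coeff_reesVal_mem f k)).mp h1
  · intro h k
    rcases k with _ | k
    · rw [coeff_zero_smul_sallyGenerator]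
      exact zero_mem _
    · rw [coeff_smul_sallyGenerator]
      exact (mul_mem_mul_pow_succ_iff hx hJ h𝔏 k (coeff_reesVal_mem f k)).mpr (h k)

theorem span_sallyDegreeOne_eq_top (hJ : IsCyclicSally x J i₀ η) :
    Submodule.span (Rees (Ideal.span (Set.range x)))
      (sallyDegreeOne (Ideal.span (Set.range x)) J) = ⊤ := by
  rw [eq_top_iff]
  intro s _
  obtain ⟨f, rfl⟩ := surjective_toSpanSingleton_sallyGenerator hJ s
  rw [LinearMap.toSpanSingleton_apply]
  exact Submodule.smul_mem _ _ (Submodule.subset_span ⟨sallyGenerator hJ, ⟨_, rfl⟩, rfl⟩)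

theorem hasSallyRank_of_isCyclicSally [IsLocalRing R] [IsNoetherianRing R] (hx : IsQuasiRegular x)
    (hJ : IsCyclicSally x J i₀ η) (h𝔏 : ∀ r, r ∈ 𝔏 ↔ η * r ∈ J)
    (hJm : J ≤ IsLocalRing.maximalIdeal R) (hk : ∃ k, IsLocalRing.maximalIdeal R ^ k ≤ 𝔏) {n : ℕ}
    (hn : Module.length R (R ⧸ 𝔏) = n) : HasSallyRank (Ideal.span (Set.range x)) J n := by
  have hp := isPrime_map_algebraMap_rees hx (hJ.span_le.trans hJm)
  refine ⟨hp, ?_⟩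
  have hQ𝔏 : Ideal.span (Set.range x) ≤ 𝔏 := fun r hr =>
    (h𝔏 r).mpr (J.mul_mem_left _ (hJ.span_le hr))
  rw [← hn, ← length_localizedModule_rees_quotient hx 𝔏 hQ𝔏 hk]
  exact length_localizedModule_congr _ (((Submodule.quotEquivOfEq _ _
    (ker_toSpanSingleton_sallyGenerator hx hJ h𝔏).symm).trans
    (LinearMap.quotKerEquivOfSurjective _
      (surjective_toSpanSingleton_sallyGenerator hJ))).symm)

end Sally

/-! ### Quadratic relations giving one Sally generator -/

section SquareRelations

variable {R : Type u} [CommRing R] {Q : Ideal R} {γ ε a₀ u v w : R}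

/-- Of the products of `γ` and `ε`, both squares fall into `QJ`, so only `γε` is new. -/
theorem mul_self_le_of_relations (ha : a₀ ∈ Q) (hγ : γ * γ = a₀ * (u * a₀ + v * γ))
    (hε : ε * ε = w * a₀ * ε) :
    (Q ⊔ Ideal.span {γ, ε}) * (Q ⊔ Ideal.span {γ, ε}) ≤
      Q * (Q ⊔ Ideal.span {γ, ε}) ⊔ Ideal.span {γ * ε} := by
  have hγJ : γ ∈ Q ⊔ Ideal.span {γ, ε} := Ideal.mem_sup_right (Ideal.subset_span (by simp))
  have hεJ : ε ∈ Q ⊔ Ideal.span {γ, ε} := Ideal.mem_sup_right (Ideal.subset_span (by simp))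
  have haJ : a₀ ∈ Q ⊔ Ideal.span {γ, ε} := Ideal.mem_sup_left ha
  have h1 : Ideal.span {γ, ε} * Q ≤ Q * (Q ⊔ Ideal.span {γ, ε}) := by
    rw [mul_comm]; exact Ideal.mul_mono_right le_sup_right
  conv_lhs => rw [Ideal.sup_mul, Ideal.mul_sup (Ideal.span {γ, ε}), Ideal.span_pair_mul_span_pair]
  refine sup_le le_sup_left (sup_le (h1.trans le_sup_left) (Ideal.span_le.mpr ?_))
  have hσ : γ * ε ∈ Q * (Q ⊔ Ideal.span {γ, ε}) ⊔ Ideal.span {γ * ε} :=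
    Ideal.mem_sup_right (Ideal.mem_span_singleton_self _)
  rintro _ (rfl | rfl | rfl | rfl)
  · rw [hγ]
    exact Ideal.mem_sup_left (Ideal.mul_mem_mul ha
      (add_mem (Ideal.mul_mem_left _ _ haJ) (Ideal.mul_mem_left _ _ hγJ)))
  · exact hσ
  · rw [mul_comm ε γ]; exact hσ
  · rw [hε, mul_assoc]
    exact Ideal.mem_sup_left (Ideal.mul_mem_left _ _ (Ideal.mul_mem_mul ha hεJ))

/-- Multiplying the relations by `ε` and `γ` gives `γ·γε = ua₀²ε + va₀γε` and `ε·γε = wa₀γε`. -/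
theorem mul_span_le_of_relations (ha : a₀ ∈ Q) (hγ : γ * γ = a₀ * (u * a₀ + v * γ))
    (hε : ε * ε = w * a₀ * ε) :
    (Q ⊔ Ideal.span {γ, ε}) * Ideal.span {γ * ε} ≤
      Q * Q * (Q ⊔ Ideal.span {γ, ε}) ⊔ Q * Ideal.span {γ * ε} := by
  have hεJ : ε ∈ Q ⊔ Ideal.span {γ, ε} := Ideal.mem_sup_right (Ideal.subset_span (by simp))
  have hσ : a₀ * (γ * ε) ∈ Q * Ideal.span {γ * ε} :=
    Ideal.mul_mem_mul ha (Ideal.mem_span_singleton_self _)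
  conv_lhs => rw [Ideal.sup_mul, Ideal.span_mul_span']
  refine sup_le le_sup_right (Ideal.span_le.mpr ?_)
  rintro _ ⟨y, (rfl | rfl), _, rfl, rfl⟩
  · have h1 : y * (y * ε) = u * (a₀ * a₀ * ε) + v * (a₀ * (y * ε)) := by
      linear_combination ε * hγ
    change y * (y * ε) ∈ _
    rw [h1]
    exact add_mem (Ideal.mem_sup_left (Ideal.mul_mem_left _ _
      (Ideal.mul_mem_mul (Ideal.mul_mem_mul ha ha) hεJ)))
      (Ideal.mem_sup_right (Ideal.mul_mem_left _ _ hσ))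
  · have h1 : y * (γ * y) = w * (a₀ * (γ * y)) := by
      linear_combination γ * hε
    change y * (γ * y) ∈ _
    rw [h1]
    exact Ideal.mem_sup_right (Ideal.mul_mem_left _ _ hσ)

end SquareRelations

/-! ### Ideals of parameters -/

section Parameters

open IsLocalRing RingTheory.Sequence

variable {A : Type u} [CommRing A] {I : Ideal A} {a c : A} {m : ℕ}

theorem span_range_cons (a : A) (b : Fin m → A) :
    Ideal.span (Set.range (Fin.cons a b : Fin (m + 1) → A)) =
      Ideal.span {a} ⊔ Ideal.span (Set.range b) := by
  rw [Fin.range_cons, Set.insert_eq, Ideal.span_union]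

theorem ofList_ofFn (x : Fin m → A) : Ideal.ofList (List.ofFn x) = Ideal.span (Set.range x) := by
  rw [Ideal.ofList]
  congr 1
  ext y
  change y ∈ List.ofFn x ↔ _
  rw [List.mem_ofFn]
  exact Iff.rfl

theorem ofList_reverse (rs : List A) : Ideal.ofList rs.reverse = Ideal.ofList rs := by
  rw [Ideal.ofList, Ideal.ofList]
  congr 1
  ext y
  exact List.mem_reverse

theorem radical_span_cons_eq [IsLocalRing A] {b : Fin m → A} (haI : a ∈ I)
    (hdvd : ∀ x ∈ I, ∃ k, a ∣ x ^ k) (hb : (I ⊔ Ideal.span (Set.range b)).radical = maximalIdeal A) :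
    (Ideal.span (Set.range (Fin.cons a b : Fin (m + 1) → A))).radical = maximalIdeal A := by
  rw [span_range_cons]
  apply le_antisymm
  · rw [← hb]
    exact Ideal.radical_mono (sup_le_sup_right ((Ideal.span_singleton_le_iff_mem _).mpr haI) _)
  · rw [← hb, Ideal.radical_le_radical_iff]
    refine sup_le (fun x hx => ?_) (le_sup_right.trans Ideal.le_radical)
    obtain ⟨k, hk⟩ := hdvd x hx
    exact ⟨k, Ideal.mem_sup_left (Ideal.mem_span_singleton.mpr hk)⟩

end Parameters

/-! ### The rings `A ⊕ I` are Goto rings -/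

section Goto

open IsLocalRing RingTheory.Sequence

variable {A : Type u} [CommRing A] {I : Ideal A} {α a c : A} {R : Type u} [CommRing R]
  [Algebra A R] {j : I →ₗ[A] R} {m : ℕ}

namespace IsIdealExtension

/-- The projection `R = A ⊕ I → I`. -/
def projIdeal (h : IsIdealExtension I α j) : R →ₗ[A] I :=
  LinearMap.snd A A I ∘ₗ h.equiv.symm.toLinearMap

variable (h : IsIdealExtension I α j) (hg : IsGoodPair I a c)

theorem projIdeal_apply (s : A) (x : I) : h.projIdeal (algebraMap A R s + j x) = x :=
  congrArg Prod.snd (h.equiv.symm_apply_apply (s, x))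

theorem canonicalIdeal_sup_eq {b : Fin m → A} : h.canonicalIdeal hg ⊔
      Ideal.span (Set.range fun i => algebraMap A R ((Fin.cons a b : Fin (m + 1) → A) i)) =
    Ideal.span (Set.range fun i => algebraMap A R ((Fin.cons a b : Fin (m + 1) → A) i)) ⊔
      Ideal.span {algebraMap A R c, j ⟨a, hg.left_mem⟩} := by
  have h1 : Ideal.span {algebraMap A R a} ≤
      Ideal.span (Set.range fun i => algebraMap A R ((Fin.cons a b : Fin (m + 1) → A) i)) :=
    (Ideal.span_singleton_le_iff_mem _).mpr (Ideal.subset_span ⟨0, rfl⟩)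
  rw [h.canonicalIdeal_eq_span hg, Set.insert_eq, Ideal.span_union, sup_comm, ← sup_assoc,
    sup_eq_left.mpr h1]

/-- The relations apply with `γ = c` and `ε = j a`. The generator `c · j a` equals `a · j c`, since
both are `j(ac)`; this is the required shape `x₀η` with `η = j c`. -/
theorem isCyclicSally (b : Fin m → A) :
    IsCyclicSally (fun i => algebraMap A R ((Fin.cons a b : Fin (m + 1) → A) i))
      (h.canonicalIdeal hg ⊔
        Ideal.span (Set.range fun i => algebraMap A R ((Fin.cons a b : Fin (m + 1) → A) i)))
      0 (j ⟨c, hg.right_mem⟩) := by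
  have hσ : algebraMap A R c * j ⟨a, hg.left_mem⟩ = algebraMap A R a * j ⟨c, hg.right_mem⟩ := by
    rw [← Algebra.smul_def, ← Algebra.smul_def, ← map_smul, ← map_smul]
    congr 1
    exact Subtype.ext (mul_comm _ _)
  have haQ : algebraMap A R a ∈
      Ideal.span (Set.range fun i => algebraMap A R ((Fin.cons a b : Fin (m + 1) → A) i)) :=
    Ideal.subset_span ⟨0, rfl⟩
  obtain ⟨z, hz, hz'⟩ := hg.exists_mul_eq _ hg.right_mem _ hg.right_mem
  obtain ⟨u, v, rfl⟩ := hg.exists_eq z hz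
  have hγ : algebraMap A R c * algebraMap A R c = algebraMap A R a *
      (algebraMap A R u * algebraMap A R a + algebraMap A R v * algebraMap A R c) := by
    simp only [← map_mul, ← map_add, hz']
  have hε : j ⟨a, hg.left_mem⟩ * j ⟨a, hg.left_mem⟩ =
      algebraMap A R α * algebraMap A R a * j ⟨a, hg.left_mem⟩ := by
    rw [h.mul, map_smul, Algebra.smul_def, map_mul]
  refine ⟨le_sup_right, ?_, ?_, ?_⟩
  · change algebraMap A R a * j ⟨c, hg.right_mem⟩ ∈ _
    rw [← hσ]
    refine Ideal.mul_mem_mul (Ideal.mem_sup_left ?_) (Ideal.mem_sup_left ?_)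
    · exact h.algebraMap_mem_canonicalIdeal hg hg.right_mem
    · simpa using h.map_mem_canonicalIdeal hg 1
  · rw [h.canonicalIdeal_sup_eq hg]
    change _ ≤ _ ⊔ Ideal.span {algebraMap A R a * j ⟨c, hg.right_mem⟩}
    rw [← hσ]
    exact mul_self_le_of_relations haQ hγ hε
  · rw [h.canonicalIdeal_sup_eq hg]
    change _ * Ideal.span {algebraMap A R a * j ⟨c, hg.right_mem⟩} ≤
      _ ⊔ _ * Ideal.span {algebraMap A R a * j ⟨c, hg.right_mem⟩}
    rw [← hσ]
    exact mul_span_le_of_relations haQ hγ hε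

/-- A necessary condition, read off in the summand `I`, which bounds the colon ideal of `j c` from
above. -/
theorem projIdeal_mem_of_mem {b : Fin m → A} {r : R} (hr : r ∈ h.canonicalIdeal hg ⊔
      Ideal.span (Set.range fun i => algebraMap A R ((Fin.cons a b : Fin (m + 1) → A) i))) :
    (h.projIdeal r : A) ∈ Ideal.span (Set.range b) * Ideal.span {c} ⊔ Ideal.span {a} := by
  obtain ⟨_, ⟨x, y, rfl⟩, q, hq, rfl⟩ := Submodule.mem_sup.mp hr
  rw [map_add, h.projIdeal_apply]
  refine add_mem (Ideal.mem_sup_right (Ideal.mem_span_singleton'.mpr ⟨y, rfl⟩)) ?_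
  obtain ⟨f, rfl⟩ := (Submodule.mem_span_range_iff_exists_fun _).mp hq
  rw [map_sum, Submodule.coe_sum]
  refine Ideal.sum_mem _ fun i _ => ?_
  rw [smul_eq_mul, mul_comm (f i), ← Algebra.smul_def, map_smul, Submodule.coe_smul, smul_eq_mul]
  obtain ⟨u, v, huv⟩ := hg.exists_eq _ (h.projIdeal (f i)).2
  rw [huv]
  refine Fin.cases ?_ (fun i => ?_) i
  · exact Ideal.mem_sup_right (Ideal.mul_mem_right _ _ (Ideal.mem_span_singleton_self a))
  · rw [Fin.cons_succ]
    have h1 : b i * (u * a + v * c) = v * (b i * c) + b i * u * a := by ring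
    rw [h1]
    exact add_mem (Ideal.mem_sup_left (Ideal.mul_mem_left _ _ (Ideal.mul_mem_mul
      (Ideal.subset_span (Set.mem_range_self i)) (Ideal.mem_span_singleton_self c))))
      (Ideal.mem_sup_right (Ideal.mul_mem_left _ _ (Ideal.mem_span_singleton_self a)))

/-- The product of `j c` with `s + j x` has `I`-component `sc + αxc`, and `xc ∈ aI`. So the
condition is `sc ∈ (b)c + (a)`, that is, `s ∈ (b) + I`. -/
theorem mem_comap_proj_iff (b : Fin m → A) (r : R) :
    r ∈ (I ⊔ Ideal.span (Set.range b)).comap h.proj ↔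
      j ⟨c, hg.right_mem⟩ * r ∈ h.canonicalIdeal hg ⊔
        Ideal.span (Set.range fun i => algebraMap A R ((Fin.cons a b : Fin (m + 1) → A) i)) := by
  obtain ⟨s, x, rfl⟩ := h.exists_eq r
  rw [Ideal.mem_comap, h.proj_apply]
  have hη : j ⟨c, hg.right_mem⟩ = algebraMap A R 0 + j ⟨c, hg.right_mem⟩ := by simp
  have hK : ∀ i ∈ I, j (i • ⟨c, hg.right_mem⟩) ∈ h.canonicalIdeal hg := by
    intro i hi
    obtain ⟨z, -, hz⟩ := hg.exists_mul_eq _ hi _ hg.right_mem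
    have h1 : (i • ⟨c, hg.right_mem⟩ : I) = z • ⟨a, hg.left_mem⟩ :=
      Subtype.ext (hz.trans (mul_comm _ _))
    rw [h1]
    exact h.map_mem_canonicalIdeal hg z
  constructor
  · intro hs
    rw [mul_add]
    refine add_mem ?_ ?_
    · obtain ⟨i, hi, t, ht, rfl⟩ := Submodule.mem_sup.mp hs
      rw [map_add, mul_add]
      refine add_mem (Ideal.mem_sup_left ?_) (Ideal.mem_sup_right (Ideal.mul_mem_left _ _ ?_))
      · rw [mul_comm, ← Algebra.smul_def, ← map_smul]
        exact hK i hi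
      · have h1 : Ideal.span (Set.range b) ≤ (Ideal.span (Set.range fun i =>
            algebraMap A R ((Fin.cons a b : Fin (m + 1) → A) i))).comap (algebraMap A R) := by
          rw [Ideal.span_le]
          rintro _ ⟨i, rfl⟩
          exact Ideal.subset_span ⟨i.succ, rfl⟩
        exact h1 ht
    · rw [mul_comm, h.mul]
      exact Ideal.mem_sup_left (hK _ (Ideal.mul_mem_left _ _ x.2))
  · intro hr
    have h1 := h.projIdeal_mem_of_mem hg hr
    rw [hη, h.mul_eq, h.projIdeal_apply] at h1
    push_cast at h1
    simp only [smul_eq_mul, zero_mul, zero_add] at h1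
    obtain ⟨_, ht, y, hy, hty⟩ := Submodule.mem_sup.mp h1
    obtain ⟨t, ht', rfl⟩ := Ideal.mem_mul_span_singleton.mp ht
    obtain ⟨y, rfl⟩ := Ideal.mem_span_singleton'.mp hy
    obtain ⟨z, -, hz⟩ := hg.exists_mul_eq _ hg.right_mem _ x.2
    have h2 : s - t ∈ I := by
      refine hg.mem_of_dvd _ ⟨y - α * z, ?_⟩
      linear_combination -hty - α * hz
    have h3 : s = (s - t) + t := by ring
    rw [h3]
    exact add_mem (Ideal.mem_sup_left h2) (Ideal.mem_sup_right ht')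

theorem length_quotient_comap_proj (L : Ideal A) :
    Module.length R (R ⧸ L.comap h.proj) = Module.length A (A ⧸ L) := by
  have hj : ∀ x : I, j x ∈ L.comap h.proj := fun x => by
    have h1 : j x = algebraMap A R 0 + j x := by simp
    rw [Ideal.mem_comap, h1, h.proj_apply]
    exact zero_mem _
  have hsurj : Function.Surjective (algebraMap A (R ⧸ L.comap h.proj)) := by
    intro y
    obtain ⟨r, rfl⟩ := Ideal.Quotient.mk_surjective y
    obtain ⟨s, x, rfl⟩ := h.exists_eq r
    refine ⟨s, ?_⟩
    rw [map_add, Ideal.Quotient.eq_zero_iff_mem.mpr (hj x), add_zero]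
    rfl
  have hker : LinearMap.ker (Algebra.linearMap A (R ⧸ L.comap h.proj)) = L := by
    ext s
    rw [LinearMap.mem_ker, Algebra.linearMap_apply,
      IsScalarTower.algebraMap_apply A R (R ⧸ L.comap h.proj), Ideal.Quotient.algebraMap_eq,
      Ideal.Quotient.eq_zero_iff_mem, Ideal.mem_comap]
    have h1 : algebraMap A R s = algebraMap A R s + j 0 := by simp
    rw [h1, h.proj_apply]
  rw [Module.length_eq_of_surjective (S := R) (R := R ⧸ L.comap h.proj)
    Ideal.Quotient.mk_surjective, ← Module.length_eq_of_surjective (S := A) hsurj]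
  exact (((Submodule.quotEquivOfEq _ _ hker).symm.trans
    (LinearMap.quotKerEquivOfSurjective _ hsurj)).length_eq).symm

include h hg in
/-- The extensions `A ⊕ I` of a Gorenstein ring by an Ulrich ideal are Goto rings. -/
theorem isGotoRing [IsLocalRing A] (hA : IsGorensteinLocalRing A)
    (hdim : ringKrullDim A = (m + 1 : ℕ)) {b : Fin m → A}
    (hb : (I ⊔ Ideal.span (Set.range b)).radical = maximalIdeal A) {n : ℕ}
    (hn : Module.length A (A ⧸ (I ⊔ Ideal.span (Set.range b))) = n) : IsGotoRing n R := by
  have := hA.1.1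
  have hloc := h.isLocalRing hg.ne_top
  have hN := h.isNoetherianRing
  set x : Fin (m + 1) → A := Fin.cons a b with hx
  have hrad : (Ideal.span (Set.range x)).radical = maximalIdeal A :=
    radical_span_cons_eq hg.left_mem (fun y hy => by
      obtain ⟨z, -, hz⟩ := hg.exists_mul_eq y hy y hy
      exact ⟨2, z, (pow_two y).trans hz⟩) hb
  have hradR : (Ideal.span (Set.range fun i => algebraMap A R (x i))).radical =
      maximalIdeal R := by
    rw [← h.radical_map_eq hg.ne_top hrad, Ideal.map_span, ← Set.range_comp]
    rfl
  have hreg : IsWeaklyRegular A (List.ofFn x).reverse :=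
    hA.1.isWeaklyRegular (by rw [hdim]; simp) (by rw [ofList_reverse, ofList_ofFn, hrad])
  have hquasi : IsQuasiRegular fun i => algebraMap A R (x i) := by
    refine IsTailRegular.isQuasiRegular (isTailRegular_of_isWeaklyRegular ?_)
    have h1 := h.isWeaklyRegular hreg (hg.isWeaklyRegular hreg)
    rwa [List.map_reverse, List.map_ofFn] at h1
  have hcyc := h.isCyclicSally hg b
  have h𝔏 := h.mem_comap_proj_iff hg b
  have hle : Ideal.span (Set.range fun i => algebraMap A R (x i)) ≤ maximalIdeal R :=
    hradR ▸ Ideal.le_radical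
  refine ⟨hloc, h.isCohenMacaulayLocalRing hg hA.1, m + 1, Nat.succ_pos m, h.canonicalIdeal hg,
    fun i => algebraMap A R (x i), h.canonicalIdeal_ne_top hg,
    h.isCanonicalModule_canonicalIdeal hg hA.1 hA.2, ⟨?_, hradR⟩,
    h.algebraMap_mem_canonicalIdeal hg hg.left_mem, ?_, span_sallyDegreeOne_eq_top hcyc⟩
  · rw [h.ringKrullDim_eq, hdim]
  · refine hasSallyRank_of_isCyclicSally hquasi hcyc h𝔏
      (sup_le (le_maximalIdeal (h.canonicalIdeal_ne_top hg)) hle) ?_ ?_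
    · have h1 : Ideal.span (Set.range fun i => algebraMap A R (x i)) ≤
          (I ⊔ Ideal.span (Set.range b)).comap h.proj := fun r hr =>
        (h𝔏 r).mpr (Ideal.mul_mem_left _ _ (Ideal.mem_sup_right hr))
      obtain ⟨k, hk⟩ := Ideal.exists_pow_le_of_le_radical_of_fg hradR.ge
        (IsNoetherian.noetherian (maximalIdeal R))
      exact ⟨k, hk.trans h1⟩
    · rw [h.length_quotient_comap_proj, hn]

end IsIdealExtension

end Goto

/-! ### The modules `Qᵏ/LQᵏ` -/

section HilbertFunction

variable {R : Type u} [CommRing R] {d : ℕ} (x : Fin d → R)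

/-- The `R`-linear combinations of the monomials of degree `k` in `x`. -/
def monomialCombination (k : ℕ) :
    ((Finset.finsuppAntidiag (Finset.univ : Finset (Fin d)) k) → R) →ₗ[R] R :=
  Fintype.linearCombination R fun e => ∏ i, x i ^ e.1 i

/-- The form of degree `k` with given coefficients. -/
def formOfCoeff {k : ℕ} (c : (Finset.finsuppAntidiag (Finset.univ : Finset (Fin d)) k) → R) :
    MvPolynomial (Fin d) R :=
  ∑ e, MvPolynomial.monomial e.1 (c e)

variable {x}

theorem sum_eq_of_mem_finsuppAntidiag {k : ℕ} {e : Fin d →₀ ℕ} :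
    e ∈ Finset.finsuppAntidiag (Finset.univ : Finset (Fin d)) k ↔ e.degree = k := by
  rw [Finset.mem_finsuppAntidiag, Finsupp.degree_eq_sum]
  simp

theorem formOfCoeff_isHomogeneous {k : ℕ}
    (c : (Finset.finsuppAntidiag (Finset.univ : Finset (Fin d)) k) → R) :
    (formOfCoeff c).IsHomogeneous k :=
  MvPolynomial.IsHomogeneous.sum _ _ _ fun e _ =>
    MvPolynomial.isHomogeneous_monomial _ (sum_eq_of_mem_finsuppAntidiag.mp e.2)

theorem coeff_formOfCoeff {k : ℕ}
    (c : (Finset.finsuppAntidiag (Finset.univ : Finset (Fin d)) k) → R)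
    (e : Finset.finsuppAntidiag (Finset.univ : Finset (Fin d)) k) :
    MvPolynomial.coeff e.1 (formOfCoeff c) = c e := by
  classical
  rw [formOfCoeff, MvPolynomial.coeff_sum, Finset.sum_eq_single e]
  · rw [MvPolynomial.coeff_monomial, if_pos rfl]
  · intro e' _ he
    rw [MvPolynomial.coeff_monomial, if_neg fun h => he (Subtype.ext h)]
  · simp

theorem eval_formOfCoeff {k : ℕ}
    (c : (Finset.finsuppAntidiag (Finset.univ : Finset (Fin d)) k) → R) :
    MvPolynomial.eval x (formOfCoeff c) = monomialCombination x k c := by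
  rw [formOfCoeff, map_sum, monomialCombination, Fintype.linearCombination_apply]
  refine Finset.sum_congr rfl fun e _ => ?_
  rw [MvPolynomial.eval_monomial, Finsupp.prod_fintype _ _ (by simp), smul_eq_mul]

theorem exists_monomialCombination_eq {k : ℕ} {r : R} (hr : r ∈ Ideal.span (Set.range x) ^ k) :
    ∃ c, monomialCombination x k c = r := by
  obtain ⟨F, hF, -, rfl⟩ := exists_isHomogeneous_eval_eq x ⊤ k (by rwa [Ideal.top_mul])
  refine ⟨fun e => MvPolynomial.coeff e.1 F, ?_⟩
  rw [← eval_formOfCoeff]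
  congr 1
  ext e
  by_cases he : e.degree = k
  · exact coeff_formOfCoeff _ ⟨e, sum_eq_of_mem_finsuppAntidiag.mpr he⟩
  · rw [hF.coeff_eq_zero he, (formOfCoeff_isHomogeneous _).coeff_eq_zero he]

theorem monomialCombination_mem_iff (hx : IsQuasiRegular x) {L : Ideal R}
    (hL : Ideal.span (Set.range x) ≤ L) {k : ℕ}
    (c : (Finset.finsuppAntidiag (Finset.univ : Finset (Fin d)) k) → R) :
    monomialCombination x k c ∈ L * Ideal.span (Set.range x) ^ k ↔ ∀ e, c e ∈ L := by
  rw [← eval_formOfCoeff]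
  constructor
  · intro h e
    rw [← coeff_formOfCoeff c]
    exact hx.coeff_mem hL (formOfCoeff_isHomogeneous c) h _
  · intro h
    refine eval_mem_mul_pow x _ (formOfCoeff_isHomogeneous c) fun e => ?_
    by_cases he : e.degree = k
    · have := coeff_formOfCoeff c ⟨e, sum_eq_of_mem_finsuppAntidiag.mpr he⟩
      rw [this]
      exact h _
    · rw [(formOfCoeff_isHomogeneous c).coeff_eq_zero he]
      exact zero_mem _

/-- By quasi-regularity `Qᵏ/LQᵏ` is free over `R/L` on the monomials of degree `k`. -/
theorem length_quotient_mul_pow (hx : IsQuasiRegular x) {L : Ideal R}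
    (hL : Ideal.span (Set.range x) ≤ L) (k : ℕ) :
    Module.length R (R ⧸ L * Ideal.span (Set.range x) ^ k) =
      ((Finset.finsuppAntidiag (Finset.univ : Finset (Fin d)) k).card : ℕ∞) *
        Module.length R (R ⧸ L) + Module.length R (R ⧸ Ideal.span (Set.range x) ^ k) := by
  set E := Finset.finsuppAntidiag (Finset.univ : Finset (Fin d)) k with hE
  let Φ : (E → R) →ₗ[R] R ⧸ L * Ideal.span (Set.range x) ^ k :=
    Submodule.mkQ _ ∘ₗ monomialCombination x k
  let Ψ : (E → R) →ₗ[R] (E → R ⧸ L) := LinearMap.pi fun e => L.mkQ ∘ₗ LinearMap.proj e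
  have hΨ : Function.Surjective Ψ := by
    intro y
    choose c hc using fun e => Submodule.Quotient.mk_surjective _ (y e)
    exact ⟨c, funext hc⟩
  have hker : LinearMap.ker Φ = LinearMap.ker Ψ := by
    ext c
    rw [LinearMap.mem_ker, LinearMap.mem_ker, LinearMap.comp_apply, Submodule.mkQ_apply,
      Submodule.Quotient.mk_eq_zero, monomialCombination_mem_iff hx hL, funext_iff]
    refine forall_congr' fun e => ?_
    exact (Submodule.Quotient.mk_eq_zero _).symm
  have hle : L * Ideal.span (Set.range x) ^ k ≤ Ideal.span (Set.range x) ^ k := Ideal.mul_le_right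
  have hexact : Function.Exact (LinearMap.range Φ).subtype (Submodule.factor hle) := by
    intro y
    obtain ⟨r, rfl⟩ := Submodule.Quotient.mk_surjective _ y
    change Submodule.Quotient.mk r = (0 : R ⧸ _) ↔ _
    rw [Submodule.Quotient.mk_eq_zero]
    constructor
    · intro hr
      obtain ⟨c, rfl⟩ := exists_monomialCombination_eq hr
      exact ⟨⟨_, c, rfl⟩, rfl⟩
    · rintro ⟨⟨_, c, rfl⟩, hc⟩
      have h1 : monomialCombination x k c - r ∈ L * Ideal.span (Set.range x) ^ k := by
        rw [← Submodule.Quotient.eq]; exact hc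
      have h2 : monomialCombination x k c ∈ Ideal.span (Set.range x) ^ k := by
        rw [← eval_formOfCoeff]
        exact eval_mem_pow x (formOfCoeff_isHomogeneous c)
      have h3 := sub_mem h2 (hle h1)
      rwa [sub_sub_cancel] at h3
  rw [Module.length_eq_add_of_exact _ _ (Submodule.subtype_injective _)
    (Submodule.factor_surjective hle) hexact]
  congr 1
  rw [← Φ.quotKerEquivRange.length_eq, (Submodule.quotEquivOfEq _ _ hker).length_eq,
    (Ψ.quotKerEquivOfSurjective hΨ).length_eq, Module.length_pi]
  congr 1
  simp

end HilbertFunction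

/-! ### Hilbert polynomial and multiplicity -/

section Multiplicity

variable {R : Type u} [CommRing R] {m : ℕ} {x : Fin (m + 1) → R}

theorem card_finsuppAntidiag_univ (m k : ℕ) :
    (Finset.finsuppAntidiag (Finset.univ : Finset (Fin (m + 1))) k).card = (k + m).choose m := by
  rw [Finset.card_finsuppAntidiag_nat_eq_choose, Finset.card_univ, Fintype.card_fin]
  have h1 : m + 1 + k - 1 = k + m := by omega
  rw [h1, Nat.choose_symm_add]

/-- Summing over the layers `Qⁱ/Qⁱ⁺¹`, with Pascal's rule. -/
theorem length_quotient_pow (hx : IsQuasiRegular x) {l : ℕ}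
    (hl : Module.length R (R ⧸ Ideal.span (Set.range x)) = l) (k : ℕ) :
    Module.length R (R ⧸ Ideal.span (Set.range x) ^ k) = ((k + m).choose (m + 1) * l : ℕ) := by
  induction k with
  | zero =>
    rw [zero_add, Nat.choose_succ_self, zero_mul, pow_zero, Ideal.one_eq_top]
    exact Module.length_eq_zero_iff.mpr (Ideal.Quotient.subsingleton_iff.mpr rfl)
  | succ k ih =>
    rw [pow_succ', length_quotient_mul_pow hx le_rfl, ih, hl, card_finsuppAntidiag_univ]
    have h1 : k + 1 + m = (k + m) + 1 := by omega
    rw [h1, Nat.choose_succ_succ' (k + m) m]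
    push_cast
    ring

/-- The multiplicity of an ideal `L` of reduction number one with a quasi-regular reduction `Q`
such that `ℓ(R/Q) = 2ℓ(R/L)`. -/
theorem isMultiplicity_of_sq_eq (hdim : ringKrullDim R = (m + 1 : ℕ)) (hx : IsQuasiRegular x)
    {L : Ideal R} (hL : Ideal.span (Set.range x) ≤ L)
    (hsq : L * L = Ideal.span (Set.range x) * L) {n : ℕ} (hn : Module.length R (R ⧸ L) = n)
    (hQ : Module.length R (R ⧸ Ideal.span (Set.range x)) = (2 * n : ℕ)) :
    IsMultiplicity L (2 * (n : ℤ)) := by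
  have hpow : ∀ k, L ^ (k + 1) = L * Ideal.span (Set.range x) ^ k := by
    intro k
    induction k with
    | zero => simp
    | succ k ih =>
      rw [pow_succ', ih, ← mul_assoc, hsq, pow_succ']
      ring
  -- With `L^(k+1) = LQᵏ` the length is `n·C(k+m, m) + 2n·C(k+m, m+1) = 2n·C(k+m+1, m+1) - n·C(k+m,
  -- m)`, so `e₀ = 2n`, `e₁ = n`, and the formula holds from `k = 0` on.
  refine ⟨m + 1, fun i => if i = 0 then 2 * n else if i = 1 then n else 0, ⟨hdim, 0, fun k _ => ?_⟩,
    by simp⟩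
  refine ⟨(k + m).choose m * n + (k + m).choose (m + 1) * (2 * n), ?_, ?_⟩
  · rw [hpow, length_quotient_mul_pow hx hL, length_quotient_pow hx hQ, hn,
      card_finsuppAntidiag_univ]
    push_cast
    rfl
  · rw [Finset.sum_range_succ', Finset.sum_range_succ', Finset.sum_eq_zero (fun i _ => by simp)]
    have h1 : k + (m + 1) - (0 + 1) = k + m := by omega
    have h2 : m + 1 - (0 + 1) = m := by omega
    have h3 : k + (m + 1) - 0 = (k + m) + 1 := by omega
    rw [h1, h2, h3, Nat.sub_zero, Nat.choose_succ_succ' (k + m) m]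
    push_cast
    simp
    ring

end Multiplicity

/-! ### Quasi-trivial extension, idealization and fiber product -/

section Examples

variable {A : Type u} [CommRing A] (I : Ideal A) (α : A)

namespace QuasiTrivialExtension

/-- The element `(s, x)` of the quasi-trivial extension. -/
def mk (s : A) (x : I) : QuasiTrivialExtension I α := ((s, x) : A × I)

variable {I α}

theorem mk_add_mk (s t : A) (x y : I) :
    (mk I α s x + mk I α t y) = mk I α (s + t) (x + y) := rfl

theorem mk_mul_mk (s t : A) (x y : I) :
    (mk I α s x * mk I α t y) = mk I α (s * t) (s • y + t • x + α • ((x : A) • y)) := rfl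

variable (I α)

/-- The inclusion of `A` into the quasi-trivial extension. -/
def inlHom : A →+* QuasiTrivialExtension I α where
  toFun s := mk I α s 0
  map_zero' := rfl
  map_one' := rfl
  map_add' s t := by rw [mk_add_mk, add_zero]
  map_mul' s t := by rw [mk_mul_mk]; simp

instance : Algebra A (QuasiTrivialExtension I α) := (inlHom I α).toAlgebra

theorem algebraMap_eq (s : A) : algebraMap A (QuasiTrivialExtension I α) s = mk I α s 0 := rfl

/-- The inclusion of `I` into the quasi-trivial extension. -/
def inrHom : I →ₗ[A] QuasiTrivialExtension I α where
  toFun x := mk I α 0 x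
  map_add' x y := by rw [mk_add_mk, add_zero]
  map_smul' s x := by rw [Algebra.smul_def, RingHom.id_apply, algebraMap_eq, mk_mul_mk]; simp

theorem inrHom_apply (x : I) : inrHom I α x = mk I α 0 x := rfl

theorem isIdealExtension : IsIdealExtension I α (inrHom I α) where
  bijective := by
    have h : ∀ p : A × I, algebraMap A (QuasiTrivialExtension I α) p.1 + inrHom I α p.2 = p := by
      intro p
      rw [algebraMap_eq, inrHom_apply, mk_add_mk, add_zero, zero_add]
      rfl
    exact ⟨fun p q hpq => (h p).symm.trans (hpq.trans (h q)), fun p => ⟨p, h p⟩⟩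
  mul x y := by
    rw [inrHom_apply, inrHom_apply, inrHom_apply, mk_mul_mk, mul_smul]
    simp

end QuasiTrivialExtension

theorem isIdealExtension_trivSqZeroExt :
    IsIdealExtension I 0 (TrivSqZeroExt.inrHom A I) where
  bijective := by
    have h : ∀ p : A × I, algebraMap A (TrivSqZeroExt A I) p.1 + TrivSqZeroExt.inrHom A I p.2 =
        TrivSqZeroExt.inl p.1 + TrivSqZeroExt.inr p.2 := fun p => rfl
    constructor
    · intro p q hpq
      dsimp only at hpq
      rw [h, h] at hpq
      refine Prod.ext ?_ ?_
      · simpa using congrArg TrivSqZeroExt.fst hpq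
      · simpa using congrArg TrivSqZeroExt.snd hpq
    · intro z
      exact ⟨(z.fst, z.snd), (h _).trans z.inl_fst_add_inr_snd_eq⟩
  mul x y := by
    rw [zero_mul, zero_smul, map_zero]
    exact TrivSqZeroExt.inr_mul_inr A x y

/-- The diagonal inclusion into the fiber product. -/
def fiberProductDiag : A →+* fiberProduct I :=
  ((RingHom.id A).prod (RingHom.id A)).codRestrict (fiberProduct I) fun _ => rfl

/-- The inclusion of `I` into the second factor of the fiber product. -/
def fiberProductInr :
    letI := (fiberProductDiag I).toAlgebra
    I →ₗ[A] fiberProduct I :=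
  letI := (fiberProductDiag I).toAlgebra
  { toFun := fun x => ⟨(0, (x : A)), by
      change Ideal.Quotient.mk I 0 = Ideal.Quotient.mk I x
      rw [map_zero, Ideal.Quotient.eq_zero_iff_mem.mpr x.2]⟩
    map_add' := fun x y => Subtype.ext (Prod.ext (add_zero 0).symm rfl)
    map_smul' := fun s x => Subtype.ext (Prod.ext (mul_zero s).symm rfl) }

/-- A pair `(s, t)` is the diagonal of `s` plus `(0, t - s)`, and `(0, x)(0, y) = (0, xy)`, whence
`α = 1`. -/
theorem isIdealExtension_fiberProduct :
    letI := (fiberProductDiag I).toAlgebra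
    IsIdealExtension I 1 (fiberProductInr I) := by
  let := (fiberProductDiag I).toAlgebra
  have h : ∀ p : A × I, ((algebraMap A (fiberProduct I) p.1 + fiberProductInr I p.2 :
      fiberProduct I) : A × A) = (p.1 + 0, p.1 + p.2) := fun p => rfl
  refine ⟨⟨fun p q hpq => ?_, fun z => ?_⟩, fun x y => ?_⟩
  · have h1 := congrArg Subtype.val hpq
    rw [h, h] at h1
    have h2 := congrArg Prod.fst h1
    have h3 := congrArg Prod.snd h1
    simp only [add_zero] at h2 h3
    refine Prod.ext h2 (Subtype.ext ?_)
    rwa [h2, add_right_inj] at h3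
  · obtain ⟨⟨s, t⟩, hst⟩ := z
    have h1 : t - s ∈ I := by
      rw [← Ideal.Quotient.eq]
      exact Eq.symm hst
    refine ⟨(s, ⟨t - s, h1⟩), Subtype.ext ?_⟩
    rw [h]
    simp
  · refine Subtype.ext (Prod.ext (mul_zero 0) ?_)
    change (x : A) * y = 1 * x * y
    ring

end Examples

/-! ### Conclusion -/

section Main

theorem IsGoodPair.sq_eq {A : Type u} [CommRing A] {I : Ideal A} {a : A} {m : ℕ} {c : A}
    (hg : IsGoodPair I a c) (b : Fin m → A) :
    (I ⊔ Ideal.span (Set.range b)) * (I ⊔ Ideal.span (Set.range b)) =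
      Ideal.span (Set.range (Fin.cons a b : Fin (m + 1) → A)) *
        (I ⊔ Ideal.span (Set.range b)) := by
  have haI : Ideal.span {a} ≤ I := (Ideal.span_singleton_le_iff_mem _).mpr hg.left_mem
  rw [span_range_cons]
  apply le_antisymm
  · conv_lhs => rw [Ideal.sup_mul, Ideal.mul_sup I]
    refine sup_le (sup_le ?_ ?_) (Ideal.mul_mono_left le_sup_right)
    · rw [Ideal.mul_le]
      intro x hx y hy
      obtain ⟨z, hz, hz'⟩ := hg.exists_mul_eq x hx y hy
      rw [hz']
      exact Ideal.mul_mem_mul (Ideal.mem_sup_left (Ideal.mem_span_singleton_self a))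
        (Ideal.mem_sup_left hz)
    · rw [mul_comm]
      exact Ideal.mul_mono le_sup_right le_sup_left
  · exact Ideal.mul_mono_left (sup_le_sup_right haI _)

open IsLocalRing RingTheory.Sequence

variable {A : Type u} [CommRing A] [IsLocalRing A] {I : Ideal A} {a : A} {m : ℕ}

/-- Elements of `I` are nilpotent modulo `a`, so `a` and the `bᵢ` form a system of parameters of
`A`. The order is left free because quasi-regularity needs the reversed list. -/
theorem isWeaklyRegular_of_isReduction (hA : IsCohenMacaulayLocalRing A)
    (hdim : ringKrullDim A = (m + 1 : ℕ)) (ha : IsReduction (Ideal.span {a}) I) {b : Fin m → A}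
    (hb : (I ⊔ Ideal.span (Set.range b)).radical = maximalIdeal A) {rs : List A}
    (hrs : rs.Perm (a :: List.ofFn b)) : IsWeaklyRegular A rs := by
  refine hA.isWeaklyRegular (by rw [hdim, hrs.length_eq]; simp) ?_
  have haI : a ∈ I := ha.1 (Ideal.mem_span_singleton_self a)
  rw [← radical_span_cons_eq haI (fun x hx => ?_) hb, span_range_cons, ← ofList_ofFn b,
    ← Ideal.ofList_cons]
  · congr 1
    rw [Ideal.ofList, Ideal.ofList]
    congr 1
    ext y
    exact hrs.mem_iff
  · obtain ⟨r, hr⟩ := ha.2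
    refine ⟨r + 1, Ideal.mem_span_singleton.mp (Ideal.mul_le_right (I := I ^ r) ?_)⟩
    rw [mul_comm, ← hr]
    exact Ideal.pow_mem_pow hx _

theorem exists_isGoodPair_of_isUlrichIdeal (hA : IsGorensteinLocalRing A)
    (hdim : ringKrullDim A = (m + 1 : ℕ)) (hI : IsUlrichIdeal I) (hht : I.height = 1)
    (ha : IsReduction (Ideal.span {a}) I) {b : Fin m → A} (hb : IsSystemOfParametersMod I b) :
    ∃ c, IsGoodPair I a c := by
  have := hA.1.1
  obtain ⟨⟨hItop, -⟩, hcm, ⟨s, hs, hainv⟩, hfree⟩ := hI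
  have hs1 : s = 1 := by
    rw [hht] at hs
    exact_mod_cast hs.symm
  subst hs1
  have hreg := isWeaklyRegular_of_isReduction hA.1 hdim ha hb.2 (List.Perm.refl _)
  have hnzd : ∀ x, a * x = 0 → x = 0 := fun x hx =>
    ((isWeaklyRegular_cons_iff A a _).mp hreg).1.right_eq_zero_of_smul hx
  have haI : a ∈ I := ha.1 (Ideal.mem_span_singleton_self a)
  obtain ⟨r, hr⟩ := ha.2
  obtain ⟨hsq, hne⟩ := sq_eq_and_ne_of_hasAInvariant_zero hItop hnzd haI hr hb hcm
    (by simpa using hainv)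
  exact exists_isGoodPair hItop haI hnzd hsq hfree hne hA.2

theorem exists_isMultiplicity_and_isGotoRing (hA : IsGorensteinLocalRing A)
    (hdim : ringKrullDim A = (m + 1 : ℕ)) (hI : IsUlrichIdeal I) (hht : I.height = 1)
    (ha : IsReduction (Ideal.span {a}) I) {b : Fin m → A} (hb : IsSystemOfParametersMod I b) :
    ∃ n : ℕ, IsMultiplicity (I ⊔ Ideal.span (Set.range b)) (2 * (n : ℤ)) ∧
      (∀ α : A, IsGotoRing n (QuasiTrivialExtension I α)) ∧
      IsGotoRing n (TrivSqZeroExt A I) ∧ IsGotoRing n (fiberProduct I) := by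
  have := hA.1.1
  obtain ⟨c, hg⟩ := exists_isGoodPair_of_isUlrichIdeal hA hdim hI hht ha hb
  obtain ⟨n, hn⟩ := ENat.ne_top_iff_exists.mp (length_quotient_ne_top hb.2)
  have hQ : Module.length A (A ⧸ Ideal.span (Set.range (Fin.cons a b : Fin (m + 1) → A))) =
      (2 * n : ℕ) := by
    have h1 := hg.length_quotient_eq
      (isWeaklyRegular_of_isReduction hA.1 hdim ha hb.2 (List.Perm.refl _))
    rw [ofList_ofFn, ← hn] at h1
    rw [span_range_cons, h1]
    push_cast
    rfl
  have hquasi : IsQuasiRegular (Fin.cons a b : Fin (m + 1) → A) := by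
    refine IsTailRegular.isQuasiRegular (isTailRegular_of_isWeaklyRegular
      (isWeaklyRegular_of_isReduction hA.1 hdim ha hb.2 ?_))
    rw [List.ofFn_succ]
    exact List.reverse_perm _
  refine ⟨n, isMultiplicity_of_sq_eq hdim hquasi ?_ (hg.sq_eq b) hn.symm hQ, fun α => ?_, ?_, ?_⟩
  · rw [span_range_cons]
    exact sup_le_sup_right ((Ideal.span_singleton_le_iff_mem _).mpr hg.left_mem) _
  · exact (QuasiTrivialExtension.isIdealExtension I α).isGotoRing hg hA hdim hb.2 hn.symm
  · exact (isIdealExtension_trivSqZeroExt I).isGotoRing hg hA hdim hb.2 hn.symm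
  · let := (fiberProductDiag I).toAlgebra
    exact (isIdealExtension_fiberProduct I).isGotoRing hg hA hdim hb.2 hn.symm

end Main

end GotoRing

end

theorem theorem10p4 {A : Type u} [CommRing A] [IsLocalRing A]
    (hA : GotoRing.IsGorensteinLocalRing A)
    (d : ℕ) (hd : 0 < d) (hdim : ringKrullDim A = d)
    (I : Ideal A) (hI : GotoRing.IsUlrichIdeal I) (hht : I.height = 1)
    (a₁ : A) (ha₁ : GotoRing.IsMinimalReduction (Ideal.span {a₁}) I)
    (b : Fin (d - 1) → A) (hb : GotoRing.IsSystemOfParametersMod I b) :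
    ∃ n : ℕ,
      GotoRing.IsMultiplicity (I ⊔ Ideal.span (Set.range b)) (2 * (n : ℤ)) ∧
      (∀ α : A, GotoRing.IsGotoRing n (GotoRing.QuasiTrivialExtension I α)) ∧
      GotoRing.IsGotoRing n (TrivSqZeroExt A I) ∧
      GotoRing.IsGotoRing n (GotoRing.fiberProduct I) := by
  -- With `d = m + 1`, the index type `Fin (d - 1)` of `b` is definitionally `Fin m`.
  obtain ⟨m, rfl⟩ := Nat.exists_eq_succ_of_ne_zero hd.ne'
  exact GotoRing.exists_isMultiplicity_and_isGotoRing (b := b) hA hdim hI hht ha₁.1 hb
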